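/- **Setting.** Write $\mathbf e(z)=e^{2\pi i z}$, $q=\mathbf e(\tau)$. Let $f$ be a meromorphic quasi-modular form of weight $k\in\mathbb Z$ and depth at most $p$ for $\mathrm{SL}_2(\mathbb Z)$: a meromorphic function on the upper half-plane with component functions $f_0,\dots,f_p$, meromorphic on the upper half-plane and at infinity, such that $(c\tau+d)^{-k}f\left(\frac{a\tau+b}{c\tau+d}\right)=\sum_{r=0}^p f_r(\tau)\left(\frac{c}{c\tau+d}\right)^r$ for all $\begin{pmatrix}a&b\\c&d\end{pmatrix}\in\mathrm{SL}_2(\mathbb Z)$ (so $f_0=f$). *Regularized integrals.* $\int_T^{\infty,*}g(t)\,dt$ for $g$ without poles on $[T,\infty)$ is the limit, as $w\to0$ in the first quadrant, of the analytic continuation along the first quadrant of $\int_T^\infty e^{-wt}g(t)\,dt$ ($\operatorname{Re}w$ large); $\int_0^{T,*}g(t)\,dt=\int_{1/T}^{\infty,*}t^{-2}g(1/t)\,dt$. Across a pole $c\in(a,b)$, $\int_a^{b,*}g(t)\,dt$ is the constant term at $z=0$ of the meromorphic continuation of $\int_a^b|t-c|^z g(t)\,dt$. With finitely many poles, the interval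 is cut into pieces with one pole each and two pole-free ends, and the values are added. The complete $L$-function is $\Lambda(f,s)=\int_0^{\infty,*}f(it)t^{s-1}\,dt$, where the integrals over the end intervals near $0$ and near $\infty$ are taken for $\operatorname{Re}s$ large, respectively $-\operatorname{Re}s$ large, and then continued meromorphically in $s$. *Pole terms.* For $T>0$ and a meromorphic function $g$ on the upper half-plane, let $\alpha$ run over the poles of $g$ with $-\frac12\le\operatorname{Re}\alpha<\frac12$, $\operatorname{Im}\alpha\ge T$, and let $\sum_{m=1}^{\operatorname{ord}_g\alpha}c_{g,\alpha}(m)(\tau-\alpha)^{-m}$ be the principal part of $g$ at $\alpha$. With $\mathrm{Li}_{-m}(z)=\left(z\frac{d}{dz}\right)^m\frac{z}{1-z}$ put $$\tilde g_T(\tau)=g(\tau)-\sum_\alpha\sum_{m=1}^{\operatorname{ord}_g\alpha}\frac{(-2\pi i)^m}{(m-1)!}c_{g,\alpha}(m)\,\mathrm{Li}_{1-m}(\mathbf e(\tau-\alpha)),$$ $$G_m(s,\alpha,T)=\int_T^{\infty,*}\mathrm{Li}_{-m}(\mathbf e(it-\alpha))\,t^{s-1}\,dt,\qquad I(g,s,T)=\sum_\alpha\sum_{m=1}^{\operatorname{ord}_g\alpha}\frac{(-2\pi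 i)^m}{(m-1)!}c_{g,\alpha}(m)\,G_{m-1}(s,\alpha,T).$$ Let $\tilde a_{g,T}(n)=\int_0^1\tilde g_T(x+iT)\,\mathbf e(-n(x+iT))\,dx$. Finally $\Gamma(s,x)=\int_x^\infty t^{s-1}e^{-t}dt$ is the upper incomplete gamma function; for $x=2\pi nT$ with $n<0$, both $\Gamma(s,x)$ and $(2\pi n)^s$ are taken with argument $\pi$, i.e. continued from $x>0$ through the upper half-plane. **Theorem.** Let $t_0>0$ be such that none of $f_0,\dots,f_p$ has a pole at $i/t_0$ (then $f$ has no pole at $it_0$ either). Then $\Lambda(f,s)$ exists as a meromorphic function of $s\in\mathbb C$. For $(g,T)=(f,t_0)$, $(f,t_0^{-1})$ and $(f_r,t_0^{-1})$, $1\le r\le p$, one has $\tilde g_T(\tau)=\sum_{n\gg-\infty}\tilde a_{g,T}(n)q^n$ for $\operatorname{Im}\tau\ge T$ (removable singularities being filled in). All series below converge absolutely for every $s\in\mathbb C$, and $$\begin{aligned}\Lambda(f,s)=&-\left(\tilde a_{f,t_0}(0)\frac{t_0^s}{s}+\tilde a_{f,t_0^{-1}}(0)\frac{i^kt_0^{s-k}}{k-s}\right)\\&+\sum_{n\ne0}\tilde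 a_{f,t_0}(n)\frac{\Gamma(s,2\pi nt_0)}{(2\pi n)^s}+i^k\sum_{n\neq0}\tilde a_{f,t_0^{-1}}(n)\frac{\Gamma(k-s,2\pi n/t_0)}{(2\pi n)^{k-s}}\\&+I(f,s,t_0)+i^kI(f,k-s,t_0^{-1})\\&+\sum_{r=1}^p i^{k-r}\left(-\frac{\tilde a_{f_r,t_0^{-1}}(0)\,t_0^{-(k-r-s)}}{k-r-s}+\sum_{n\ne0}\tilde a_{f_r,t_0^{-1}}(n)\frac{\Gamma(k-r-s,2\pi n/t_0)}{(2\pi n)^{k-r-s}}+I(f_r,k-r-s,t_0^{-1})\right)\end{aligned}$$ for every $s\in\mathbb C$ at which every fraction in this formula with denominator $s$, $k-s$ or $k-r-s$ ($1\le r\le p$) has either nonzero denominator or zero coefficient $\tilde a(0)$, the term being read as $0$ in the latter case. -/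

import Mathlib

open Complex MeasureTheory Filter Topology
open scoped Real

noncomputable section

namespace QMF

/-- The open upper half-plane, as a subset of `ℂ`. -/
def upperHalf : Set ℂ := {τ | 0 < τ.im}

/-- `e(z) = exp(2πiz)`. -/
def e (z : ℂ) : ℂ := exp (2 * π * I * z)

/-! ### Meromorphic quasi-modular forms

A meromorphic function is represented by a function `ℂ → ℂ`; its values on a discrete set
(for instance at the poles) carry no information, so identities between meromorphic functions
are required off a discrete closed subset of the domain only. -/

/-- Meromorphic at infinity: for large imaginary part, `f` is a function of `q = e(τ)`
that is meromorphic at `q = 0`. -/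
def MeromorphicAtInfinity (f : ℂ → ℂ) : Prop :=
  ∃ (φ : ℂ → ℂ) (Y : ℝ), 0 < Y ∧ MeromorphicAt φ 0 ∧
    f =ᶠ[codiscreteWithin {τ : ℂ | Y < τ.im}] fun τ => φ (e τ)

/-- `f` is a meromorphic quasi-modular form of weight `k` and depth at most `p` for `SL₂(ℤ)`,
with component functions `F 0, …, F p` (the values `F r` for `r > p` are irrelevant). -/
structure IsMeromorphicQuasimodular (k : ℤ) (p : ℕ) (f : ℂ → ℂ) (F : ℕ → ℂ → ℂ) : Prop where
  meromorphic : MeromorphicOn f upperHalf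
  component_meromorphic : ∀ r ≤ p, MeromorphicOn (F r) upperHalf
  component_atInfinity : ∀ r ≤ p, MeromorphicAtInfinity (F r)
  transform : ∀ γ : Matrix.SpecialLinearGroup (Fin 2) ℤ,
    (fun τ : ℂ => ((γ 1 0 : ℂ) * τ + (γ 1 1 : ℂ)) ^ (-k) *
        f (((γ 0 0 : ℂ) * τ + (γ 0 1 : ℂ)) / ((γ 1 0 : ℂ) * τ + (γ 1 1 : ℂ))))
      =ᶠ[codiscreteWithin upperHalf]
    fun τ => ∑ r ∈ Finset.range (p + 1),
      F r τ * ((γ 1 0 : ℂ) / ((γ 1 0 : ℂ) * τ + (γ 1 1 : ℂ))) ^ r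

/-! ### Special functions -/

/-- The polylogarithm `Li_{-m}` of order `-m`, `m ≥ 0`, as the rational function
`(z d/dz)^m (z / (1 - z))`. -/
def polylogNeg (m : ℕ) : ℂ → ℂ :=
  (fun (g : ℂ → ℂ) (z : ℂ) => z * deriv g z)^[m] (fun z => z / (1 - z))

/-- The upper incomplete gamma function `Γ(s, x) = ∫_x^∞ t^(s-1) e^(-t) dt` for real `x ≠ 0` and
all `s ∈ ℂ`. The path of integration is the ray `x + (1 + i) u`, `u ≥ 0`, and `t^(s-1)` is the
principal power. For `x > 0` this is the usual function; for `x < 0` it is the value of the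
continuation from `x > 0` through the upper half-plane, i.e. the branch with `arg x = π`. -/
def upperGamma (s : ℂ) (x : ℝ) : ℂ :=
  (1 + I) * ∫ u in Set.Ioi (0 : ℝ),
    ((x : ℂ) + (1 + I) * u) ^ (s - 1) * exp (-((x : ℂ) + (1 + I) * u))

/-! ### Poles, principal parts, and removal of poles -/

/-- The order of the pole of `f` at `α` (zero if `α` is not a pole). -/
def poleOrder (f : ℂ → ℂ) (α : ℂ) : ℕ := (-(meromorphicOrderAt f α).untop₀).toNat

/-- The coefficient `c_{f,α}(m)` of `(τ - α)^(-m)` in the Laurent expansion of `f` at `α`, for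
`1 ≤ m ≤ N = poleOrder f α`: the Taylor coefficient of index `N - m` at `α` of the function
`(τ - α)^N f(τ)`, whose singularity at `α` is removed. -/
def polarCoeff (f : ℂ → ℂ) (α : ℂ) (m : ℕ) : ℂ :=
  iteratedDeriv (poleOrder f α - m)
    (toMeromorphicNFAt (fun z => (z - α) ^ poleOrder f α * f z) α) α /
    ((poleOrder f α - m).factorial : ℂ)

/-- The poles of `f` in the half-strip `-1/2 ≤ Re τ < 1/2`, `Im τ ≥ T`. -/
def stripPoles (f : ℂ → ℂ) (T : ℝ) : Set ℂ :=
  {α | -(1 / 2) ≤ α.re ∧ α.re < 1 / 2 ∧ T ≤ α.im ∧ 0 < poleOrder f α}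

/-- `P_α(f)`: the periodic function, built from polylogarithms, with the principal part of `f`
at `α`. -/
def polePart (f : ℂ → ℂ) (α τ : ℂ) : ℂ :=
  ∑ m ∈ Finset.Icc 1 (poleOrder f α),
    (-2 * π * I) ^ m / ((m - 1).factorial : ℂ) * polarCoeff f α m *
      polylogNeg (m - 1) (e (τ - α))

/-- `f` with its poles in the half-strip of height at least `T` removed. -/
def removePoles (f : ℂ → ℂ) (T : ℝ) (τ : ℂ) : ℂ :=
  f τ - ∑ᶠ α ∈ stripPoles f T, polePart f α τ

/-- `g(τ) = ∑ a(n) q^n` on `Im τ ≥ T`, with finitely many negative exponents. Points at which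
`g` is not analytic (removable singularities with an irrelevant value) are left out. -/
def IsFourierExpansion (g : ℂ → ℂ) (T : ℝ) (a : ℤ → ℂ) : Prop :=
  (∃ N : ℤ, ∀ n < N, a n = 0) ∧
    ∀ τ : ℂ, T ≤ τ.im → AnalyticAt ℂ g τ → HasSum (fun n : ℤ => a n * e (n * τ)) (g τ)

/-- The `n`-th Fourier coefficient of `removePoles f T`. -/
def tildeCoeff (f : ℂ → ℂ) (T : ℝ) (n : ℤ) : ℂ :=
  ∫ x in (0 : ℝ)..1, removePoles f T (x + T * I) * e (-(n * (x + T * I)))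

/-! ### Regularized integrals -/

/-- The regularized integral of `g` over `(T, ∞)` is `v`: the Laplace integral
`∫_T^∞ e^(-wt) g(t) dt` converges for `Re w > σ`, continues analytically along the first quadrant,
and tends to `v` as `w → 0`. Thus possible branch points on the positive real axis are passed from
above. -/
def HasRegIntegralAtInfinity (g : ℝ → ℂ) (T : ℝ) (v : ℂ) : Prop :=
  ∃ (σ : ℝ) (L : ℂ → ℂ), 0 < σ ∧
    (∀ w : ℂ, σ < w.re → IntegrableOn (fun t : ℝ => exp (-w * t) * g t) (Set.Ioi T) ∧
      L w = ∫ t in Set.Ioi T, exp (-w * t) * g t) ∧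
    AnalyticOnNhd ℂ L {w | σ < w.re ∨ (0 < w.re ∧ 0 < w.im)} ∧
    Tendsto L (𝓝[{w : ℂ | 0 < w.re ∧ 0 < w.im}] 0) (𝓝 v)

/-- The regularized integral of `g` over `(0, T)` is `v`, by the reflection `t ↦ 1/t`. -/
def HasRegIntegralAtZero (g : ℝ → ℂ) (T : ℝ) (v : ℂ) : Prop :=
  HasRegIntegralAtInfinity (fun t => (1 / (t : ℂ) ^ 2) * g (1 / t)) T⁻¹ v

/-- `v` is the constant term of the Laurent expansion of `R` at `0`. -/
def IsConstantTerm (R : ℂ → ℂ) (v : ℂ) : Prop :=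
  ∃ (N : ℕ) (c : ℕ → ℂ) (h : ℂ → ℂ), AnalyticAt ℂ h 0 ∧ h 0 = v ∧
    ∀ᶠ z in 𝓝[≠] (0 : ℂ), R z = ∑ j ∈ Finset.range N, c j / z ^ (j + 1) + h z

/-- The regularized integral of `g` from `a` to `b`, with at most one pole `c` in between, is `v`:
the constant term at `z = 0` of the meromorphic continuation of `∫_a^b |t - c|^z g(t) dt`. -/
def HasHadamardIntegral (g : ℝ → ℂ) (a c b : ℝ) (v : ℂ) : Prop :=
  a < c ∧ c < b ∧ ∃ (σ δ : ℝ) (R : ℂ → ℂ), 0 < δ ∧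
    MeromorphicOn R {z | -δ < z.re} ∧
    (∀ z : ℂ, σ < z.re → IntegrableOn (fun t : ℝ => ((|t - c| : ℝ) : ℂ) ^ z * g t) (Set.Ioc a b) ∧
      R z = ∫ t in a..b, ((|t - c| : ℝ) : ℂ) ^ z * g t) ∧
    IsConstantTerm R v

/-- The regularized integral of `g` over `(T, ∞)` is `v`, where `g` may have finitely many poles
in `(T, ∞)`: these are separated by break points `T = a 0 < a 1 < ⋯ < a n`. -/
def HasRegIntegralIoi (g : ℝ → ℂ) (T : ℝ) (v : ℂ) : Prop :=
  ∃ (n : ℕ) (a c : ℕ → ℝ) (u : ℕ → ℂ) (u' : ℂ), a 0 = T ∧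
    (∀ i < n, HasHadamardIntegral g (a i) (c i) (a (i + 1)) (u i)) ∧
    HasRegIntegralAtInfinity g (a n) u' ∧
    v = ∑ i ∈ Finset.range n, u i + u'

open Classical in
/-- The regularized integral `∫_T^{∞,*} g(t) dt` (zero if it does not exist). -/
def regIntegralIoi (g : ℝ → ℂ) (T : ℝ) : ℂ :=
  if h : ∃ v, HasRegIntegralIoi g T v then h.choose else 0

/-- `G_m(s, α, T) = ∫_T^{∞,*} Li_{-m}(e(it - α)) t^(s-1) dt`. -/
def G (m : ℕ) (s α : ℂ) (T : ℝ) : ℂ :=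
  regIntegralIoi (fun t => polylogNeg m (e (I * t - α)) * (t : ℂ) ^ (s - 1)) T

/-- `I(f, s, T)`: the contribution of the poles of `f` in the half-strip of height at least `T`. -/
def poleTerm (f : ℂ → ℂ) (s : ℂ) (T : ℝ) : ℂ :=
  ∑ᶠ α ∈ stripPoles f T, ∑ m ∈ Finset.Icc 1 (poleOrder f α),
    (-2 * π * I) ^ m / ((m - 1).factorial : ℂ) * polarCoeff f α m * G (m - 1) s α T

/-- `Λ(s) = ∫_0^{∞,*} f(it) t^(s-1) dt`. The poles of `f(it)` in `(0, ∞)` are separated by break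
points `0 < a 0 < ⋯ < a n`. Because of the constant Fourier coefficients, the regularized integrals
over `(0, a 0)` and `(a n, ∞)` are defined directly only for `Re s` large and for `-Re s` large,
respectively; `A` and `B` are their meromorphic continuations in `s`. The meromorphic function `Λ`
is taken in normal form: analytic except at its poles, and zero there. -/
def IsCompletedL (f Λ : ℂ → ℂ) : Prop :=
  MeromorphicNFOn Λ Set.univ ∧
  ∃ (n : ℕ) (a c : ℕ → ℝ) (A B : ℂ → ℂ) (H : ℕ → ℂ → ℂ) (σ : ℝ), 0 < a 0 ∧
    MeromorphicOn A Set.univ ∧ MeromorphicOn B Set.univ ∧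
    (∀ s : ℂ, σ < s.re →
      HasRegIntegralAtZero (fun t => f (I * t) * (t : ℂ) ^ (s - 1)) (a 0) (A s)) ∧
    (∀ s : ℂ, s.re < -σ →
      HasRegIntegralAtInfinity (fun t => f (I * t) * (t : ℂ) ^ (s - 1)) (a n) (B s)) ∧
    (∀ i < n, ∀ s : ℂ,
      HasHadamardIntegral (fun t => f (I * t) * (t : ℂ) ^ (s - 1)) (a i) (c i) (a (i + 1))
        (H i s)) ∧
    Λ =ᶠ[codiscrete ℂ] fun s => A s + ∑ i ∈ Finset.range n, H i s + B s

open Classical in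
/-- The complete L-function `Λ(f, ·)` (zero if it does not exist). -/
def completedL (f : ℂ → ℂ) : ℂ → ℂ :=
  if h : ∃ Λ, IsCompletedL f Λ then h.choose else 0

/-- The term `a(n) Γ(s, 2πnT) / (2πn)^s`, `n ≠ 0`, with `arg n = π` for `n < 0`. -/
def gammaTerm (a : ℤ → ℂ) (s : ℂ) (T : ℝ) (n : {n : ℤ // n ≠ 0}) : ℂ :=
  a n * upperGamma s (2 * π * (n : ℤ) * T) / ((2 * π * (n : ℤ) : ℝ) : ℂ) ^ s

end QMF

end

/-! The Mellin integral of f(it) is cut at t₀. Above the cut, subtract from f the periodic functions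
`polePart`, which are combinations of polylogarithms in e(τ - α) with the same principal parts as f
at its finitely many poles in the half-strip Im τ ≥ t₀. The difference has only removable
singularities on some half-plane Im τ > T' with T' < t₀, has period 1 and is meromorphic in q at q =
0. So it is a Fourier series with finitely many negative exponents
(`IsPeriodicMeromorphic.exists_fourier`), and it can be integrated term by term over (t₀, ∞).
Positive exponents converge absolutely and give incomplete gamma functions. The finitely many
negative ones need the regularization: the Laplace integral of an exponential times a power is
continued by turning the ray of integration, which gives the branch with argument π
(`hasRegIntegralAtInfinity_exp_mul_cpow`). The constant term gives -t₀^s/s, first for Re s < 0. The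
subtracted polylogarithms give the functions G. This is `IsPeriodicMeromorphic.mellin_halfLine`; its
value is `halfLineMellin`.

Below the cut, t ↦ 1/t and the matrix S turn f(i/t) into the sum over r of f_r(it)(it)^(k-r). So (0,
t₀) contributes i^(k-r) times the half-line contribution of f_r at 1/t₀, evaluated at k-r-s. For
this the components must have period 1 as well; a Vandermonde argument derives that from the
transformation law (`component_add_one`).

The rest shows that the regularized integrals do not depend on the choices in their definitions.
Across a pole, the Hadamard integral is the difference of the end values of a finite-part primitive,
a function of the form κ log|t - c| plus a meromorphic one (`hasHadamardIntegral_of_primitive`).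
Hence values over adjacent intervals add up, and any two systems of break points have a common
refinement. A break point cannot be a pole, since 1/(t - x) is not integrable. Values at infinity
are unique by the identity theorem in the Laplace variable w, and the continuations in s by the
identity theorem in s.

Compact pieces are entire in s: near a pole the finite part is the mean of two semicircle integrals
that stay away from the pole (`exists_entire_hasFP`). Therefore both sides of the formula are
meromorphic and agree near every point outside a discrete set. As Λ is in normal form, they agree
wherever the right-hand side is analytic. -/

noncomputable section

namespace QMF

/-! ### Parametric integrals -/

/-- A locally dominated parametric integral of holomorphic functions is holomorphic. -/
theorem differentiableOn_integral_param {α : Type*} [MeasurableSpace α] {μ : Measure α}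
    {F : ℂ → α → ℂ} {U : Set ℂ} (hU : IsOpen U)
    (hm : ∀ z ∈ U, AEStronglyMeasurable (F z) μ)
    (hd : ∀ᵐ x ∂μ, DifferentiableOn ℂ (fun z => F z x) U)
    (hb : ∀ z₀ ∈ U, ∃ r > 0, ∃ B : α → ℝ, Integrable B μ ∧
      ∀ᵐ x ∂μ, ∀ z ∈ Metric.ball z₀ r, z ∈ U → ‖F z x‖ ≤ B x) :
    DifferentiableOn ℂ (fun z => ∫ x, F z x ∂μ) U := by
  intro z₀ hz₀
  obtain ⟨r₁, hr₁, B, hB, hbd⟩ := hb z₀ hz₀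
  obtain ⟨r₂, hr₂, hball⟩ := Metric.isOpen_iff.1 hU z₀ hz₀
  set r := min r₁ r₂ with hr
  have hr0 : 0 < r := lt_min hr₁ hr₂
  have hsub : Metric.ball z₀ r ⊆ U := (Metric.ball_subset_ball (min_le_right _ _)).trans hball
  have hbd' : ∀ᵐ x ∂μ, ∀ z ∈ Metric.ball z₀ r, ‖F z x‖ ≤ B x := by
    filter_upwards [hbd] with x hx z hz
    exact hx z (Metric.ball_subset_ball (min_le_left _ _) hz) (hsub hz)
  have key := hasDerivAt_integral_of_dominated_loc_of_deriv_le (μ := μ) (F := F)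
    (F' := fun z x => deriv (fun z => F z x) z) (x₀ := z₀) (s := Metric.ball z₀ (r / 2))
    (bound := fun x => B x / (r / 4)) (Metric.ball_mem_nhds _ (by positivity)) ?_ ?_ ?_ ?_ ?_ ?_
  · exact key.2.differentiableAt.differentiableWithinAt
  · filter_upwards [hU.mem_nhds hz₀] with z hz using hm z hz
  · refine hB.mono' (hm z₀ hz₀) ?_
    filter_upwards [hbd'] with x hx using hx z₀ (Metric.mem_ball_self hr0)
  -- Measurability of the z-derivative at z₀: it is an a.e. limit of difference quotients along
  -- increments shorter than r, which keep z₀ + h n inside U.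
  · set h : ℕ → ℂ := fun n => ((r / 2 : ℝ) : ℂ) / (n + 1) with hh
    have hh0 : ∀ n, h n ≠ 0 := by
      intro n
      have : ((n : ℂ) + 1) ≠ 0 := by exact_mod_cast Nat.succ_ne_zero n
      simp only [hh]
      exact div_ne_zero (by exact_mod_cast (by positivity : (r / 2 : ℝ) ≠ 0)) this
    have hhn : ∀ n, ‖h n‖ < r := by
      intro n
      simp only [hh]
      rw [norm_div, Complex.norm_real]
      have : ‖(n : ℂ) + 1‖ = n + 1 := by
        rw [← Nat.cast_one, ← Nat.cast_add, Complex.norm_natCast]; push_cast; ring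
      rw [this, Real.norm_of_nonneg (by positivity), div_lt_iff₀ (by positivity)]
      nlinarith [Nat.cast_nonneg (α := ℝ) n]
    have htend : Tendsto h atTop (𝓝[≠] 0) := by
      refine tendsto_nhdsWithin_iff.2 ⟨?_, Eventually.of_forall hh0⟩
      have := (tendsto_one_div_add_atTop_nhds_zero_nat (𝕜 := ℂ)).const_mul ((r / 2 : ℝ) : ℂ)
      simpa only [hh, mul_one_div, mul_zero] using this
    refine aestronglyMeasurable_of_tendsto_ae (u := atTop)
      (f := fun n x => (h n)⁻¹ • (F (z₀ + h n) x - F z₀ x)) ?_ ?_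
    · intro n
      have hn : z₀ + h n ∈ U := hsub (by simpa using hhn n)
      exact ((hm _ hn).sub (hm _ hz₀)).const_smul (h n)⁻¹
    · filter_upwards [hd] with x hx
      have hda : HasDerivAt (fun z => F z x) (deriv (fun z => F z x) z₀) z₀ :=
        (hx.differentiableAt (hU.mem_nhds hz₀)).hasDerivAt
      exact (hasDerivAt_iff_tendsto_slope_zero.1 hda).comp htend
  -- Cauchy's estimate on the circle of radius r/4 about z, which stays in the ball of radius r
  -- because z lies in the one of radius r/2.
  · filter_upwards [hd, hbd'] with x hx hxb z hz
    refine Complex.norm_deriv_le_of_forall_mem_sphere_norm_le (by positivity) ?_ ?_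
    · have : Metric.closedBall z (r / 4) ⊆ Metric.ball z₀ r := by
        intro w hw
        rw [Metric.mem_closedBall] at hw
        rw [Metric.mem_ball] at hz ⊢
        linarith [dist_triangle w z z₀]
      exact ((hx.mono hsub).mono this).diffContOnCl_ball subset_rfl
    · intro w hw
      apply hxb
      rw [mem_sphere_iff_norm, ← dist_eq_norm] at hw
      rw [Metric.mem_ball] at hz ⊢
      linarith [dist_triangle w z z₀]
  · exact hB.div_const _
  · filter_upwards [hd] with x hx z hz
    have hzU : z ∈ U := hsub (Metric.ball_subset_ball (by linarith) hz)
    exact (hx.differentiableAt (hU.mem_nhds hzU)).hasDerivAt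

/-! ### The identity theorem for meromorphic functions -/

/-- On a connected set the order of A - B is infinite either everywhere or nowhere. -/
theorem MeromorphicOn.eventuallyEq_of_isPreconnected {A B : ℂ → ℂ} {U : Set ℂ}
    (hA : MeromorphicOn A U) (hB : MeromorphicOn B U) (hU : IsPreconnected U) {x y : ℂ}
    (hx : x ∈ U) (hy : y ∈ U) (h : A =ᶠ[𝓝[≠] x] B) : A =ᶠ[𝓝[≠] y] B := by
  have hD : MeromorphicOn (A - B) U := hA.sub hB
  have hx' : meromorphicOrderAt (A - B) x = ⊤ := by
    rw [meromorphicOrderAt_eq_top_iff]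
    filter_upwards [h] with z hz
    simp [hz]
  have hy' : meromorphicOrderAt (A - B) y = ⊤ := by
    by_contra hne
    exact (hD.meromorphicOrderAt_ne_top_of_isPreconnected hU hy hx hne) hx'
  rw [meromorphicOrderAt_eq_top_iff] at hy'
  filter_upwards [hy'] with z hz
  simpa [sub_eq_zero] using hz

/-! ### Regularized integrals at infinity -/

/-- The domain of the continued Laplace integral. -/
def laplaceDomain (σ : ℝ) : Set ℂ := {w | σ < w.re ∨ (0 < w.re ∧ 0 < w.im)}

theorem laplaceDomain_mono {σ σ' : ℝ} (h : σ ≤ σ') : laplaceDomain σ' ⊆ laplaceDomain σ := by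
  intro w hw
  rcases hw with hw | hw
  · exact Or.inl (h.trans_lt hw)
  · exact Or.inr hw

theorem isOpen_laplaceDomain (σ : ℝ) : IsOpen (laplaceDomain σ) := by
  refine (isOpen_lt continuous_const continuous_re).union
    ((isOpen_lt continuous_const continuous_re).inter (isOpen_lt continuous_const continuous_im))

theorem isPreconnected_laplaceDomain (σ : ℝ) : IsPreconnected (laplaceDomain σ) := by
  have h1 : Convex ℝ {w : ℂ | σ < w.re} := convex_halfSpace_re_gt σ
  have h2 : Convex ℝ {w : ℂ | 0 < w.re ∧ 0 < w.im} :=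
    (convex_halfSpace_re_gt 0).inter (convex_halfSpace_im_gt 0)
  refine IsPreconnected.union (⟨max σ 0 + 1, 1⟩ : ℂ) ?_ ?_ h1.isPreconnected h2.isPreconnected
  · show σ < max σ 0 + 1
    linarith [le_max_left σ 0]
  · refine ⟨?_, ?_⟩
    · show 0 < max σ 0 + 1
      linarith [le_max_right σ 0]
    · show (0 : ℝ) < 1
      norm_num

instance neBot_firstQuadrant : (𝓝[{w : ℂ | 0 < w.re ∧ 0 < w.im}] (0 : ℂ)).NeBot := by
  have key : ∀ x : ℝ, 0 < x → (x : ℂ) * (1 + I) ∈ {w : ℂ | 0 < w.re ∧ 0 < w.im} :=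
    fun x hx => ⟨by simpa using hx, by simpa using hx⟩
  rw [← mem_closure_iff_nhdsWithin_neBot, mem_closure_iff_seq_limit]
  refine ⟨fun n => ((1 / ((n : ℝ) + 1) : ℝ) : ℂ) * (1 + I), ?_, ?_⟩
  · intro n
    exact key _ (by positivity)
  · have h := (continuous_ofReal.tendsto 0).comp
      (tendsto_one_div_add_atTop_nhds_zero_nat (𝕜 := ℝ))
    have := h.mul_const (1 + I)
    simpa using this

namespace HasRegIntegralAtInfinity

variable {g g₁ g₂ : ℝ → ℂ} {T : ℝ} {v v₁ v₂ : ℂ}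

/-- This permits replacing f by its normal form later on, since the two differ on a discrete set
only. -/
theorem congr_ae (h : HasRegIntegralAtInfinity g₁ T v)
    (hg : g₁ =ᵐ[volume.restrict (Set.Ioi T)] g₂) : HasRegIntegralAtInfinity g₂ T v := by
  obtain ⟨σ, L, hσ, hL, ha, ht⟩ := h
  refine ⟨σ, L, hσ, fun w hw => ?_, ha, ht⟩
  have hae : (fun t : ℝ => exp (-w * t) * g₁ t) =ᵐ[volume.restrict (Set.Ioi T)]
      fun t : ℝ => exp (-w * t) * g₂ t := by
    filter_upwards [hg] with t ht
    rw [ht]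
  exact ⟨(hL w hw).1.congr hae, (hL w hw).2.trans (integral_congr_ae hae)⟩

theorem add (h₁ : HasRegIntegralAtInfinity g₁ T v₁) (h₂ : HasRegIntegralAtInfinity g₂ T v₂) :
    HasRegIntegralAtInfinity (fun t => g₁ t + g₂ t) T (v₁ + v₂) := by
  obtain ⟨σ₁, L₁, hσ₁, hL₁, ha₁, ht₁⟩ := h₁
  obtain ⟨σ₂, L₂, hσ₂, hL₂, ha₂, ht₂⟩ := h₂
  refine ⟨max σ₁ σ₂, fun w => L₁ w + L₂ w, lt_max_of_lt_left hσ₁, fun w hw => ?_, ?_,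
    ht₁.add ht₂⟩
  · have h1 := hL₁ w ((le_max_left _ _).trans_lt hw)
    have h2 := hL₂ w ((le_max_right _ _).trans_lt hw)
    simp only [mul_add]
    exact ⟨h1.1.add h2.1, by rw [h1.2, h2.2, integral_add h1.1 h2.1]⟩
  · exact (ha₁.mono (laplaceDomain_mono (le_max_left _ _))).add
      (ha₂.mono (laplaceDomain_mono (le_max_right _ _)))

theorem const_mul (h : HasRegIntegralAtInfinity g T v) (c : ℂ) :
    HasRegIntegralAtInfinity (fun t => c * g t) T (c * v) := by
  obtain ⟨σ, L, hσ, hL, ha, ht⟩ := h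
  refine ⟨σ, fun w => c * L w, hσ, fun w hw => ?_, fun w hw => analyticAt_const.mul (ha w hw),
    ht.const_mul c⟩
  have h1 := hL w hw
  have : (fun t : ℝ => exp (-w * t) * (c * g t)) = fun t : ℝ => c * (exp (-w * t) * g t) := by
    ext t; ring
  rw [this]
  exact ⟨h1.1.const_mul c, by rw [integral_const_mul, ← h1.2]⟩

/-- Two continued Laplace integrals agree for large Re w, hence on the whole domain because it is
connected, hence in the limit. -/
theorem unique (h₁ : HasRegIntegralAtInfinity g T v₁) (h₂ : HasRegIntegralAtInfinity g T v₂) :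
    v₁ = v₂ := by
  obtain ⟨σ₁, L₁, hσ₁, hL₁, ha₁, ht₁⟩ := h₁
  obtain ⟨σ₂, L₂, hσ₂, hL₂, ha₂, ht₂⟩ := h₂
  set σ := max σ₁ σ₂
  have hb₁ := ha₁.mono (laplaceDomain_mono (le_max_left σ₁ σ₂))
  have hb₂ := ha₂.mono (laplaceDomain_mono (le_max_right σ₁ σ₂))
  have hz : ((σ + 1 : ℝ) : ℂ) ∈ laplaceDomain σ := Or.inl (by simp)
  have heq : Set.EqOn L₁ L₂ (laplaceDomain σ) := by
    refine hb₁.eqOn_of_preconnected_of_eventuallyEq hb₂ (isPreconnected_laplaceDomain σ) hz ?_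
    have : {w : ℂ | σ < w.re} ∈ 𝓝 ((σ + 1 : ℝ) : ℂ) :=
      (isOpen_lt continuous_const continuous_re).mem_nhds (by simp)
    filter_upwards [this] with w hw
    rw [(hL₁ w ((le_max_left _ _).trans_lt hw)).2, (hL₂ w ((le_max_right _ _).trans_lt hw)).2]
  refine tendsto_nhds_unique (ht₁.congr' ?_) ht₂
  filter_upwards [self_mem_nhdsWithin] with w hw using heq (Or.inr hw)

theorem zero (T : ℝ) : HasRegIntegralAtInfinity (fun _ => 0) T 0 :=
  ⟨1, fun _ => 0, one_pos, fun w _ => by simp, analyticOnNhd_const, tendsto_const_nhds⟩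

theorem sum {ι : Type*} (s : Finset ι) {g : ι → ℝ → ℂ} {v : ι → ℂ}
    (h : ∀ i ∈ s, HasRegIntegralAtInfinity (g i) T (v i)) :
    HasRegIntegralAtInfinity (fun t => ∑ i ∈ s, g i t) T (∑ i ∈ s, v i) := by
  classical
  induction s using Finset.induction_on with
  | empty => simpa using zero T
  | insert a s ha ih =>
    simp only [Finset.sum_insert ha]
    exact (h a (Finset.mem_insert_self _ _)).add
      (ih fun i hi => h i (Finset.mem_insert_of_mem hi))

/-- Local integrability is implicit in the definition: the factor e^((σ+1)t) that undoes the damping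
is continuous, so bounded on compact intervals. This is what excludes poles of the integrand on the
half-line. -/
theorem integrableOn (h : HasRegIntegralAtInfinity g T v) (B : ℝ) :
    IntegrableOn g (Set.Ioc T B) := by
  obtain ⟨σ, L, hσ, hL, -, -⟩ := h
  have h1 : IntegrableOn (fun t : ℝ => exp (-((σ + 1 : ℝ) : ℂ) * t) * g t) (Set.Ioc T B) :=
    (hL _ (by simp)).1.mono_set Set.Ioc_subset_Ioi_self
  have h2 : IntegrableOn (fun t : ℝ => exp (((σ + 1 : ℝ) : ℂ) * t) *
      (exp (-((σ + 1 : ℝ) : ℂ) * t) * g t)) (Set.Ioc T B) := by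
    have hc : ContinuousOn (fun t : ℝ => exp (((σ + 1 : ℝ) : ℂ) * t)) (Set.Icc T B) := by
      fun_prop
    rw [← integrableOn_Icc_iff_integrableOn_Ioc] at h1 ⊢
    exact h1.continuousOn_mul hc isCompact_Icc
  refine h2.congr (Eventually.of_forall fun t => ?_)
  show exp (((σ + 1 : ℝ) : ℂ) * t) * (exp (-((σ + 1 : ℝ) : ℂ) * t) * g t) = g t
  rw [← mul_assoc, ← Complex.exp_add]
  ring_nf
  simp

/-- For T ≥ 0 and Re w > 0 the damped integrand is dominated by ‖g‖. So the Laplace integral is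
holomorphic on the right half-plane and tends to the ordinary integral as w → 0. -/
theorem of_integrableOn (h : IntegrableOn g (Set.Ioi T)) (hT : 0 ≤ T) :
    HasRegIntegralAtInfinity g T (∫ t in Set.Ioi T, g t) := by
  have hle : ∀ w : ℂ, 0 < w.re → ∀ t ∈ Set.Ioi T, ‖exp (-w * t) * g t‖ ≤ ‖g t‖ := by
    intro w hw t ht
    rw [norm_mul, Complex.norm_exp]
    have : (-w * (t : ℂ)).re ≤ 0 := by
      simp only [neg_mul, neg_re, re_mul_ofReal]
      have := mul_pos hw (hT.trans_lt ht)
      linarith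
    exact mul_le_of_le_one_left (norm_nonneg _) (Real.exp_le_one_iff.2 this)
  have hmeas : ∀ w : ℂ, AEStronglyMeasurable (fun t : ℝ => exp (-w * t) * g t)
      (volume.restrict (Set.Ioi T)) := fun w =>
    (Continuous.aestronglyMeasurable (by fun_prop)).mul h.aestronglyMeasurable
  have hint : ∀ w : ℂ, 0 < w.re →
      IntegrableOn (fun t : ℝ => exp (-w * t) * g t) (Set.Ioi T) := fun w hw =>
    Integrable.mono h (hmeas w) ((ae_restrict_iff' measurableSet_Ioi).2
      (Eventually.of_forall fun t ht => hle w hw t ht))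
  refine ⟨1, fun w => ∫ t in Set.Ioi T, exp (-w * t) * g t, one_pos,
    fun w hw => ⟨hint w (one_pos.trans hw), rfl⟩, ?_, ?_⟩
  · have hopen : IsOpen {w : ℂ | 0 < w.re} := isOpen_lt continuous_const continuous_re
    have hd : DifferentiableOn ℂ (fun w => ∫ t in Set.Ioi T, exp (-w * t) * g t)
        {w : ℂ | 0 < w.re} := by
      refine differentiableOn_integral_param hopen (fun w _ => hmeas w)
        (Eventually.of_forall fun t => ?_) fun w _ => ⟨1, one_pos, fun t => ‖g t‖, h.norm, ?_⟩
      · fun_prop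
      · exact (ae_restrict_iff' measurableSet_Ioi).2
          (Eventually.of_forall fun t ht z _ hz => hle z hz t ht)
    refine (hd.analyticOnNhd hopen).mono ?_
    rintro w (hw | hw)
    · exact one_pos.trans hw
    · exact hw.1
  · refine tendsto_integral_filter_of_dominated_convergence (fun t => ‖g t‖)
      (Eventually.of_forall hmeas) ?_ h.norm ?_
    · filter_upwards [self_mem_nhdsWithin] with w hw
      exact (ae_restrict_iff' measurableSet_Ioi).2
        (Eventually.of_forall fun t ht => hle w hw.1 t ht)
    · refine Eventually.of_forall fun t => ?_
      have hc : Continuous fun w : ℂ => exp (-w * t) * g t := by fun_prop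
      have := (hc.tendsto 0).mono_left (nhdsWithin_le_nhds (s := {w : ℂ | 0 < w.re ∧ 0 < w.im}))
      simpa using this

/-- The integral over the compact segment that is dropped is entire in w, and its value at w = 0 is
the ordinary integral. -/
theorem shift (h : HasRegIntegralAtInfinity g T v) {B : ℝ} (hB : T ≤ B) :
    HasRegIntegralAtInfinity g B (v - ∫ t in T..B, g t) := by
  have hg := h.integrableOn B
  obtain ⟨σ, L, hσ, hL, ha, ht⟩ := h
  have hmeas : ∀ w : ℂ, AEStronglyMeasurable (fun t : ℝ => exp (-w * t) * g t)
      (volume.restrict (Set.Ioc T B)) := fun w =>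
    (Continuous.aestronglyMeasurable (by fun_prop)).mul hg.aestronglyMeasurable
  set M : ℂ → ℝ := fun w => (‖w‖) * (|T| + |B|)
  have hle : ∀ w : ℂ, ∀ t ∈ Set.Ioc T B,
      ‖exp (-w * t) * g t‖ ≤ Real.exp (M w) * ‖g t‖ := by
    intro w t ht
    rw [norm_mul, Complex.norm_exp]
    refine mul_le_mul_of_nonneg_right (Real.exp_le_exp.2 ?_) (norm_nonneg _)
    refine (re_le_norm _).trans ?_
    rw [norm_mul, norm_neg, Complex.norm_real]
    refine mul_le_mul_of_nonneg_left ?_ (norm_nonneg _)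
    rw [Real.norm_eq_abs]
    have h1 := ht.1
    have h2 := ht.2
    rw [abs_le]
    constructor
    · linarith [neg_abs_le T, abs_nonneg B]
    · linarith [le_abs_self B, abs_nonneg T]
  have hd : Differentiable ℂ fun w : ℂ => ∫ t in Set.Ioc T B, exp (-w * t) * g t := by
    rw [← differentiableOn_univ]
    refine differentiableOn_integral_param isOpen_univ (fun w _ => hmeas w)
      (Eventually.of_forall fun t => by fun_prop) fun w _ =>
      ⟨1, one_pos, fun t => Real.exp ((‖w‖ + 1) * (|T| + |B|)) * ‖g t‖, hg.norm.const_mul _, ?_⟩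
    refine (ae_restrict_iff' measurableSet_Ioc).2 (Eventually.of_forall fun t ht z hz _ => ?_)
    refine (hle z t ht).trans (mul_le_mul_of_nonneg_right (Real.exp_le_exp.2 ?_) (norm_nonneg _))
    refine mul_le_mul_of_nonneg_right ?_ (by positivity)
    rw [Metric.mem_ball, dist_eq_norm] at hz
    have := norm_sub_norm_le z w
    linarith
  refine ⟨σ, fun w => L w - ∫ t in Set.Ioc T B, exp (-w * t) * g t, hσ, fun w hw => ?_,
    fun w hw => (ha w hw).sub (hd.analyticAt w), ?_⟩
  · have h1 := hL w hw
    refine ⟨h1.1.mono_set (Set.Ioi_subset_Ioi hB), ?_⟩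
    show L w - _ = _
    rw [h1.2, ← Set.Ioc_union_Ioi_eq_Ioi hB, setIntegral_union (Set.Ioc_disjoint_Ioi le_rfl)
      measurableSet_Ioi (h1.1.mono_set Set.Ioc_subset_Ioi_self)
      (h1.1.mono_set (Set.Ioi_subset_Ioi hB))]
    ring
  · refine ht.sub ?_
    have := (hd.continuous.tendsto 0).mono_left
      (nhdsWithin_le_nhds (s := {w : ℂ | 0 < w.re ∧ 0 < w.im}))
    rw [intervalIntegral.integral_of_le hB]
    simpa using this

end HasRegIntegralAtInfinity

/-! ### Constant terms and Hadamard integrals -/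

theorem IsConstantTerm.of_analyticAt {R : ℂ → ℂ} (h : AnalyticAt ℂ R 0) :
    IsConstantTerm R (R 0) :=
  ⟨0, fun _ => 0, R, h, rfl, Eventually.of_forall fun z => by simp⟩

theorem IsConstantTerm.const_mul {R : ℂ → ℂ} {v : ℂ} (h : IsConstantTerm R v) (c : ℂ) :
    IsConstantTerm (fun z => c * R z) (c * v) := by
  obtain ⟨N, d, f, hf, hv, hR⟩ := h
  refine ⟨N, fun j => c * d j, fun z => c * f z, analyticAt_const.mul hf, by simp [hv], ?_⟩
  filter_upwards [hR] with z hz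
  rw [hz, mul_add, Finset.mul_sum]
  simp only [mul_div_assoc]

theorem IsConstantTerm.add {R₁ R₂ : ℂ → ℂ} {v₁ v₂ : ℂ} (h₁ : IsConstantTerm R₁ v₁)
    (h₂ : IsConstantTerm R₂ v₂) : IsConstantTerm (fun z => R₁ z + R₂ z) (v₁ + v₂) := by
  obtain ⟨N₁, d₁, f₁, hf₁, hv₁, hR₁⟩ := h₁
  obtain ⟨N₂, d₂, f₂, hf₂, hv₂, hR₂⟩ := h₂
  have pad : ∀ (N M : ℕ) (d : ℕ → ℂ) (z : ℂ), N ≤ M → ∑ j ∈ Finset.range N, d j / z ^ (j + 1) =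
      ∑ j ∈ Finset.range M, (if j < N then d j else 0) / z ^ (j + 1) := by
    intro N M d z hNM
    rw [← Finset.sum_subset (Finset.range_subset_range.2 hNM)]
    · refine Finset.sum_congr rfl fun j hj => ?_
      rw [if_pos (Finset.mem_range.1 hj)]
    · intro j _ hj
      rw [Finset.mem_range] at hj
      simp [hj]
  refine ⟨max N₁ N₂, fun j => (if j < N₁ then d₁ j else 0) + (if j < N₂ then d₂ j else 0),
    fun z => f₁ z + f₂ z, hf₁.add hf₂, by simp [hv₁, hv₂], ?_⟩
  filter_upwards [hR₁, hR₂] with z h1 h2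
  rw [h1, h2, pad N₁ _ d₁ z (le_max_left _ _), pad N₂ _ d₂ z (le_max_right _ _)]
  simp only [add_div, Finset.sum_add_distrib]
  ring

/-- Multiplying by z^(N+1) and letting z → 0 isolates the leading coefficient, which therefore
vanishes; then induct on N. -/
theorem eq_zero_of_eventuallyEq_principal (N : ℕ) (d : ℕ → ℂ) {f : ℂ → ℂ} (hf : ContinuousAt f 0)
    (h : ∀ᶠ z in 𝓝[≠] (0 : ℂ), ∑ j ∈ Finset.range N, d j / z ^ (j + 1) + f z = 0) : f 0 = 0 := by
  have hf' : Tendsto f (𝓝[≠] 0) (𝓝 (f 0)) := hf.tendsto.mono_left nhdsWithin_le_nhds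
  induction N with
  | zero =>
    refine tendsto_nhds_unique hf' (tendsto_const_nhds.congr' ?_)
    filter_upwards [h] with z hz
    simpa using hz.symm
  | succ N ih =>
    have hd : d N = 0 := by
      have h1 : Tendsto (fun z : ℂ => ∑ j ∈ Finset.range N, d j * z ^ (N - j) + d N +
          z ^ (N + 1) * f z) (𝓝[≠] 0) (𝓝 (d N)) := by
        have hc : Tendsto (fun z : ℂ => ∑ j ∈ Finset.range N, d j * z ^ (N - j) + d N)
            (𝓝[≠] 0) (𝓝 (d N)) := by
          have hc : Continuous fun z : ℂ => ∑ j ∈ Finset.range N, d j * z ^ (N - j) + d N := by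
            fun_prop
          have := (hc.tendsto 0).mono_left (nhdsWithin_le_nhds (s := {0}ᶜ))
          convert this using 2
          rw [Finset.sum_eq_zero, zero_add]
          intro j hj
          have : N - j ≠ 0 := by have := Finset.mem_range.1 hj; omega
          simp [this]
        have hp : Tendsto (fun z : ℂ => z ^ (N + 1)) (𝓝[≠] 0) (𝓝 0) := by
          have hc : Continuous fun z : ℂ => z ^ (N + 1) := by fun_prop
          have := (hc.tendsto 0).mono_left (nhdsWithin_le_nhds (s := {0}ᶜ))
          simpa using this
        simpa using hc.add (hp.mul hf')
      refine tendsto_nhds_unique h1 (tendsto_const_nhds.congr' ?_)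
      filter_upwards [h, self_mem_nhdsWithin] with z hz hz0
      have hz0 : z ≠ 0 := hz0
      have : z ^ (N + 1) * (∑ j ∈ Finset.range (N + 1), d j / z ^ (j + 1) + f z) = 0 := by
        rw [hz, mul_zero]
      rw [← this, mul_add, Finset.sum_range_succ, mul_add, Finset.mul_sum]
      congr 2
      · refine Finset.sum_congr rfl fun j hj => ?_
        have hj' := Finset.mem_range.1 hj
        have : N + 1 = (N - j) + (j + 1) := by omega
        rw [this, pow_add]
        field_simp
      · field_simp
    apply ih
    filter_upwards [h] with z hz
    rw [Finset.sum_range_succ, hd] at hz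
    simpa using hz

theorem IsConstantTerm.unique {R₁ R₂ : ℂ → ℂ} {v₁ v₂ : ℂ} (h₁ : IsConstantTerm R₁ v₁)
    (h₂ : IsConstantTerm R₂ v₂) (h : R₁ =ᶠ[𝓝[≠] 0] R₂) : v₁ = v₂ := by
  obtain ⟨N, d, f, hf, hv, hR⟩ := h₁.add (h₂.const_mul (-1))
  have : f 0 = 0 := by
    refine eq_zero_of_eventuallyEq_principal N d hf.continuousAt ?_
    filter_upwards [hR, h] with z hz hz'
    rw [← hz, hz']
    ring
  rw [hv] at this
  linear_combination this

namespace HasHadamardIntegral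

variable {g g₁ g₂ : ℝ → ℂ} {a b c : ℝ} {v v₁ v₂ : ℂ}

theorem congr_ae (h : HasHadamardIntegral g₁ a c b v)
    (hg : g₁ =ᵐ[volume.restrict (Set.Ioc a b)] g₂) : HasHadamardIntegral g₂ a c b v := by
  obtain ⟨hac, hcb, σ, δ, R, hδ, hR, hI, hc⟩ := h
  refine ⟨hac, hcb, σ, δ, R, hδ, hR, fun z hz => ?_, hc⟩
  have hae : (fun t : ℝ => ((|t - c| : ℝ) : ℂ) ^ z * g₁ t) =ᵐ[volume.restrict (Set.Ioc a b)]
      fun t : ℝ => ((|t - c| : ℝ) : ℂ) ^ z * g₂ t := by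
    filter_upwards [hg] with t ht
    rw [ht]
  refine ⟨(hI z hz).1.congr hae, (hI z hz).2.trans ?_⟩
  rw [intervalIntegral.integral_of_le (hac.trans hcb).le,
    intervalIntegral.integral_of_le (hac.trans hcb).le]
  exact integral_congr_ae hae

theorem add (h₁ : HasHadamardIntegral g₁ a c b v₁) (h₂ : HasHadamardIntegral g₂ a c b v₂) :
    HasHadamardIntegral (fun t => g₁ t + g₂ t) a c b (v₁ + v₂) := by
  obtain ⟨hac, hcb, σ₁, δ₁, R₁, hδ₁, hR₁, hI₁, hc₁⟩ := h₁
  obtain ⟨-, -, σ₂, δ₂, R₂, hδ₂, hR₂, hI₂, hc₂⟩ := h₂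
  refine ⟨hac, hcb, max σ₁ σ₂, min δ₁ δ₂, fun z => R₁ z + R₂ z, lt_min hδ₁ hδ₂, ?_,
    fun z hz => ?_, hc₁.add hc₂⟩
  · refine (hR₁.mono_set ?_).add (hR₂.mono_set ?_)
    · intro z (hz : _ < z.re)
      exact (neg_le_neg (min_le_left _ _)).trans_lt hz
    · intro z (hz : _ < z.re)
      exact (neg_le_neg (min_le_right _ _)).trans_lt hz
  · have h1 := hI₁ z ((le_max_left _ _).trans_lt hz)
    have h2 := hI₂ z ((le_max_right _ _).trans_lt hz)
    simp only [mul_add]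
    refine ⟨h1.1.add h2.1, ?_⟩
    have hab := (hac.trans hcb).le
    rw [h1.2, h2.2, ← intervalIntegral.integral_add]
    · rw [intervalIntegrable_iff_integrableOn_Ioc_of_le hab]; exact h1.1
    · rw [intervalIntegrable_iff_integrableOn_Ioc_of_le hab]; exact h2.1

theorem const_mul (h : HasHadamardIntegral g a c b v) (d : ℂ) :
    HasHadamardIntegral (fun t => d * g t) a c b (d * v) := by
  obtain ⟨hac, hcb, σ, δ, R, hδ, hR, hI, hc⟩ := h
  refine ⟨hac, hcb, σ, δ, fun z => d * R z, hδ, fun z hz => ?_, fun z hz => ?_, hc.const_mul d⟩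
  · exact (MeromorphicAt.const d z).mul (hR z hz)
  · have : (fun t : ℝ => ((|t - c| : ℝ) : ℂ) ^ z * (d * g t)) =
        fun t : ℝ => d * (((|t - c| : ℝ) : ℂ) ^ z * g t) := by
      ext t; ring
    rw [this]
    refine ⟨(hI z hz).1.const_mul d, ?_⟩
    rw [intervalIntegral.integral_const_mul, ← (hI z hz).2]

/-- Both continuations are meromorphic on a common half-plane Re z > -δ, which is connected and
contains 0, and they agree far to the right. So they have the same Laurent expansion at 0. -/
theorem unique (h₁ : HasHadamardIntegral g a c b v₁) (h₂ : HasHadamardIntegral g a c b v₂) :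
    v₁ = v₂ := by
  obtain ⟨hac, hcb, σ₁, δ₁, R₁, hδ₁, hR₁, hI₁, hc₁⟩ := h₁
  obtain ⟨-, -, σ₂, δ₂, R₂, hδ₂, hR₂, hI₂, hc₂⟩ := h₂
  refine hc₁.unique hc₂ ?_
  set δ := min δ₁ δ₂
  have hδ : 0 < δ := lt_min hδ₁ hδ₂
  set x : ℝ := max (max σ₁ σ₂) 0 + 1
  have hx0 : max (max σ₁ σ₂) 0 < x := lt_add_one _
  have hU : IsPreconnected {z : ℂ | -δ < z.re} := (convex_halfSpace_re_gt _).isPreconnected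
  refine MeromorphicOn.eventuallyEq_of_isPreconnected
    (hR₁.mono_set fun z (hz : -δ < z.re) => (neg_le_neg (min_le_left _ _)).trans_lt hz)
    (hR₂.mono_set fun z (hz : -δ < z.re) => (neg_le_neg (min_le_right _ _)).trans_lt hz) hU
    (x := (x : ℂ)) (y := 0) ?_ ?_ ?_
  · show -δ < x
    linarith [le_max_right (max σ₁ σ₂) 0]
  · show -δ < 0
    linarith
  · have : {w : ℂ | max σ₁ σ₂ < w.re} ∈ 𝓝 (x : ℂ) :=
      (isOpen_lt continuous_const continuous_re).mem_nhds
        ((le_max_left (max σ₁ σ₂) 0).trans_lt hx0)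
    filter_upwards [nhdsWithin_le_nhds this] with w hw
    rw [(hI₁ w ((le_max_left _ _).trans_lt hw)).2, (hI₂ w ((le_max_right _ _).trans_lt hw)).2]

end HasHadamardIntegral

end QMF

end

noncomputable section

namespace QMF

/-! ### Laurent expansions -/

/-- The principal part of a meromorphic function. -/
theorem exists_principalPart {𝕜 : Type*} [RCLike 𝕜] [NormedSpace 𝕜 ℂ] {f : 𝕜 → ℂ} {c : 𝕜}
    (hf : MeromorphicAt f c) : ∃ (N : ℕ) (β : ℕ → ℂ) (q : 𝕜 → ℂ), AnalyticAt 𝕜 q c ∧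
      ∀ᶠ t in 𝓝[≠] c, f t = ∑ j ∈ Finset.range N, ((t - c) ^ (j + 1))⁻¹ • β j + q t := by
  obtain ⟨n, hn⟩ := hf
  have h0 : AnalyticAt 𝕜 (fun w => (w ^ n) • f (c + w)) 0 := by
    have h1 : AnalyticAt 𝕜 (fun w : 𝕜 => c + w) 0 := by fun_prop
    have := AnalyticAt.comp (g := fun z => (z - c) ^ n • f z) (f := fun w : 𝕜 => c + w) (x := 0)
      (by simpa using hn) h1
    refine this.congr (Eventually.of_forall fun w => ?_)
    simp
  obtain ⟨F, hF, hFe⟩ := h0.exists_eq_sum_add_pow_mul n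
  refine ⟨n, fun j => ((1 : 𝕜) / ((n - 1 - j).factorial : 𝕜)) • iteratedDeriv (n - 1 - j)
    (fun w => (w ^ n) • f (c + w)) 0, fun t => F (t - c), ?_, ?_⟩
  · have h1 : AnalyticAt 𝕜 (fun t : 𝕜 => t - c) c := by fun_prop
    exact AnalyticAt.comp (g := F) (by simpa using hF) h1
  · filter_upwards [self_mem_nhdsWithin] with t ht
    have ht' : t - c ≠ 0 := sub_ne_zero.2 ht
    have h2 := hFe (t - c)
    simp only [add_sub_cancel] at h2
    have h3 : f t = ((t - c) ^ n)⁻¹ • ((t - c) ^ n • f t) := by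
      rw [inv_smul_smul₀ (pow_ne_zero n ht')]
    rw [h3, h2, smul_add, inv_smul_smul₀ (pow_ne_zero n ht'), Finset.smul_sum,
      ← Finset.sum_range_reflect]
    congr 1
    refine Finset.sum_congr rfl fun j hj => ?_
    have hj' := Finset.mem_range.1 hj
    rw [smul_smul, smul_smul]
    congr 1
    have : n = (n - 1 - j) + (j + 1) := by omega
    have e : (t - c) ^ n = (t - c) ^ (n - 1 - j) * (t - c) ^ (j + 1) := by rw [← pow_add, ← this]
    rw [e]
    field_simp

/-! ### Explicit Hadamard integrals -/

theorem integral_abs_cpow_mul_inv_pow (n : ℕ) {z : ℂ} (hz : n < z.re) {β : ℝ} (hβ : 0 < β) :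
    IntervalIntegrable (fun u : ℝ => ((|u| : ℝ) : ℂ) ^ z * ((u : ℂ) ^ (n + 1))⁻¹) volume 0 β ∧
    ∫ u in (0 : ℝ)..β, ((|u| : ℝ) : ℂ) ^ z * ((u : ℂ) ^ (n + 1))⁻¹ = β ^ (z - n) / (z - n) := by
  have heq : Set.EqOn (fun u : ℝ => ((|u| : ℝ) : ℂ) ^ z * ((u : ℂ) ^ (n + 1))⁻¹)
      (fun u : ℝ => (u : ℂ) ^ (z - (n + 1))) (Set.uIoc 0 β) := by
    intro u hu
    rw [Set.uIoc_of_le hβ.le] at hu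
    have hu0 : (u : ℂ) ≠ 0 := ofReal_ne_zero.2 hu.1.ne'
    simp only [abs_of_pos hu.1]
    rw [cpow_sub _ _ hu0, div_eq_mul_inv]
    norm_cast
  have hre : -1 < (z - (n + 1)).re := by simp; linarith
  have hzn : z - n ≠ 0 := by
    intro h
    rw [sub_eq_zero] at h
    rw [h] at hz
    simp at hz
  constructor
  · exact (intervalIntegral.intervalIntegrable_cpow' hre).congr heq.symm
  · rw [intervalIntegral.integral_congr_ae (Eventually.of_forall fun u hu => heq hu),
      integral_cpow (Or.inl hre)]
    have : z - (n + 1) + 1 = z - n := by ring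
    rw [this, ofReal_zero, zero_cpow hzn, sub_zero]

theorem integral_abs_cpow_mul_inv_pow_sub (n : ℕ) {z : ℂ} (hz : n < z.re) {a b c : ℝ}
    (hac : a < c) (hcb : c < b) :
    IntervalIntegrable (fun t : ℝ => ((|t - c| : ℝ) : ℂ) ^ z * (((t - c : ℝ) : ℂ) ^ (n + 1))⁻¹)
      volume a b ∧
    ∫ t in a..b, ((|t - c| : ℝ) : ℂ) ^ z * (((t - c : ℝ) : ℂ) ^ (n + 1))⁻¹ =
      (((b - c : ℝ) : ℂ) ^ (z - n) + (-1) ^ (n + 1) * ((c - a : ℝ) : ℂ) ^ (z - n)) / (z - n) := by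
  set F : ℝ → ℂ := fun u => ((|u| : ℝ) : ℂ) ^ z * ((u : ℂ) ^ (n + 1))⁻¹ with hF
  have hFneg : ∀ u, F (-u) = (-1) ^ (n + 1) * F u := by
    intro u
    simp only [hF, abs_neg, ofReal_neg]
    rw [neg_pow, mul_inv, ← inv_pow]
    norm_num
    ring
  have h1 := integral_abs_cpow_mul_inv_pow n hz (sub_pos.2 hcb)
  have h2 := integral_abs_cpow_mul_inv_pow n hz (sub_pos.2 hac)
  have h3 : IntervalIntegrable F volume (a - c) 0 := by
    have := (h2.1.const_mul ((-1) ^ (n + 1))).comp_sub_left 0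
    simp only [zero_sub, sub_zero, neg_sub] at this
    refine this.symm.congr ?_
    intro u _
    show (-1) ^ (n + 1) * F (-u) = F u
    rw [hFneg, ← mul_assoc, ← mul_pow]
    simp
  have h4 : ∫ u in (a - c)..0, F u = (-1) ^ (n + 1) * ∫ u in (0 : ℝ)..(c - a), F u := by
    have := intervalIntegral.integral_comp_sub_left (a := 0) (b := c - a) F 0
    simp only [zero_sub, neg_sub, neg_zero] at this
    rw [← this]
    simp only [hFneg, intervalIntegral.integral_const_mul]
  constructor
  · have := (h3.trans h1.1).comp_sub_right c
    simpa [hF] using this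
  · have := intervalIntegral.integral_comp_sub_right (a := a) (b := b) F c
    refine this.trans ?_
    rw [← intervalIntegral.integral_add_adjacent_intervals h3 h1.1, h4, h1.2, h2.2]
    ring

/-- The contributions of the two sides of c combine to ((b-c)^z - (c-a)^z)/z. The singularity at z =
0 is removable, and the constant term is the derivative of the numerator there. -/
theorem hasHadamardIntegral_inv {a b c : ℝ} (hac : a < c) (hcb : c < b) :
    HasHadamardIntegral (fun t => ((t - c : ℝ) : ℂ)⁻¹) a c b
      (Real.log (b - c) - Real.log (c - a) : ℝ) := by
  have hβ : ((b - c : ℝ) : ℂ) ≠ 0 := ofReal_ne_zero.2 (sub_pos.2 hcb).ne'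
  have hα : ((c - a : ℝ) : ℂ) ≠ 0 := ofReal_ne_zero.2 (sub_pos.2 hac).ne'
  set f : ℂ → ℂ := fun z => ((b - c : ℝ) : ℂ) ^ z - ((c - a : ℝ) : ℂ) ^ z with hf
  have hder : HasDerivAt f (Real.log (b - c) - Real.log (c - a) : ℝ) 0 := by
    have := ((hasDerivAt_id (0 : ℂ)).const_cpow (Or.inl hβ)).sub
      ((hasDerivAt_id (0 : ℂ)).const_cpow (Or.inl hα))
    refine this.congr_deriv ?_
    simp [ofReal_log (sub_pos.2 hcb).le, ofReal_log (sub_pos.2 hac).le]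
  have hdiff : Differentiable ℂ f := fun z =>
    (differentiableAt_id.const_cpow (Or.inl hβ)).sub (differentiableAt_id.const_cpow (Or.inl hα))
  have hds : Differentiable ℂ (dslope f 0) := by
    rw [← differentiableOn_univ, differentiableOn_dslope univ_mem]
    exact hdiff.differentiableOn
  refine ⟨hac, hcb, 0, 1, dslope f 0, one_pos, fun z _ => (hds.analyticAt z).meromorphicAt,
    fun z hz => ?_, ?_⟩
  · have h := integral_abs_cpow_mul_inv_pow_sub 0 (z := z) (by simpa using hz) hac hcb
    simp only [zero_add, pow_one, Nat.cast_zero, sub_zero] at h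
    refine ⟨(intervalIntegrable_iff_integrableOn_Ioc_of_le (hac.trans hcb).le).1 h.1, ?_⟩
    rw [h.2]
    have hz0 : z ≠ 0 := by rintro rfl; simp at hz
    rw [dslope_of_ne _ hz0, slope_def_field]
    simp [hf]
    ring
  · have := IsConstantTerm.of_analyticAt (hds.analyticAt 0)
    rwa [dslope_same, hder.deriv] at this

/-- The continuation can be singular only at z = n + 1, so its value at 0 is the constant term; it
is what the elementary antiderivative gives if the pole is ignored. -/
theorem hasHadamardIntegral_inv_pow (n : ℕ) {a b c : ℝ} (hac : a < c) (hcb : c < b) :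
    HasHadamardIntegral (fun t => (((t - c : ℝ) : ℂ) ^ (n + 2))⁻¹) a c b
      (-(1 / (n + 1 : ℂ)) * ((((b - c : ℝ) : ℂ) ^ (n + 1))⁻¹ - (((a - c : ℝ) : ℂ) ^ (n + 1))⁻¹)) := by
  have hβ : ((b - c : ℝ) : ℂ) ≠ 0 := ofReal_ne_zero.2 (sub_pos.2 hcb).ne'
  have hα : ((c - a : ℝ) : ℂ) ≠ 0 := ofReal_ne_zero.2 (sub_pos.2 hac).ne'
  set R : ℂ → ℂ := fun z => (((b - c : ℝ) : ℂ) ^ (z - (n + 1 : ℕ)) +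
    (-1) ^ (n + 1 + 1) * ((c - a : ℝ) : ℂ) ^ (z - (n + 1 : ℕ))) / (z - (n + 1 : ℕ)) with hR
  have hnum : Differentiable ℂ fun z : ℂ => (((b - c : ℝ) : ℂ) ^ (z - (n + 1 : ℕ)) +
      (-1) ^ (n + 1 + 1) * ((c - a : ℝ) : ℂ) ^ (z - (n + 1 : ℕ))) := by
    intro z
    have h1 : DifferentiableAt ℂ (fun z : ℂ => z - (n + 1 : ℕ)) z := by fun_prop
    exact (h1.const_cpow (Or.inl hβ)).add ((h1.const_cpow (Or.inl hα)).const_mul _)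
  have hden : ∀ z : ℂ, AnalyticAt ℂ (fun z : ℂ => z - (n + 1 : ℕ)) z := fun z => by fun_prop
  refine ⟨hac, hcb, (n + 1 : ℕ), 1, R, one_pos, fun z _ =>
    (hnum.analyticAt z).meromorphicAt.div (hden z).meromorphicAt, fun z hz => ?_, ?_⟩
  · have h := integral_abs_cpow_mul_inv_pow_sub (n + 1) (z := z) hz hac hcb
    exact ⟨(intervalIntegrable_iff_integrableOn_Ioc_of_le (hac.trans hcb).le).1 h.1, h.2.symm⟩
  · have hne : (0 : ℂ) - (n + 1 : ℕ) ≠ 0 := by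
      rw [zero_sub, neg_ne_zero]; exact_mod_cast Nat.succ_ne_zero n
    have := IsConstantTerm.of_analyticAt (R := R) ((hnum.analyticAt 0).div (hden 0) hne)
    convert this using 1
    simp only [hR, zero_sub, cpow_neg, cpow_natCast]
    have hac' : ((a - c : ℝ) : ℂ) = -((c - a : ℝ) : ℂ) := by push_cast; ring
    have e1 : ((-1 : ℂ) ^ (n + 1))⁻¹ = (-1) ^ (n + 1) := by rw [← inv_pow]; norm_num
    rw [hac', neg_pow, mul_inv, e1]
    have hn1 : (n : ℂ) + 1 ≠ 0 := by exact_mod_cast Nat.succ_ne_zero n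
    push_cast
    rw [pow_succ (-1 : ℂ) (n + 1)]
    field_simp
    ring

theorem intervalIntegrable_abs_sub_rpow {r : ℝ} (hr : -1 < r) {a b c : ℝ} (hac : a < c)
    (hcb : c < b) : IntervalIntegrable (fun t : ℝ => |t - c| ^ r) volume a b := by
  have h1 : ∀ β, 0 < β → IntervalIntegrable (fun u : ℝ => |u| ^ r) volume 0 β := by
    intro β hβ
    refine (intervalIntegral.intervalIntegrable_rpow' hr).congr ?_
    intro u hu
    rw [Set.uIoc_of_le hβ.le] at hu
    simp only [abs_of_pos hu.1]
  have h2 : IntervalIntegrable (fun u : ℝ => |u| ^ r) volume (a - c) 0 := by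
    have := (h1 (c - a) (sub_pos.2 hac)).comp_sub_left 0
    simp only [zero_sub, sub_zero, neg_sub, abs_neg] at this
    exact this.symm
  have := (h2.trans (h1 (b - c) (sub_pos.2 hcb))).comp_sub_right c
  simpa using this

theorem hasHadamardIntegral_of_continuousOn {h : ℝ → ℂ} {a b c : ℝ} (hac : a < c) (hcb : c < b)
    (hh : ContinuousOn h (Set.Icc a b)) : HasHadamardIntegral h a c b (∫ t in a..b, h t) := by
  have hab := (hac.trans hcb).le
  obtain ⟨M, hM⟩ := isCompact_Icc.exists_bound_of_continuousOn hh
  have hM0 : 0 ≤ M := (norm_nonneg _).trans (hM a ⟨le_rfl, hab⟩)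
  have hmeas : ∀ z : ℂ, AEStronglyMeasurable (fun t : ℝ => ((|t - c| : ℝ) : ℂ) ^ z * h t)
      (volume.restrict (Set.Ioc a b)) := by
    intro z
    refine AEStronglyMeasurable.mul ?_
      ((hh.mono Set.Ioc_subset_Icc_self).aestronglyMeasurable measurableSet_Ioc)
    exact Measurable.aestronglyMeasurable (by fun_prop)
  have hae : ∀ᵐ t ∂volume.restrict (Set.Ioc a b), t ∈ Set.Ioc a b ∧ t ≠ c := by
    refine (ae_restrict_mem measurableSet_Ioc).and (ae_restrict_of_ae ?_)
    exact Measure.ae_ne volume c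
  -- One integrable majorant for all exponents with -1/2 < Re z ≤ m: the first term serves |t - c| ≤
  -- 1, the second |t - c| ≥ 1.
  set bd : ℝ → ℝ → ℝ := fun m t => (|t - c| ^ (-(1 / 2) : ℝ) + (b - a + 1) ^ m) * M
  have hbd : ∀ (m : ℝ) (z : ℂ), -(1 / 2) < z.re → z.re ≤ m → 0 ≤ m → ∀ t ∈ Set.Ioc a b, t ≠ c →
      ‖((|t - c| : ℝ) : ℂ) ^ z * h t‖ ≤ bd m t := by
    intro m z hz hzm hm t ht htc
    have hpos : 0 < |t - c| := abs_pos.2 (sub_ne_zero.2 htc)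
    rw [norm_mul, norm_cpow_eq_rpow_re_of_pos hpos]
    refine mul_le_mul ?_ (hM t ⟨ht.1.le, ht.2⟩) (norm_nonneg _) (by positivity)
    rcases le_total |t - c| 1 with h1 | h1
    · refine (Real.rpow_le_rpow_of_exponent_ge hpos h1 hz.le).trans ?_
      have : (0 : ℝ) ≤ (b - a + 1) ^ m := Real.rpow_nonneg (by linarith) _
      linarith
    · have h2 : |t - c| ≤ b - a + 1 := by
        rw [abs_le]
        constructor <;> linarith [ht.1, ht.2]
      refine (Real.rpow_le_rpow_of_exponent_le h1 hzm).trans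
        ((Real.rpow_le_rpow hpos.le h2 hm).trans ?_)
      have : (0 : ℝ) ≤ |t - c| ^ (-(1 / 2) : ℝ) := Real.rpow_nonneg hpos.le _
      linarith
  have hbdint : ∀ m, Integrable (bd m) (volume.restrict (Set.Ioc a b)) := by
    intro m
    have h1 := intervalIntegrable_abs_sub_rpow (r := -(1 / 2)) (by norm_num) hac hcb
    rw [intervalIntegrable_iff_integrableOn_Ioc_of_le hab] at h1
    exact (h1.add (integrable_const _)).mul_const M
  have hint : ∀ z : ℂ, -(1 / 2) < z.re →
      IntegrableOn (fun t : ℝ => ((|t - c| : ℝ) : ℂ) ^ z * h t) (Set.Ioc a b) := by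
    intro z hz
    refine (hbdint (max z.re 0)).mono' (hmeas z) ?_
    filter_upwards [hae] with t ht
    exact hbd _ z hz (le_max_left _ _) (le_max_right _ _) t ht.1 ht.2
  have hopen : IsOpen {z : ℂ | -(1 / 2) < z.re} := isOpen_lt continuous_const continuous_re
  have hd : DifferentiableOn ℂ (fun z => ∫ t in Set.Ioc a b, ((|t - c| : ℝ) : ℂ) ^ z * h t)
      {z : ℂ | -(1 / 2) < z.re} := by
    refine differentiableOn_integral_param hopen (fun z _ => hmeas z) ?_ fun z hz =>
      ⟨1, one_pos, bd (|z.re| + 1), hbdint _, ?_⟩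
    · filter_upwards [hae] with t ht
      have : ((|t - c| : ℝ) : ℂ) ≠ 0 := ofReal_ne_zero.2 (abs_ne_zero.2 (sub_ne_zero.2 ht.2))
      intro z _
      exact ((differentiableAt_id.const_cpow (Or.inl this)).mul_const _).differentiableWithinAt
    · filter_upwards [hae] with t ht w hw hw'
      refine hbd _ w hw' ?_ (by positivity) t ht.1 ht.2
      rw [Metric.mem_ball, dist_eq_norm] at hw
      have h1 := (le_abs_self _).trans ((abs_re_le_norm (w - z)).trans hw.le)
      rw [sub_re] at h1
      linarith [le_abs_self z.re]
  have han := hd.analyticOnNhd hopen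
  refine ⟨hac, hcb, 0, 1 / 2, fun z => ∫ t in Set.Ioc a b, ((|t - c| : ℝ) : ℂ) ^ z * h t,
    by norm_num, fun z hz => (han z hz).meromorphicAt, fun z hz => ⟨hint z (by linarith), ?_⟩, ?_⟩
  · rw [intervalIntegral.integral_of_le hab]
  · have := IsConstantTerm.of_analyticAt (han 0 (by simp))
    simpa [intervalIntegral.integral_of_le hab] using this

/-! ### Finite-part primitives -/

/-- The function `κ log|t - c| + P` with `P` meromorphic at `c` and derivative `g` computes the
Hadamard integrals of `g` across `c`. -/
theorem hasHadamardIntegral_of_primitive {g Φ P : ℝ → ℂ} {a b c : ℝ} {κ : ℂ} (hac : a < c)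
    (hcb : c < b) (hd : ∀ t ∈ Set.Icc a b, t ≠ c → HasDerivAt Φ (g t) t)
    (ha : ∀ t ∈ Set.Icc a b, t ≠ c → AnalyticAt ℝ Φ t) (hP : MeromorphicAt P c)
    (hΦ : ∀ᶠ t in 𝓝[≠] c, Φ t = κ * Real.log (t - c) + P t) :
    HasHadamardIntegral g a c b (Φ b - Φ a) := by
  classical
  have hab := (hac.trans hcb).le
  obtain ⟨N, β, q, hq, hPq⟩ := exists_principalPart hP
  -- The explicit singular part of Φ. `Real.log` is the logarithm of the absolute value, so S makes
  -- sense on both sides of c. Its derivative S' is handled term by term by the two preceding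
  -- explicit integrals.
  set S : ℝ → ℂ := fun t => κ * Real.log (t - c) +
    ∑ j ∈ Finset.range N, β j * (((t - c : ℝ) : ℂ) ^ (j + 1))⁻¹ with hS
  set S' : ℝ → ℂ := fun t => κ * ((t - c : ℝ) : ℂ)⁻¹ +
    ∑ j ∈ Finset.range N, β j * (-(j + 1 : ℂ) * (((t - c : ℝ) : ℂ) ^ (j + 2))⁻¹) with hS'
  have hofReal : ∀ t : ℝ, AnalyticAt ℝ (fun t : ℝ => (t : ℂ)) t := fun t =>
    ofRealCLM.analyticAt t
  have hSa : ∀ t, t ≠ c → AnalyticAt ℝ S t := by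
    intro t htc
    have h1 : AnalyticAt ℝ (fun t : ℝ => Real.log (t - c)) t := by
      rcases lt_or_gt_of_ne htc with h | h
      · have h2 : AnalyticAt ℝ (fun t : ℝ => Real.log (c - t)) t :=
          AnalyticAt.log (by fun_prop) (sub_pos.2 h)
        refine h2.congr (Eventually.of_forall fun u => ?_)
        show Real.log (c - u) = Real.log (u - c)
        rw [← Real.log_neg_eq_log, neg_sub]
      · exact AnalyticAt.log (by fun_prop) (sub_pos.2 h)
    have h2 : AnalyticAt ℝ (fun t : ℝ => ((Real.log (t - c) : ℝ) : ℂ)) t :=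
      (hofReal _).comp h1
    have h3 : AnalyticAt ℝ (fun t : ℝ => ((t - c : ℝ) : ℂ)) t :=
      AnalyticAt.comp (g := fun t : ℝ => (t : ℂ)) (hofReal _)
        (by fun_prop : AnalyticAt ℝ (fun t : ℝ => t - c) t)
    have h4 : ((t - c : ℝ) : ℂ) ≠ 0 := ofReal_ne_zero.2 (sub_ne_zero.2 htc)
    refine (analyticAt_const.mul h2).add (Finset.analyticAt_fun_sum _ fun j _ => ?_)
    exact analyticAt_const.mul ((h3.pow (j + 1)).inv (pow_ne_zero _ h4))
  have hSd : ∀ t, t ≠ c → HasDerivAt S (S' t) t := by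
    intro t htc
    have h4 : ((t - c : ℝ) : ℂ) ≠ 0 := ofReal_ne_zero.2 (sub_ne_zero.2 htc)
    have h0 : HasDerivAt (fun t : ℝ => ((t - c : ℝ) : ℂ)) 1 t := by
      simpa using ((hasDerivAt_id t).sub_const c).ofReal_comp
    have h1 : HasDerivAt (fun t : ℝ => ((Real.log (t - c) : ℝ) : ℂ)) (((t - c : ℝ) : ℂ)⁻¹) t := by
      have := (((hasDerivAt_id t).sub_const c).log (sub_ne_zero.2 htc)).ofReal_comp
      simpa using this
    refine (h1.const_mul κ).add (HasDerivAt.fun_sum fun j _ => ?_)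
    refine HasDerivAt.const_mul (β j) ?_
    have := (h0.pow (j + 1)).inv (pow_ne_zero _ h4)
    refine this.congr_deriv ?_
    simp only [Pi.pow_apply, Nat.add_sub_cancel]
    generalize ((t - c : ℝ) : ℂ) = w at h4
    have : (w ^ (j + 1)) ^ 2 = w ^ j * w ^ (j + 2) := by ring
    rw [this]
    push_cast
    field_simp
  -- The regular part Φ - S, with the value at c filled in. It is real-analytic on all of [a, b], so
  -- its derivative is continuous and has an ordinary integral.
  set Q : ℝ → ℂ := Function.update (fun t => Φ t - S t) c (q c) with hQ
  have hQne : ∀ t, t ≠ c → Q =ᶠ[𝓝 t] fun t => Φ t - S t := by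
    intro t htc
    filter_upwards [isOpen_ne.mem_nhds htc] with u hu
    rw [hQ, Function.update_of_ne hu]
  have hQa : ∀ t ∈ Set.Icc a b, AnalyticAt ℝ Q t := by
    intro t ht
    rcases eq_or_ne t c with rfl | htc
    · refine hq.congr ?_
      have h1 : ∀ᶠ u in 𝓝[≠] t, q u = Q u := by
        filter_upwards [hΦ, hPq, self_mem_nhdsWithin] with u h1 h2 h3
        rw [hQ, Function.update_of_ne h3, h1, h2, hS]
        simp only [Complex.real_smul]
        push_cast
        have : ∀ j, (((u : ℂ) - t) ^ (j + 1))⁻¹ * β j = β j * (((u : ℂ) - t) ^ (j + 1))⁻¹ :=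
          fun j => mul_comm _ _
        simp only [this]
        ring
      have h2 := eventually_nhdsWithin_iff.1 h1
      filter_upwards [h2] with u hu
      rcases eq_or_ne u t with rfl | hne
      · simp [hQ]
      · exact hu hne
    · exact ((ha t ht htc).sub (hSa t htc)).congr (hQne t htc).symm
  have hQc : ContinuousOn (deriv Q) (Set.Icc a b) := fun t ht =>
    (hQa t ht).deriv.continuousAt.continuousWithinAt
  have hQint : ∫ t in a..b, deriv Q t = Q b - Q a := by
    refine intervalIntegral.integral_eq_sub_of_hasDerivAt ?_ ?_
    · intro t ht
      rw [Set.uIcc_of_le hab] at ht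
      exact (hQa t ht).differentiableAt.hasDerivAt
    · exact ContinuousOn.intervalIntegrable (by rwa [Set.uIcc_of_le hab])
  have key : HasHadamardIntegral (fun t => S' t + deriv Q t) a c b
      ((κ * (Real.log (b - c) - Real.log (c - a) : ℝ) + ∑ j ∈ Finset.range N, β j *
        (-(j + 1 : ℂ) * (-(1 / (j + 1 : ℂ)) * ((((b - c : ℝ) : ℂ) ^ (j + 1))⁻¹ -
          (((a - c : ℝ) : ℂ) ^ (j + 1))⁻¹)))) + ∫ t in a..b, deriv Q t) := by
    refine HasHadamardIntegral.add ?_ (hasHadamardIntegral_of_continuousOn hac hcb hQc)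
    refine ((hasHadamardIntegral_inv hac hcb).const_mul κ).add ?_
    have hsum : ∀ M : ℕ, HasHadamardIntegral (fun t => ∑ j ∈ Finset.range M,
        β j * (-(j + 1 : ℂ) * (((t - c : ℝ) : ℂ) ^ (j + 2))⁻¹)) a c b
        (∑ j ∈ Finset.range M, β j * (-(j + 1 : ℂ) * (-(1 / (j + 1 : ℂ)) *
          ((((b - c : ℝ) : ℂ) ^ (j + 1))⁻¹ - (((a - c : ℝ) : ℂ) ^ (j + 1))⁻¹)))) := by
      intro M
      induction M with
      | zero =>
        simpa using hasHadamardIntegral_of_continuousOn (h := fun _ => 0) hac hcb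
          continuousOn_const
      | succ M ih =>
        simp only [Finset.sum_range_succ]
        exact ih.add (((hasHadamardIntegral_inv_pow M hac hcb).const_mul _).const_mul _)
    exact hsum N
  have hval : Φ b - Φ a = (κ * (Real.log (b - c) - Real.log (c - a) : ℝ) +
      ∑ j ∈ Finset.range N, β j *
        (-(j + 1 : ℂ) * (-(1 / (j + 1 : ℂ)) * ((((b - c : ℝ) : ℂ) ^ (j + 1))⁻¹ -
          (((a - c : ℝ) : ℂ) ^ (j + 1))⁻¹)))) + ∫ t in a..b, deriv Q t := by
    rw [hQint, hQ, Function.update_of_ne hcb.ne', Function.update_of_ne hac.ne]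
    simp only [hS]
    have hlog : Real.log (a - c) = Real.log (c - a) := by rw [← Real.log_neg_eq_log, neg_sub]
    rw [hlog]
    have : ∀ j : ℕ, β j * (-(j + 1 : ℂ) * (-(1 / (j + 1 : ℂ)) * ((((b - c : ℝ) : ℂ) ^ (j + 1))⁻¹ -
          (((a - c : ℝ) : ℂ) ^ (j + 1))⁻¹))) = β j * (((b - c : ℝ) : ℂ) ^ (j + 1))⁻¹ -
          β j * (((a - c : ℝ) : ℂ) ^ (j + 1))⁻¹ := by
      intro j
      have hn1 : (j : ℂ) + 1 ≠ 0 := by exact_mod_cast Nat.succ_ne_zero j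
      rw [← mul_assoc (-((j : ℂ) + 1))]
      have : -((j : ℂ) + 1) * -(1 / (j + 1)) = 1 := by field_simp
      rw [this]
      ring
    simp only [this, Finset.sum_sub_distrib]
    push_cast
    ring
  rw [hval]
  refine key.congr_ae ?_
  filter_upwards [ae_restrict_mem measurableSet_Ioc,
    ae_restrict_of_ae (Measure.ae_ne volume c)] with t ht htc
  have ht' : t ∈ Set.Icc a b := ⟨ht.1.le, ht.2⟩
  rw [(hQne t htc).deriv_eq, ((hd t ht' htc).fun_sub (hSd t htc)).deriv]
  ring

end QMF

end

/-! ### Finite-part primitives and finite-part integrals over compact intervals -/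

noncomputable section

namespace QMF

theorem analyticAt_comp_ofReal {G : ℂ → ℂ} {x : ℝ} (h : AnalyticAt ℂ G x) :
    AnalyticAt ℝ (fun t : ℝ => G t) x :=
  AnalyticAt.comp (g := G) (f := fun t : ℝ => (t : ℂ)) h.restrictScalars (ofRealCLM.analyticAt x)

theorem meromorphicAt_comp_ofReal {G : ℂ → ℂ} {x : ℝ} (h : MeromorphicAt G x) :
    MeromorphicAt (fun t : ℝ => G t) x :=
  MeromorphicAt.comp_analyticAt (f := G) (g := fun t : ℝ => (t : ℂ)) h (ofRealCLM.analyticAt x)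

theorem tendsto_ofReal_nhdsNE (x : ℝ) :
    Tendsto (fun t : ℝ => (t : ℂ)) (𝓝[≠] x) (𝓝[≠] (x : ℂ)) := by
  refine tendsto_nhdsWithin_iff.2 ⟨(continuous_ofReal.tendsto x).mono_left nhdsWithin_le_nhds, ?_⟩
  filter_upwards [self_mem_nhdsWithin] with t ht
  exact fun h => ht (ofReal_injective h)

theorem analyticAt_ofReal_log_sub {t c : ℝ} (htc : t ≠ c) :
    AnalyticAt ℝ (fun t : ℝ => ((Real.log (t - c) : ℝ) : ℂ)) t := by
  have h1 : AnalyticAt ℝ (fun t : ℝ => Real.log (t - c)) t := by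
    rcases lt_or_gt_of_ne htc with h | h
    · have h2 : AnalyticAt ℝ (fun t : ℝ => Real.log (c - t)) t :=
        AnalyticAt.log (by fun_prop) (sub_pos.2 h)
      refine h2.congr (Eventually.of_forall fun u => ?_)
      show Real.log (c - u) = Real.log (u - c)
      rw [← Real.log_neg_eq_log, neg_sub]
    · exact AnalyticAt.log (by fun_prop) (sub_pos.2 h)
  exact (ofRealCLM.analyticAt _).comp h1

theorem hasDerivAt_ofReal_log_sub {t c : ℝ} (htc : t ≠ c) :
    HasDerivAt (fun t : ℝ => ((Real.log (t - c) : ℝ) : ℂ)) (((t : ℂ) - c)⁻¹) t := by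
  have := (((hasDerivAt_id t).sub_const c).log (sub_ne_zero.2 htc)).ofReal_comp
  simpa using this

/-- `Φ` is a finite-part primitive of `g` on `[A, B]`: a primitive off the finite set `D`, with
at most logarithmic and polar singularities on `D`. -/
structure IsFPPrim (g Φ : ℝ → ℂ) (D : Finset ℝ) (A B : ℝ) : Prop where
  deriv : ∀ t ∈ Set.Icc A B, t ∉ D → HasDerivAt Φ (g t) t
  analytic : ∀ t ∈ Set.Icc A B, t ∉ D → AnalyticAt ℝ Φ t
  log : ∀ c ∈ Set.Icc A B, c ∈ D → ∃ (κ : ℂ) (P : ℝ → ℂ), MeromorphicAt P c ∧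
    ∀ᶠ t in 𝓝[≠] c, Φ t = κ * Real.log (t - c) + P t

/-- Increasing break points stay ordered. -/
theorem breakpoints_le {n : ℕ} {a : ℕ → ℝ} (h : ∀ i < n, a i < a (i + 1)) {i j : ℕ} (hij : i ≤ j)
    (hj : j ≤ n) : a i ≤ a j := by
  induction j, hij using Nat.le_induction with
  | base => exact le_rfl
  | succ j _ ih => exact (ih (by omega)).trans (h j (by omega)).le

/-- Induction on the largest point d of D: the smaller points are treated on [A, B'] with B'
slightly to the left of d, and the piece [B', B] is added. If D is empty, one piece with an
arbitrary centre is used, as a Hadamard integral always carries a centre. -/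
theorem exists_breakpoints (D : Finset ℝ) : ∀ {A B : ℝ}, A < B → (∀ d ∈ D, A < d ∧ d < B) →
    ∃ (n : ℕ) (a c : ℕ → ℝ), a 0 = A ∧ a n = B ∧ (∀ i < n, a i < c i ∧ c i < a (i + 1)) ∧
      ∀ i < n, ∀ d ∈ D, a i ≤ d → d ≤ a (i + 1) → d = c i := by
  classical
  induction D using Finset.induction_on_max with
  | empty =>
    intro A B hAB _
    refine ⟨1, fun i => if i = 0 then A else B, fun _ => (A + B) / 2, by simp, by simp, ?_, ?_⟩
    · intro i hi
      obtain rfl : i = 0 := by omega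
      constructor
      · show A < (A + B) / 2
        linarith
      · show (A + B) / 2 < B
        linarith
    · intro i _ d hd
      simp at hd
  | insert d D hd ih =>
    intro A B hAB hAD
    have hdd := hAD d (Finset.mem_insert_self _ _)
    have hev : ∀ᶠ x in 𝓝[<] d, (A < x ∧ x < d) ∧ ∀ y ∈ D, y < x := by
      refine Eventually.and ?_ ?_
      · exact Ioo_mem_nhdsLT hdd.1
      · rw [Finset.eventually_all]
        intro y hy
        filter_upwards [Ioo_mem_nhdsLT (hd y hy)] with x hx using hx.1
    obtain ⟨B', ⟨hAB', hBd⟩, hB'⟩ := hev.exists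
    obtain ⟨n, a, c, ha0, han, hac, hD⟩ := ih hAB' fun y hy =>
      ⟨(hAD y (Finset.mem_insert_of_mem hy)).1, hB' y hy⟩
    have hmono : ∀ i < n, a i < a (i + 1) := fun i hi => (hac i hi).1.trans (hac i hi).2
    refine ⟨n + 1, fun i => if i ≤ n then a i else B, fun i => if i < n then c i else d, ?_, ?_,
      ?_, ?_⟩
    · simpa using ha0
    · simp
    · intro i hi
      rcases Nat.lt_succ_iff_lt_or_eq.1 hi with h | rfl
      · simpa [h, h.le, Nat.succ_le_of_lt h] using hac i h
      · simpa [han] using ⟨hBd, hdd.2⟩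
    · intro i hi y hy h1 h2
      rcases Nat.lt_succ_iff_lt_or_eq.1 hi with h | rfl
      · simp only [h, h.le, Nat.succ_le_of_lt h, if_true] at h1 h2 ⊢
        rcases Finset.mem_insert.1 hy with rfl | hy
        · have := breakpoints_le hmono (Nat.succ_le_of_lt h) le_rfl
          rw [han] at this
          exact absurd (h2.trans this) (not_le.2 hBd)
        · exact hD i h y hy h1 h2
      · simp only [le_refl, if_true, han, lt_irrefl, if_false] at h1 ⊢
        rcases Finset.mem_insert.1 hy with rfl | hy
        · rfl
        · exact absurd h1 (not_le.2 (hB' y hy))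

namespace IsFPPrim

variable {g Φ : ℝ → ℂ} {D : Finset ℝ} {A B : ℝ}

theorem exists_log (h : IsFPPrim g Φ D A B) {c : ℝ} (hc : c ∈ Set.Icc A B) :
    ∃ (κ : ℂ) (P : ℝ → ℂ), MeromorphicAt P c ∧
      ∀ᶠ t in 𝓝[≠] c, Φ t = κ * Real.log (t - c) + P t := by
  by_cases hD : c ∈ D
  · exact h.log c hc hD
  · exact ⟨0, Φ, (h.analytic c hc hD).meromorphicAt, Eventually.of_forall fun t => by simp⟩

theorem mono (h : IsFPPrim g Φ D A B) {a b : ℝ} (ha : A ≤ a) (hb : b ≤ B) :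
    IsFPPrim g Φ D a b :=
  ⟨fun t ht => h.deriv t (Set.Icc_subset_Icc ha hb ht),
    fun t ht => h.analytic t (Set.Icc_subset_Icc ha hb ht),
    fun t ht => h.log t (Set.Icc_subset_Icc ha hb ht)⟩

theorem hasHadamardIntegral (h : IsFPPrim g Φ D A B) {a b c : ℝ} (hA : A ≤ a) (hac : a < c)
    (hcb : c < b) (hB : b ≤ B) (hD : ∀ d ∈ D, a ≤ d → d ≤ b → d = c) :
    HasHadamardIntegral g a c b (Φ b - Φ a) := by
  obtain ⟨κ, P, hP, hΦ⟩ := h.exists_log (c := c) ⟨hA.trans hac.le, hcb.le.trans hB⟩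
  refine hasHadamardIntegral_of_primitive hac hcb ?_ ?_ hP hΦ
  · exact fun t ht htc => h.deriv t (Set.Icc_subset_Icc hA hB ht) fun hd =>
      htc (hD t hd ht.1 ht.2)
  · exact fun t ht htc => h.analytic t (Set.Icc_subset_Icc hA hB ht) fun hd =>
      htc (hD t hd ht.1 ht.2)

theorem chain (h : IsFPPrim g Φ D A B) {n : ℕ} {a c : ℕ → ℝ} (ha0 : A ≤ a 0) (han : a n ≤ B)
    (hac : ∀ i < n, a i < c i ∧ c i < a (i + 1))
    (hD : ∀ i < n, ∀ d ∈ D, a i ≤ d → d ≤ a (i + 1) → d = c i) :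
    ∀ i < n, HasHadamardIntegral g (a i) (c i) (a (i + 1)) (Φ (a (i + 1)) - Φ (a i)) := by
  intro i hi
  have hmono : ∀ i < n, a i < a (i + 1) := fun i hi => (hac i hi).1.trans (hac i hi).2
  exact h.hasHadamardIntegral (ha0.trans (breakpoints_le hmono (Nat.zero_le i) hi.le)) (hac i hi).1
    (hac i hi).2 ((breakpoints_le hmono (Nat.succ_le_of_lt hi) le_rfl).trans han) (hD i hi)

end IsFPPrim

/-- `v` is the finite-part integral of `g` over `[A, B]`, whose end points are regular. -/
def HasFP (g : ℝ → ℂ) (A B : ℝ) (v : ℂ) : Prop :=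
  A ≤ B ∧ ∃ (D : Finset ℝ) (Φ : ℝ → ℂ), A ∉ D ∧ B ∉ D ∧ IsFPPrim g Φ D A B ∧ v = Φ B - Φ A

theorem IsFPPrim.hasFP {g Φ : ℝ → ℂ} {D : Finset ℝ} {A B a b : ℝ} (h : IsFPPrim g Φ D A B)
    (hA : A ≤ a) (hab : a ≤ b) (hB : b ≤ B) (ha : a ∉ D) (hb : b ∉ D) :
    HasFP g a b (Φ b - Φ a) :=
  ⟨hab, D, Φ, ha, hb, h.mono hA hB, rfl⟩

namespace HasFP

variable {g g₁ g₂ : ℝ → ℂ} {A B : ℝ} {v v₁ v₂ : ℂ}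

/-- A finite-part integral is a sum of Hadamard integrals, over break points which may be chosen
so as to avoid a given finite set. -/
theorem exists_chain (h : HasFP g A B v) :
    ∃ (n : ℕ) (a c : ℕ → ℝ) (u : ℕ → ℂ), a 0 = A ∧ a n = B ∧
      (∀ i < n, HasHadamardIntegral g (a i) (c i) (a (i + 1)) (u i)) ∧
      v = ∑ i ∈ Finset.range n, u i := by
  classical
  obtain ⟨hAB, D, Φ, hA, hB, hΦ, rfl⟩ := h
  rcases hAB.eq_or_lt with rfl | hAB
  · exact ⟨0, fun _ => A, fun _ => A, fun _ => 0, rfl, rfl, by simp, by simp⟩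
  -- D may contain points outside [A, B], which are irrelevant; the end points themselves are not in
  -- D.
  · obtain ⟨n, a, c, ha0, han, hac, hD⟩ := exists_breakpoints (D.filter fun d => A < d ∧ d < B) hAB
      fun d hd => (Finset.mem_filter.1 hd).2
    have hmono : ∀ i < n, a i < a (i + 1) := fun i hi => (hac i hi).1.trans (hac i hi).2
    refine ⟨n, a, c, fun i => Φ (a (i + 1)) - Φ (a i), ha0, han,
      hΦ.chain ha0.ge han.le hac fun i hi d hd h1 h2 => hD i hi d ?_ h1 h2, ?_⟩
    · have h3 := breakpoints_le hmono (Nat.zero_le i) hi.le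
      have h4 := breakpoints_le hmono (Nat.succ_le_of_lt hi) le_rfl
      rw [ha0] at h3
      rw [han] at h4
      refine Finset.mem_filter.2 ⟨hd, lt_of_le_of_ne (h3.trans h1) ?_,
        lt_of_le_of_ne (h2.trans h4) ?_⟩
      · rintro rfl; exact hA hd
      · rintro rfl; exact hB hd
    · rw [Finset.sum_range_sub (fun i => Φ (a i)), ha0, han]

/-- Break points adapted to the union of the two singular sets serve both primitives. Piece by piece
the increments agree by uniqueness of the Hadamard integral, and the sums telescope. -/
theorem unique (h₁ : HasFP g A B v₁) (h₂ : HasFP g A B v₂) : v₁ = v₂ := by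
  classical
  obtain ⟨hAB, D₁, Φ₁, hA₁, hB₁, hΦ₁, rfl⟩ := h₁
  obtain ⟨-, D₂, Φ₂, hA₂, hB₂, hΦ₂, rfl⟩ := h₂
  rcases hAB.eq_or_lt with rfl | hAB
  · simp
  · obtain ⟨n, a, c, ha0, han, hac, hD⟩ := exists_breakpoints
      ((D₁ ∪ D₂).filter fun d => A < d ∧ d < B) hAB fun d hd => (Finset.mem_filter.1 hd).2
    have hmono : ∀ i < n, a i < a (i + 1) := fun i hi => (hac i hi).1.trans (hac i hi).2
    have hD' : ∀ i < n, ∀ d ∈ D₁ ∪ D₂, d ≠ A → d ≠ B → a i ≤ d → d ≤ a (i + 1) → d = c i := by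
      intro i hi d hd hdA hdB h1 h2
      refine hD i hi d ?_ h1 h2
      have h3 := breakpoints_le hmono (Nat.zero_le i) hi.le
      have h4 := breakpoints_le hmono (Nat.succ_le_of_lt hi) le_rfl
      rw [ha0] at h3
      rw [han] at h4
      exact Finset.mem_filter.2 ⟨hd, lt_of_le_of_ne (h3.trans h1) hdA.symm,
        lt_of_le_of_ne (h2.trans h4) hdB⟩
    have e₁ := hΦ₁.chain ha0.ge han.le hac fun i hi d hd => hD' i hi d
      (Finset.mem_union_left _ hd) (by rintro rfl; exact hA₁ hd) (by rintro rfl; exact hB₁ hd)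
    have e₂ := hΦ₂.chain ha0.ge han.le hac fun i hi d hd => hD' i hi d
      (Finset.mem_union_right _ hd) (by rintro rfl; exact hA₂ hd) (by rintro rfl; exact hB₂ hd)
    rw [← ha0, ← han, ← Finset.sum_range_sub (fun i => Φ₁ (a i)),
      ← Finset.sum_range_sub (fun i => Φ₂ (a i))]
    exact Finset.sum_congr rfl fun i hi =>
      (e₁ i (Finset.mem_range.1 hi)).unique (e₂ i (Finset.mem_range.1 hi))

theorem add (h₁ : HasFP g₁ A B v₁) (h₂ : HasFP g₂ A B v₂) :
    HasFP (fun t => g₁ t + g₂ t) A B (v₁ + v₂) := by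
  classical
  obtain ⟨hAB, D₁, Φ₁, hA₁, hB₁, hΦ₁, rfl⟩ := h₁
  obtain ⟨-, D₂, Φ₂, hA₂, hB₂, hΦ₂, rfl⟩ := h₂
  refine ⟨hAB, D₁ ∪ D₂, fun t => Φ₁ t + Φ₂ t, by simp [hA₁, hA₂], by simp [hB₁, hB₂],
    ⟨fun t ht htD => ?_, fun t ht htD => ?_, fun c hc _ => ?_⟩, by ring⟩
  · rw [Finset.mem_union, not_or] at htD
    exact (hΦ₁.deriv t ht htD.1).add (hΦ₂.deriv t ht htD.2)
  · rw [Finset.mem_union, not_or] at htD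
    exact (hΦ₁.analytic t ht htD.1).add (hΦ₂.analytic t ht htD.2)
  · obtain ⟨κ₁, P₁, hP₁, h₁⟩ := hΦ₁.exists_log hc
    obtain ⟨κ₂, P₂, hP₂, h₂⟩ := hΦ₂.exists_log hc
    refine ⟨κ₁ + κ₂, P₁ + P₂, hP₁.add hP₂, ?_⟩
    filter_upwards [h₁, h₂] with t e₁ e₂
    rw [e₁, e₂, Pi.add_apply]
    ring

theorem const_mul (h : HasFP g A B v) (d : ℂ) : HasFP (fun t => d * g t) A B (d * v) := by
  obtain ⟨hAB, D, Φ, hA, hB, hΦ, rfl⟩ := h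
  refine ⟨hAB, D, fun t => d * Φ t, hA, hB,
    ⟨fun t ht htD => (hΦ.deriv t ht htD).const_mul d,
      fun t ht htD => analyticAt_const.mul (hΦ.analytic t ht htD), fun c hc _ => ?_⟩, by ring⟩
  obtain ⟨κ, P, hP, h⟩ := hΦ.exists_log hc
  refine ⟨d * κ, fun t => d * P t, (MeromorphicAt.const d c).mul hP, ?_⟩
  filter_upwards [h] with t e
  rw [e]
  ring

theorem zero (hAB : A ≤ B) : HasFP (fun _ => 0) A B 0 :=
  ⟨hAB, ∅, fun _ => 0, by simp, by simp,
    ⟨fun t _ _ => hasDerivAt_const t 0, fun _ _ _ => analyticAt_const, by simp⟩, by simp⟩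

theorem sum {ι : Type*} (s : Finset ι) {g : ι → ℝ → ℂ} {v : ι → ℂ} (hAB : A ≤ B)
    (h : ∀ i ∈ s, HasFP (g i) A B (v i)) :
    HasFP (fun t => ∑ i ∈ s, g i t) A B (∑ i ∈ s, v i) := by
  classical
  induction s using Finset.induction_on with
  | empty => simpa using zero hAB
  | insert a s ha ih =>
    simp only [Finset.sum_insert ha]
    exact (h a (Finset.mem_insert_self _ _)).add
      (ih fun i hi => h i (Finset.mem_insert_of_mem hi))

/-- Exceptional points are simply added to the singular set, which is allowed to contain regular
points of the primitive. -/
theorem congr (h : HasFP g₁ A B v) (E : Finset ℝ) (hA : A ∉ E) (hB : B ∉ E)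
    (hE : ∀ t ∈ Set.Icc A B, t ∉ E → g₁ t = g₂ t) : HasFP g₂ A B v := by
  classical
  obtain ⟨hAB, D, Φ, hA', hB', hΦ, rfl⟩ := h
  refine ⟨hAB, D ∪ E, Φ, by simp [hA, hA'], by simp [hB, hB'],
    ⟨fun t ht htD => ?_, fun t ht htD => ?_, fun c hc _ => hΦ.exists_log hc⟩, rfl⟩
  · rw [Finset.mem_union, not_or] at htD
    rw [← hE t ht htD.2]
    exact hΦ.deriv t ht htD.1
  · rw [Finset.mem_union, not_or] at htD
    exact hΦ.analytic t ht htD.1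

/-- Finite-part integrals are invariant under `t ↦ 1 / t`. -/
theorem reflect (hA : 0 < A) (h : HasFP g A B v) :
    HasFP (fun t => (1 / (t : ℂ) ^ 2) * g (1 / t)) B⁻¹ A⁻¹ v := by
  classical
  obtain ⟨hAB, D, Φ, hA', hB', hΦ, rfl⟩ := h
  have hB : 0 < B := hA.trans_le hAB
  have hmem : ∀ t ∈ Set.Icc B⁻¹ A⁻¹, 0 < t ∧ 1 / t ∈ Set.Icc A B := by
    intro t ht
    have h0 : 0 < t := (inv_pos.2 hB).trans_le ht.1
    refine ⟨h0, ?_, ?_⟩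
    · rw [one_div]; exact (le_inv_comm₀ hA h0).2 ht.2
    · rw [one_div]; exact (inv_le_comm₀ h0 hB).2 ht.1
  have hD : ∀ t : ℝ, t ∉ D.image (fun d => d⁻¹) → 1 / t ∉ D := by
    intro t ht h
    refine ht (Finset.mem_image.2 ⟨1 / t, h, by simp⟩)
  have hD' : ∀ t : ℝ, t ∉ D → t⁻¹ ∉ D.image (fun d => d⁻¹) := by
    intro t ht h
    obtain ⟨d, hd, he⟩ := Finset.mem_image.1 h
    rw [inv_inj] at he
    exact ht (he ▸ hd)
  have hinv : ∀ t : ℝ, 0 < t → AnalyticAt ℝ (fun t : ℝ => 1 / t) t := fun t ht =>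
    analyticAt_const.div analyticAt_id ht.ne'
  refine ⟨inv_anti₀ hA hAB, D.image fun d => d⁻¹, fun t => -Φ (1 / t), hD' _ hB', hD' _ hA',
    ⟨fun t ht htD => ?_, fun t ht htD => ?_, fun c hc _ => ?_⟩, by simp; ring⟩
  · obtain ⟨h0, h1⟩ := hmem t ht
    have h2 := hΦ.deriv _ h1 (hD t htD)
    have h3 : HasDerivAt (fun t : ℝ => 1 / t) (-(t ^ 2)⁻¹) t := by
      simpa using hasDerivAt_inv h0.ne'
    have h4 := (HasDerivAt.scomp t h2 h3).neg
    refine h4.congr_deriv ?_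
    rw [Complex.real_smul]
    push_cast
    ring
  · obtain ⟨h0, h1⟩ := hmem t ht
    exact ((hΦ.analytic _ h1 (hD t htD)).comp (hinv t h0)).neg
  · obtain ⟨h0, h1⟩ := hmem c hc
    obtain ⟨κ, P, hP, hlog⟩ := hΦ.exists_log h1
    have h5 : Tendsto (fun t : ℝ => 1 / t) (𝓝[≠] c) (𝓝[≠] (1 / c)) := by
      refine tendsto_nhdsWithin_iff.2
        ⟨(hinv c h0).continuousAt.tendsto.mono_left nhdsWithin_le_nhds, ?_⟩
      filter_upwards [self_mem_nhdsWithin] with t ht h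
      simp at h
      exact ht h
    -- From log|1/t - 1/c| = log|t - c| - log c - log t, the last two terms being analytic at c; the
    -- sign comes from the primitive -Φ(1/t).
    refine ⟨-κ, fun t => κ * (Real.log c + Real.log t : ℝ) - P (1 / t), ?_, ?_⟩
    · refine MeromorphicAt.sub (AnalyticAt.meromorphicAt ?_) (hP.comp_analyticAt (hinv c h0))
      refine analyticAt_const.mul ?_
      refine AnalyticAt.comp (g := fun t : ℝ => (t : ℂ)) (ofRealCLM.analyticAt _) ?_
      exact analyticAt_const.add (analyticAt_log h0)
    · filter_upwards [h5.eventually hlog, nhdsWithin_le_nhds (lt_mem_nhds h0),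
        self_mem_nhdsWithin] with t ht ht0 htc
      have htc' : t - c ≠ 0 := sub_ne_zero.2 htc
      have : 1 / t - 1 / c = -((t - c) / (c * t)) := by
        field_simp
        ring
      rw [ht, this, Real.log_neg_eq_log, Real.log_div htc' (by positivity),
        Real.log_mul h0.ne' ht0.ne']
      push_cast
      ring

end HasFP

/-! ### Existence of finite-part primitives -/

/-- Near each point G has a holomorphic primitive on a disc, and the integral from A differs from it
by a constant; this yields real-analyticity of the primitive. -/
theorem exists_isFPPrim_of_analyticAt {G : ℂ → ℂ} {A B : ℝ}
    (hG : ∀ x ∈ Set.Icc A B, AnalyticAt ℂ G (x : ℂ)) :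
    IsFPPrim (fun t : ℝ => G t) (fun t => ∫ u in A..t, G u) ∅ A B := by
  have hcont : ContinuousOn (fun t : ℝ => G t) (Set.Icc A B) := fun x hx =>
    (analyticAt_comp_ofReal (hG x hx)).continuousAt.continuousWithinAt
  have key : ∀ x ∈ Set.Icc A B, ∃ P : ℂ → ℂ, AnalyticAt ℂ P x ∧ HasDerivAt P (G x) x ∧
      (fun t => ∫ u in A..t, G u) =ᶠ[𝓝 x] fun t : ℝ => (∫ u in A..x, G u) + (P t - P x) := by
    intro x hx
    obtain ⟨r, hr, hball⟩ := Metric.eventually_nhds_iff_ball.1 (hG x hx).eventually_analyticAt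
    have hdiff : DifferentiableOn ℂ G (Metric.ball x r) := fun z hz =>
      (hball z hz).differentiableAt.differentiableWithinAt
    obtain ⟨P, hP⟩ := hdiff.isExactOn_ball
    have hx0 : (x : ℂ) ∈ Metric.ball (x : ℂ) r := Metric.mem_ball_self hr
    refine ⟨P, ?_, hP x hx0, ?_⟩
    · exact DifferentiableOn.analyticAt (s := Metric.ball (x : ℂ) r) (fun z hz =>
        (hP z hz).differentiableAt.differentiableWithinAt) (Metric.ball_mem_nhds _ hr)
    · filter_upwards [Metric.ball_mem_nhds x hr] with t ht
      have hsub : ∀ u ∈ Set.uIcc x t, (u : ℂ) ∈ Metric.ball (x : ℂ) r := by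
        intro u hu
        rw [Metric.mem_ball, dist_eq_norm] at ht ⊢
        rw [← ofReal_sub, norm_real]
        exact (Set.abs_sub_left_of_mem_uIcc hu).trans_lt ht
      have hint : IntervalIntegrable (fun u : ℝ => G u) volume x t :=
        ContinuousOn.intervalIntegrable fun u hu =>
          (analyticAt_comp_ofReal (hball _ (hsub u hu))).continuousAt.continuousWithinAt
      have hint' : IntervalIntegrable (fun u : ℝ => G u) volume A x := by
        refine ContinuousOn.intervalIntegrable ?_
        rw [Set.uIcc_of_le hx.1]
        exact hcont.mono (Set.Icc_subset_Icc_right hx.2)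
      rw [← intervalIntegral.integral_add_adjacent_intervals hint' hint]
      congr 1
      exact intervalIntegral.integral_eq_sub_of_hasDerivAt
        (fun u hu => (hP u (hsub u hu)).comp_ofReal) hint
  refine ⟨fun t ht _ => ?_, fun t ht _ => ?_, by simp⟩
  · obtain ⟨P, -, hP, he⟩ := key t ht
    refine HasDerivAt.congr_of_eventuallyEq ?_ he
    exact (hP.comp_ofReal.sub_const _).const_add _
  · obtain ⟨P, hP, -, he⟩ := key t ht
    refine AnalyticAt.congr ?_ he.symm
    exact analyticAt_const.add ((analyticAt_comp_ofReal hP).sub analyticAt_const)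

/-- The principal part `S` of a meromorphic function, with a primitive of `S - κ / (z - d)`. -/
theorem exists_principalPart_primitive {G : ℂ → ℂ} {d : ℂ} (hG : MeromorphicAt G d) :
    ∃ (κ : ℂ) (S R q : ℂ → ℂ), (∀ z, z ≠ d → AnalyticAt ℂ S z) ∧ (∀ z, MeromorphicAt R z) ∧
      (∀ z, z ≠ d → AnalyticAt ℂ R z) ∧ (∀ z, z ≠ d → HasDerivAt R (S z - κ * (z - d)⁻¹) z) ∧
      AnalyticAt ℂ (Function.update (fun z => G z - S z) d (q d)) d := by
  obtain ⟨N, β, q, hq, hGq⟩ := exists_principalPart hG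
  set S : ℂ → ℂ := fun z => ∑ j ∈ Finset.range N, ((z - d) ^ (j + 1))⁻¹ * β j with hS
  have hSa : ∀ z : ℂ, z ≠ d → AnalyticAt ℂ S z := by
    intro z hz
    refine Finset.analyticAt_fun_sum _ fun j _ => AnalyticAt.mul ?_ analyticAt_const
    exact AnalyticAt.inv (by fun_prop) (pow_ne_zero _ (sub_ne_zero.2 hz))
  have hG₁d : AnalyticAt ℂ (Function.update (fun z => G z - S z) d (q d)) d := by
    refine hq.congr ?_
    have h2 := eventually_nhdsWithin_iff.1 hGq
    filter_upwards [h2] with u hu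
    rcases eq_or_ne u d with rfl | hne
    · simp
    · rw [Function.update_of_ne hne, hu hne]
      simp [hS]
  -- The summand j = 0 vanishes because 1/0 = 0. It would belong to the residue term β 0/(z - d),
  -- which has no meromorphic primitive and is split off as κ.
  set R : ℂ → ℂ := fun z => ∑ j ∈ Finset.range N, -(1 / (j : ℂ)) * ((z - d) ^ j)⁻¹ * β j with hR
  have hRm : ∀ z : ℂ, MeromorphicAt R z := by
    intro z
    refine MeromorphicAt.fun_sum fun j _ => ?_
    refine ((MeromorphicAt.const _ _).mul (MeromorphicAt.inv ?_)).mul (MeromorphicAt.const _ _)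
    exact AnalyticAt.meromorphicAt (by fun_prop)
  have hRa : ∀ z : ℂ, z ≠ d → AnalyticAt ℂ R z := by
    intro z hz
    refine Finset.analyticAt_fun_sum _ fun j _ => AnalyticAt.mul ?_ analyticAt_const
    refine analyticAt_const.mul ?_
    exact AnalyticAt.inv (by fun_prop) (pow_ne_zero _ (sub_ne_zero.2 hz))
  set κ : ℂ := ∑ j ∈ Finset.range N, if j = 0 then β j else 0 with hκ
  have hRd : ∀ z : ℂ, z ≠ d → HasDerivAt R (S z - κ * (z - d)⁻¹) z := by
    intro z hz
    have hz' : z - d ≠ 0 := sub_ne_zero.2 hz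
    have : S z - κ * (z - d)⁻¹ = ∑ j ∈ Finset.range N,
        (((z - d) ^ (j + 1))⁻¹ * β j - (if j = 0 then β j else 0) * (z - d)⁻¹) := by
      rw [Finset.sum_sub_distrib, ← Finset.sum_mul]
    rw [this]
    refine HasDerivAt.fun_sum fun j _ => ?_
    rcases Nat.eq_zero_or_pos j with rfl | hj
    · simp only [zero_add, pow_one, if_true, Nat.cast_zero, div_zero, neg_zero, zero_mul]
      refine (hasDerivAt_const z (0 : ℂ)).congr_deriv ?_
      ring
    · rw [if_neg hj.ne', zero_mul, sub_zero]
      refine HasDerivAt.mul_const ?_ _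
      have hj0 : (j : ℂ) ≠ 0 := Nat.cast_ne_zero.2 hj.ne'
      have h0 : HasDerivAt (fun z : ℂ => z - d) 1 z := (hasDerivAt_id z).sub_const _
      have := ((h0.pow j).inv (pow_ne_zero _ hz')).const_mul (-(1 / (j : ℂ)))
      refine this.congr_deriv ?_
      simp only [Pi.pow_apply]
      generalize z - d = w at hz'
      obtain ⟨i, rfl⟩ : ∃ i, j = i + 1 := ⟨j - 1, by omega⟩
      have e1 : (w ^ (i + 1)) ^ 2 = w ^ i * w ^ (i + 1 + 1) := by ring
      rw [e1, Nat.add_sub_cancel]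
      field_simp
  exact ⟨κ, S, R, q, hSa, hRm, hRa, hRd, hG₁d⟩

/-- Induction on D: subtract the principal part at d, apply the induction hypothesis to the
remainder, and add back the primitive κ log|t - d| + R(t) of that principal part. -/
theorem exists_isFPPrim (D : Finset ℝ) {A B : ℝ} : ∀ {G : ℂ → ℂ},
    (∀ x ∈ Set.Icc A B, MeromorphicAt G (x : ℂ)) →
    (∀ x ∈ Set.Icc A B, x ∉ D → AnalyticAt ℂ G (x : ℂ)) →
    ∃ Φ, IsFPPrim (fun t : ℝ => G t) Φ D A B := by
  classical
  induction D using Finset.induction_on with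
  | empty => exact fun _ h => ⟨_, exists_isFPPrim_of_analyticAt fun x hx => h x hx (by simp)⟩
  | insert d D hdD ih =>
    intro G hG hGD
    by_cases hd : d ∈ Set.Icc A B
    swap
    · obtain ⟨Φ, hΦ⟩ := ih hG fun x hx hxD => hGD x hx (by
        rw [Finset.mem_insert, not_or]
        exact ⟨by rintro rfl; exact hd hx, hxD⟩)
      refine ⟨Φ, fun t ht htD => hΦ.deriv t ht fun h => htD (Finset.mem_insert_of_mem h),
        fun t ht htD => hΦ.analytic t ht fun h => htD (Finset.mem_insert_of_mem h),
        fun c hc _ => hΦ.exists_log hc⟩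
    obtain ⟨κ, S, R, q, hSa, hRm, hRa, hRd, hG₁d⟩ := exists_principalPart_primitive (hG d hd)
    set G₁ : ℂ → ℂ := Function.update (fun z => G z - S z) d (q d) with hG₁
    have hG₁ne : ∀ z : ℂ, z ≠ d → G₁ =ᶠ[𝓝 z] fun z => G z - S z := by
      intro z hz
      filter_upwards [isOpen_ne.mem_nhds hz] with u hu
      rw [hG₁, Function.update_of_ne hu]
    have hcast : ∀ x : ℝ, x ≠ d → (x : ℂ) ≠ d := fun x hx h => hx (ofReal_injective h)
    obtain ⟨Φ, hΦ⟩ := ih (G := G₁)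
      (by
        intro x hx
        rcases eq_or_ne x d with rfl | hne
        · exact hG₁d.meromorphicAt
        · exact ((hG x hx).sub (hSa _ (hcast x hne)).meromorphicAt).congr
            ((hG₁ne _ (hcast x hne)).symm.filter_mono nhdsWithin_le_nhds))
      (by
        intro x hx hxD
        rcases eq_or_ne x d with rfl | hne
        · exact hG₁d
        · refine ((hGD x hx ?_).sub (hSa _ (hcast x hne))).congr (hG₁ne _ (hcast x hne)).symm
          simp [hne, hxD])
    refine ⟨fun t => Φ t + (κ * Real.log (t - d) + R t), fun t ht htD => ?_, fun t ht htD => ?_,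
      fun c hc _ => ?_⟩
    · rw [Finset.mem_insert, not_or] at htD
      have h1 := hΦ.deriv t ht htD.2
      have h2 := ((hasDerivAt_ofReal_log_sub htD.1).const_mul κ).add
        (hRd _ (hcast t htD.1)).comp_ofReal
      refine (h1.add h2).congr_deriv ?_
      rw [hG₁, Function.update_of_ne (hcast t htD.1)]
      ring
    · rw [Finset.mem_insert, not_or] at htD
      exact (hΦ.analytic t ht htD.2).add ((analyticAt_const.mul
        (analyticAt_ofReal_log_sub htD.1)).add (analyticAt_comp_ofReal (hRa _ (hcast t htD.1))))
    · obtain ⟨κ', P, hP, hlog⟩ := hΦ.exists_log hc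
      rcases eq_or_ne c d with rfl | hne
      · refine ⟨κ, fun t => Φ t + R t,
          (hΦ.analytic c hc hdD).meromorphicAt.add (meromorphicAt_comp_ofReal (hRm _)),
          Eventually.of_forall fun t => by ring⟩
      · refine ⟨κ', fun t => P t + (κ * Real.log (t - d) + R t),
          hP.add (((analyticAt_const.mul (analyticAt_ofReal_log_sub hne)).meromorphicAt).add
            (meromorphicAt_comp_ofReal (hRm _))), ?_⟩
        filter_upwards [hlog] with t ht
        rw [ht]
        ring

theorem finite_not_analyticAt {G : ℂ → ℂ} {A B : ℝ}
    (hG : ∀ x ∈ Set.Icc A B, MeromorphicAt G (x : ℂ)) :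
    {x : ℝ | x ∈ Set.Icc A B ∧ ¬ AnalyticAt ℂ G (x : ℂ)}.Finite := by
  have h : {x : ℝ | AnalyticAt ℂ G (x : ℂ)} ∈ codiscreteWithin (Set.Icc A B) := by
    rw [mem_codiscreteWithin]
    intro x hx
    rw [disjoint_principal_right]
    have := (tendsto_ofReal_nhdsNE x).eventually (hG x hx).eventually_analyticAt
    filter_upwards [this] with t ht h
    exact h.2 ht
  exact isCompact_Icc.finite_sdiff_of_mem_codiscreteWithin h

/-- At `x`, `G` is either analytic or has a pole. -/
def RegularOrPole (G : ℂ → ℂ) (x : ℂ) : Prop :=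
  AnalyticAt ℂ G x ∨ (MeromorphicAt G x ∧ meromorphicOrderAt G x < 0)

theorem RegularOrPole.meromorphicAt {G : ℂ → ℂ} {x : ℂ} (h : RegularOrPole G x) :
    MeromorphicAt G x :=
  h.elim AnalyticAt.meromorphicAt And.left

theorem MeromorphicNFAt.regularOrPole {G : ℂ → ℂ} {x : ℂ} (h : MeromorphicNFAt G x) :
    RegularOrPole G x := by
  by_cases h0 : 0 ≤ meromorphicOrderAt G x
  · exact Or.inl (h.meromorphicOrderAt_nonneg_iff_analyticAt.1 h0)
  · exact Or.inr ⟨h.meromorphicAt, not_le.1 h0⟩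

/-- The primitive with exactly the poles of `G` as its singular set. -/
theorem exists_isFPPrim_poles {G : ℂ → ℂ} {A B : ℝ}
    (hG : ∀ x ∈ Set.Icc A B, RegularOrPole G (x : ℂ)) :
    ∃ (D : Finset ℝ) (Φ : ℝ → ℂ), (∀ x, x ∈ D ↔ x ∈ Set.Icc A B ∧ ¬ AnalyticAt ℂ G (x : ℂ)) ∧
      IsFPPrim (fun t : ℝ => G t) Φ D A B := by
  have hfin := finite_not_analyticAt fun x hx => (hG x hx).meromorphicAt
  obtain ⟨Φ, hΦ⟩ := exists_isFPPrim hfin.toFinset (fun x hx => (hG x hx).meromorphicAt)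
    fun x hx hxD => by
      by_contra h
      exact hxD (hfin.mem_toFinset.2 ⟨hx, h⟩)
  exact ⟨hfin.toFinset, Φ, fun x => hfin.mem_toFinset, hΦ⟩

end QMF

end

noncomputable section

namespace QMF

/-! ### Integrability excludes poles -/

theorem isBigO_inv_sub_of_pole {G : ℂ → ℂ} {x : ℂ} (hG : MeromorphicAt G x)
    (h : meromorphicOrderAt G x < 0) : (fun z => (z - x)⁻¹) =O[𝓝[≠] x] G := by
  obtain ⟨n, hn⟩ := WithTop.ne_top_iff_exists.1 h.ne_top
  obtain ⟨u, hu, hux, hGu⟩ := (meromorphicOrderAt_eq_int_iff hG).1 hn.symm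
  have hn0 : n < 0 := by rw [← hn] at h; exact_mod_cast h
  obtain ⟨m, hm⟩ : ∃ m : ℕ, n = -(m + 1 : ℤ) := ⟨(-n - 1).toNat, by omega⟩
  set H : ℂ → ℂ := fun z => (z - x) ^ m * (u z)⁻¹ with hH
  have hHc : ContinuousAt H x := by
    have h1 : ContinuousAt (fun z : ℂ => (z - x) ^ m) x := by fun_prop
    exact h1.mul (hu.continuousAt.inv₀ hux)
  have h1 : H =O[𝓝[≠] x] fun _ => (1 : ℂ) :=
    (hHc.tendsto.mono_left nhdsWithin_le_nhds).isBigO_one ℂ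
  have h2 := h1.mul (Asymptotics.isBigO_refl G (𝓝[≠] x))
  have h3 : (fun z => (z - x)⁻¹) =ᶠ[𝓝[≠] x] fun z => H z * G z := by
    filter_upwards [hGu, self_mem_nhdsWithin,
      nhdsWithin_le_nhds (hu.continuousAt.eventually_ne hux)] with z hz hzx huz
    have hzx' : z - x ≠ 0 := sub_ne_zero.2 hzx
    rw [hz, hH, hm, zpow_neg, smul_eq_mul]
    norm_cast
    rw [pow_succ]
    field_simp
  exact Asymptotics.IsBigO.congr' h2 h3.symm (Eventually.of_forall fun z => one_mul _)

/-- Near a pole G dominates 1/(t - x), and w is bounded away from 0 there. As 1/(t - x) is not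
integrable, even when x is an end point of the interval, a pole is excluded. -/
theorem RegularOrPole.analyticAt_of_integrableOn {G : ℂ → ℂ} {w : ℝ → ℂ} {a b x : ℝ}
    (h : RegularOrPole G x) (hab : a < b) (hx : x ∈ Set.Icc a b)
    (hw : (fun _ => (1 : ℝ)) =O[𝓝[≠] x] w)
    (hint : IntegrableOn (fun t : ℝ => w t * G t) (Set.Ioc a b)) : AnalyticAt ℂ G x := by
  refine h.resolve_right fun ⟨hm, ho⟩ => ?_
  have h1 : (fun t : ℝ => ((t : ℂ) - x)⁻¹) =O[𝓝[≠] x] fun t : ℝ => G t :=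
    (isBigO_inv_sub_of_pole hm ho).comp_tendsto (tendsto_ofReal_nhdsNE x)
  have h2 : (fun t : ℝ => (t - x)⁻¹) =O[𝓝[≠] x] fun t : ℝ => w t * G t := by
    have h3 := hw.mul h1.norm_left
    refine Asymptotics.IsBigO.of_norm_left (h3.congr_left fun t => ?_)
    rw [one_mul, ← ofReal_sub, ← ofReal_inv, norm_real]
  refine not_intervalIntegrable_of_sub_inv_isBigO_punctured h2 hab.ne ?_
    ((intervalIntegrable_iff_integrableOn_Ioc_of_le hab.le).2 hint)
  rwa [Set.uIcc_of_le hab.le]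

theorem HasHadamardIntegral.analyticAt {G : ℂ → ℂ} {a b c : ℝ} {v : ℂ}
    (h : HasHadamardIntegral (fun t : ℝ => G t) a c b v) {x : ℝ} (hx : x ∈ Set.Icc a b)
    (hxc : x ≠ c) (hG : RegularOrPole G x) : AnalyticAt ℂ G x := by
  obtain ⟨hac, hcb, σ, δ, R, hδ, hR, hI, hc⟩ := h
  -- Any exponent in the range of convergence will do; the weight |t - c|^z does not vanish at x ≠
  -- c, so it cannot hide a pole at x.
  have h1 := (hI ((max σ 0 + 1 : ℝ) : ℂ)
    (by rw [ofReal_re]; linarith [le_max_left σ 0])).1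
  refine hG.analyticAt_of_integrableOn (hac.trans hcb) hx ?_ h1
  have hne : ((|x - c| : ℝ) : ℂ) ≠ 0 := ofReal_ne_zero.2 (abs_ne_zero.2 (sub_ne_zero.2 hxc))
  have hpos : 0 < |x - c| := abs_pos.2 (sub_ne_zero.2 hxc)
  have hct : ContinuousAt (fun t : ℝ => ((|t - c| : ℝ) : ℂ) ^ ((max σ 0 + 1 : ℝ) : ℂ)) x := by
    refine ContinuousAt.cpow (by fun_prop) continuousAt_const ?_
    exact Or.inl (by simpa using sub_ne_zero.2 hxc)
  have hn : 0 < ‖((|x - c| : ℝ) : ℂ) ^ ((max σ 0 + 1 : ℝ) : ℂ)‖ :=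
    norm_pos_iff.2 (cpow_ne_zero_iff.2 (Or.inl hne))
  refine (Asymptotics.isBigO_const_left_iff_pos_le_norm one_ne_zero).2 ⟨_, half_pos hn, ?_⟩
  filter_upwards [nhdsWithin_le_nhds (hct.norm.eventually (lt_mem_nhds (half_lt_self hn)))] with t ht
  exact ht.le

theorem HasRegIntegralAtInfinity.analyticAt {G : ℂ → ℂ} {T : ℝ} {v : ℂ}
    (h : HasRegIntegralAtInfinity (fun t : ℝ => G t) T v) {x : ℝ} (hx : T ≤ x)
    (hG : RegularOrPole G x) : AnalyticAt ℂ G x := by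
  refine hG.analyticAt_of_integrableOn (a := T) (b := x + 1) (w := fun _ => 1) (by linarith)
    ⟨hx, by linarith⟩ ?_ ?_
  · exact Asymptotics.isBigO_const_const _ one_ne_zero _
  · simpa using h.integrableOn (x + 1)

/-! ### Uniqueness of regularized integrals -/

theorem hasFP_integral {G : ℂ → ℂ} {A B : ℝ} (hAB : A ≤ B)
    (hG : ∀ x ∈ Set.Icc A B, AnalyticAt ℂ G (x : ℂ)) :
    HasFP (fun t : ℝ => G t) A B (∫ t in A..B, G t) := by
  have := (exists_isFPPrim_of_analyticAt hG).hasFP le_rfl hAB le_rfl (by simp) (by simp)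
  simpa using this

theorem HasFP.concat {G : ℂ → ℂ} {A B C : ℝ} {v w : ℂ}
    (hG : ∀ x ∈ Set.Icc A C, RegularOrPole G (x : ℂ)) (hA : AnalyticAt ℂ G A)
    (hB : AnalyticAt ℂ G B) (hC : AnalyticAt ℂ G C) (h₁ : HasFP (fun t : ℝ => G t) A B v)
    (h₂ : HasFP (fun t : ℝ => G t) B C w) : HasFP (fun t : ℝ => G t) A C (v + w) := by
  obtain ⟨D, Φ, hD, hΦ⟩ := exists_isFPPrim_poles hG
  have hA' : A ∉ D := fun h => ((hD A).1 h).2 hA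
  have hB' : B ∉ D := fun h => ((hD B).1 h).2 hB
  have hC' : C ∉ D := fun h => ((hD C).1 h).2 hC
  rw [h₁.unique (hΦ.hasFP le_rfl h₁.1 h₂.1 hA' hB'), h₂.unique (hΦ.hasFP h₁.1 h₂.1 le_rfl hB' hC')]
  have := hΦ.hasFP le_rfl (h₁.1.trans h₂.1) le_rfl hA' hC'
  convert this using 1
  ring

/-- Converse of `HasFP.exists_chain` for functions that are regular or have poles. Existence of the
Hadamard integrals forces all poles to sit at the centres, so one global primitive computes every
piece. The last break point needs its own hypothesis, because n may be 0. -/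
theorem hasFP_of_chain {G : ℂ → ℂ} {n : ℕ} {a c : ℕ → ℝ} {u : ℕ → ℂ}
    (h : ∀ i < n, HasHadamardIntegral (fun t : ℝ => G t) (a i) (c i) (a (i + 1)) (u i))
    (hG : ∀ x ∈ Set.Icc (a 0) (a n), RegularOrPole G (x : ℂ)) (h0 : AnalyticAt ℂ G (a n)) :
    AnalyticAt ℂ G (a 0) ∧
      HasFP (fun t : ℝ => G t) (a 0) (a n) (∑ i ∈ Finset.range n, u i) := by
  obtain ⟨D, Φ, hD, hΦ⟩ := exists_isFPPrim_poles hG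
  have hmono : ∀ i < n, a i < a (i + 1) := fun i hi => (h i hi).1.trans (h i hi).2.1
  have hmem : ∀ i < n, Set.Icc (a i) (a (i + 1)) ⊆ Set.Icc (a 0) (a n) := fun i hi =>
    Set.Icc_subset_Icc (breakpoints_le hmono (Nat.zero_le i) hi.le)
      (breakpoints_le hmono (Nat.succ_le_of_lt hi) le_rfl)
  have han : ∀ i < n, ∀ x ∈ Set.Icc (a i) (a (i + 1)), x ≠ c i → AnalyticAt ℂ G x :=
    fun i hi x hx hxc => (h i hi).analyticAt hx hxc (hG x (hmem i hi hx))
  have hu : ∀ i < n, u i = Φ (a (i + 1)) - Φ (a i) := by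
    intro i hi
    refine (h i hi).unique (hΦ.hasHadamardIntegral (hmem i hi ⟨le_rfl, (hmono i hi).le⟩).1
      (h i hi).1 (h i hi).2.1 (hmem i hi ⟨(hmono i hi).le, le_rfl⟩).2 fun d hd h1 h2 => ?_)
    by_contra hdc
    exact ((hD d).1 hd).2 (han i hi d ⟨h1, h2⟩ hdc)
  have ha0 : AnalyticAt ℂ G (a 0) := by
    rcases Nat.eq_zero_or_pos n with rfl | hn
    · exact h0
    · exact han 0 hn _ ⟨le_rfl, (hmono 0 hn).le⟩ (h 0 hn).1.ne
  refine ⟨ha0, ?_⟩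
  have := hΦ.hasFP le_rfl (breakpoints_le hmono (Nat.zero_le n) le_rfl) le_rfl
    (fun h => ((hD _).1 h).2 ha0) (fun h => ((hD _).1 h).2 h0)
  rw [← Finset.sum_range_sub (fun i => Φ (a i))] at this
  rwa [Finset.sum_congr rfl fun i hi => hu i (Finset.mem_range.1 hi)]

/-- Normal form of the definition: beyond the last break point there are no poles, so the split into
a finite part and a tail may be moved to any larger B. Two such integrals can then be compared at a
common B. -/
theorem HasRegIntegralIoi.exists_hasFP {G : ℂ → ℂ} {T : ℝ} {v : ℂ}
    (h : HasRegIntegralIoi (fun t : ℝ => G t) T v) (hG : ∀ x : ℝ, T ≤ x → RegularOrPole G x) :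
    ∃ B₀ : ℝ, ∀ B ≥ B₀, ∃ w, HasFP (fun t : ℝ => G t) T B w ∧
      HasRegIntegralAtInfinity (fun t : ℝ => G t) B (v - w) := by
  obtain ⟨n, a, c, u, u', rfl, hch, hreg, rfl⟩ := h
  have hmono : ∀ i < n, a i < a (i + 1) := fun i hi => (hch i hi).1.trans (hch i hi).2.1
  have hle := breakpoints_le hmono (Nat.zero_le n) le_rfl
  have han : ∀ x : ℝ, a n ≤ x → AnalyticAt ℂ G x := fun x hx =>
    hreg.analyticAt hx (hG x (hle.trans hx))
  obtain ⟨ha0, hFP⟩ := hasFP_of_chain hch (fun x hx => hG x hx.1) (han _ le_rfl)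
  refine ⟨a n, fun B hB => ⟨_, hFP.concat (fun x hx => hG x hx.1) ha0 (han _ le_rfl) (han _ hB)
    (hasFP_integral hB fun x hx => han x hx.1), ?_⟩⟩
  have := hreg.shift hB
  convert this using 1
  ring

theorem HasRegIntegralIoi.unique {G : ℂ → ℂ} {T : ℝ} {v₁ v₂ : ℂ}
    (hG : ∀ x : ℝ, T ≤ x → RegularOrPole G x) (h₁ : HasRegIntegralIoi (fun t : ℝ => G t) T v₁)
    (h₂ : HasRegIntegralIoi (fun t : ℝ => G t) T v₂) : v₁ = v₂ := by
  obtain ⟨B₁, hB₁⟩ := h₁.exists_hasFP hG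
  obtain ⟨B₂, hB₂⟩ := h₂.exists_hasFP hG
  obtain ⟨w₁, e₁, r₁⟩ := hB₁ _ (le_max_left B₁ B₂)
  obtain ⟨w₂, e₂, r₂⟩ := hB₂ _ (le_max_right B₁ B₂)
  have := r₁.unique r₂
  rw [e₁.unique e₂] at this
  linear_combination this

theorem HasFP.hasRegIntegralIoi {g : ℝ → ℂ} {T B : ℝ} {v w : ℂ} (h : HasFP g T B v)
    (hB : HasRegIntegralAtInfinity g B w) : HasRegIntegralIoi g T (v + w) := by
  obtain ⟨n, a, c, u, ha0, han, hch, rfl⟩ := h.exists_chain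
  exact ⟨n, a, c, u, w, ha0, hch, han ▸ hB, rfl⟩

theorem regIntegralIoi_eq {G : ℂ → ℂ} {T : ℝ} {v : ℂ}
    (hG : ∀ x : ℝ, T ≤ x → RegularOrPole G x) (h : HasRegIntegralIoi (fun t : ℝ => G t) T v) :
    regIntegralIoi (fun t : ℝ => G t) T = v := by
  have hex : ∃ v, HasRegIntegralIoi (fun t : ℝ => G t) T v := ⟨v, h⟩
  rw [regIntegralIoi, dif_pos hex]
  exact HasRegIntegralIoi.unique hG hex.choose_spec h

/-! ### Finite-part integrals depending on a parameter -/

theorem differentiable_intervalIntegral {F : ℂ → ℝ → ℂ} {a b : ℝ} (hab : a ≤ b)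
    (hc : ContinuousOn (Function.uncurry F) (Set.univ ×ˢ Set.Icc a b))
    (hd : ∀ t ∈ Set.Icc a b, Differentiable ℂ fun s => F s t) :
    Differentiable ℂ fun s => ∫ t in a..b, F s t := by
  simp only [intervalIntegral.integral_of_le hab]
  rw [← differentiableOn_univ]
  refine differentiableOn_integral_param isOpen_univ (fun s _ => ?_) ?_ fun s _ => ?_
  · refine ContinuousOn.aestronglyMeasurable ?_ measurableSet_Ioc
    exact hc.comp (f := fun t : ℝ => (s, t)) (by fun_prop)
      fun t ht => ⟨trivial, Set.Ioc_subset_Icc_self ht⟩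
  · filter_upwards [ae_restrict_mem measurableSet_Ioc] with t ht
    exact (hd t (Set.Ioc_subset_Icc_self ht)).differentiableOn
  · obtain ⟨M, hM⟩ := ((isCompact_closedBall s 1).prod
      (isCompact_Icc (a := a) (b := b))).exists_bound_of_continuousOn
      (hc.mono (Set.prod_mono (Set.subset_univ _) subset_rfl))
    refine ⟨1, one_pos, fun _ => M, integrable_const _, ?_⟩
    filter_upwards [ae_restrict_mem measurableSet_Ioc] with t ht z hz _
    exact hM (z, t) ⟨Metric.ball_subset_closedBall hz, Set.Ioc_subset_Icc_self ht⟩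

theorem differentiable_integral_mul_cpow {g : ℝ → ℂ} {γ : ℝ → ℂ} {a b : ℝ} (hab : a ≤ b)
    (hg : ContinuousOn g (Set.Icc a b)) (hγ : ContinuousOn γ (Set.Icc a b))
    (hs : ∀ t ∈ Set.Icc a b, γ t ∈ slitPlane) :
    Differentiable ℂ fun s : ℂ => ∫ t in a..b, g t * γ t ^ (s - 1) := by
  refine differentiable_intervalIntegral hab ?_ fun t ht s => ?_
  · have h2 : Set.MapsTo (fun p : ℂ × ℝ => p.2) (Set.univ ×ˢ Set.Icc a b) (Set.Icc a b) :=
      fun p hp => hp.2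
    refine (hg.comp continuousOn_snd h2).mul ?_
    exact ContinuousOn.cpow (hγ.comp continuousOn_snd h2) (by fun_prop) fun p hp => hs _ hp.2
  · have : γ t ≠ 0 := slitPlane_ne_zero (hs t ht)
    have h1 : DifferentiableAt ℂ (fun s : ℂ => s - 1) s := by fun_prop
    exact (h1.const_cpow (Or.inl this)).const_mul _

/-- Half the sum of the integrals over the upper and lower semicircles from `c - ε` to `c + ε`. -/
def semicircleMean (K : ℂ → ℂ) (c ε : ℝ) : ℂ :=
  1 / 2 * (-(∫ θ in (0 : ℝ)..π, K (circleMap c ε θ) * (circleMap 0 ε θ * I)) +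
    ∫ θ in π..(2 * π), K (circleMap c ε θ) * (circleMap 0 ε θ * I))

/-- Along the upper and the lower semicircle the residue term κ/(z - c) contributes -iπκ and +iπκ,
which cancel in the mean. What is left is the increment of the single-valued part P, and that is the
Hadamard integral since |t - c| = ε at both ends. -/
theorem hasHadamardIntegral_semicircleMean {K : ℂ → ℂ} {c r ε : ℝ} (hε : 0 < ε) (hεr : ε < r)
    (hKc : MeromorphicAt K c)
    (hK : ∀ z ∈ Metric.ball (c : ℂ) r, z ≠ c → AnalyticAt ℂ K z) :
    HasHadamardIntegral (fun t : ℝ => K t) (c - ε) c (c + ε) (semicircleMean K c ε) := by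
  obtain ⟨κ, S, R, q, hSa, hRm, hRa, hRd, hK₁⟩ := exists_principalPart_primitive hKc
  set K₁ : ℂ → ℂ := Function.update (fun z => K z - S z) c (q c) with hK₁def
  have hd : DifferentiableOn ℂ K₁ (Metric.ball (c : ℂ) r) := by
    intro z hz
    rcases eq_or_ne z c with rfl | hne
    · exact hK₁.differentiableAt.differentiableWithinAt
    · have : AnalyticAt ℂ K₁ z := by
        refine ((hK z hz hne).sub (hSa z hne)).congr ?_
        filter_upwards [isOpen_ne.mem_nhds hne] with u hu
        rw [hK₁def, Function.update_of_ne hu]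
        rfl
      exact this.differentiableAt.differentiableWithinAt
  obtain ⟨P₁, hP₁⟩ := hd.isExactOn_ball
  have hP₁a : ∀ z ∈ Metric.ball (c : ℂ) r, AnalyticAt ℂ P₁ z := fun z hz =>
    DifferentiableOn.analyticAt (s := Metric.ball (c : ℂ) r) (fun z hz =>
      (hP₁ z hz).differentiableAt.differentiableWithinAt) (Metric.isOpen_ball.mem_nhds hz)
  set P : ℂ → ℂ := fun z => P₁ z + R z with hP
  have hPd : ∀ z ∈ Metric.ball (c : ℂ) r, z ≠ c → HasDerivAt P (K z - κ * (z - c)⁻¹) z := by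
    intro z hz hne
    refine ((hP₁ z hz).add (hRd z hne)).congr_deriv ?_
    rw [hK₁def, Function.update_of_ne hne]
    ring
  have hball : ∀ t ∈ Set.Icc (c - ε) (c + ε), (t : ℂ) ∈ Metric.ball (c : ℂ) r := by
    intro t ht
    rw [Metric.mem_ball, dist_eq_norm, ← ofReal_sub, norm_real, Real.norm_eq_abs]
    refine lt_of_le_of_lt (abs_le.2 ⟨?_, ?_⟩) hεr <;> linarith [ht.1, ht.2]
  have hcast : ∀ x : ℝ, x ≠ c → (x : ℂ) ≠ c := fun x hx h => hx (ofReal_injective h)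
  have key := hasHadamardIntegral_of_primitive (g := fun t : ℝ => K t)
    (Φ := fun t : ℝ => κ * Real.log (t - c) + P t) (P := fun t : ℝ => P t) (a := c - ε) (b := c + ε)
    (c := c) (κ := κ) (by linarith) (by linarith)
    (fun t ht htc => by
      refine (((hasDerivAt_ofReal_log_sub htc).const_mul κ).add
        (hPd t (hball t ht) (hcast t htc)).comp_ofReal).congr_deriv ?_
      ring)
    (fun t ht htc => (analyticAt_const.mul (analyticAt_ofReal_log_sub htc)).add
      (analyticAt_comp_ofReal ((hP₁a t (hball t ht)).add (hRa t (hcast t htc)))))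
    (meromorphicAt_comp_ofReal ((hP₁a c (Metric.mem_ball_self (hε.trans hεr))).meromorphicAt.add
      (hRm c)))
    (Eventually.of_forall fun t => rfl)
  have hcirc : ∀ θ : ℝ, circleMap (c : ℂ) ε θ ∈ Metric.ball (c : ℂ) r ∧ circleMap (c : ℂ) ε θ ≠ c := by
    intro θ
    refine ⟨?_, circleMap_ne_center hε.ne'⟩
    rw [Metric.mem_ball, dist_eq_norm, circleMap_sub_center, norm_circleMap_zero, abs_of_pos hε]
    exact hεr
  have hint : ∀ x y : ℝ, ∫ θ in x..y, K (circleMap c ε θ) * (circleMap 0 ε θ * I) =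
      (P (circleMap c ε y) + κ * I * y) - (P (circleMap c ε x) + κ * I * x) := by
    intro x y
    refine intervalIntegral.integral_eq_sub_of_hasDerivAt
      (f := fun θ : ℝ => P (circleMap c ε θ) + κ * I * θ) (fun θ _ => ?_) ?_
    · have h1 := HasDerivAt.comp θ (hPd _ (hcirc θ).1 (hcirc θ).2) (hasDerivAt_circleMap (c : ℂ) ε θ)
      have h2 : HasDerivAt (fun θ : ℝ => κ * I * (θ : ℂ)) (κ * I * 1) θ :=
        (hasDerivAt_id θ).ofReal_comp.const_mul _
      refine (h1.add h2).congr_deriv ?_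
      rw [circleMap_sub_center]
      have : circleMap 0 ε θ ≠ 0 := circleMap_ne_center hε.ne'
      field_simp
      ring
    · refine Continuous.intervalIntegrable ?_ _ _
      refine Continuous.mul ?_ (by fun_prop)
      rw [continuous_iff_continuousAt]
      intro θ
      exact ContinuousAt.comp (g := K) (hK _ (hcirc θ).1 (hcirc θ).2).continuousAt
        (continuous_circleMap _ _).continuousAt
  convert key using 1
  rw [semicircleMean, hint, hint]
  have e0 : circleMap (c : ℂ) ε 0 = ((c + ε : ℝ) : ℂ) := by simp [circleMap]
  have e1 : circleMap (c : ℂ) ε π = ((c - ε : ℝ) : ℂ) := by simp [circleMap]; ring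
  have e2 : circleMap (c : ℂ) ε (2 * π) = ((c + ε : ℝ) : ℂ) := by simp [circleMap]
  have l1 : Real.log (c + ε - c) = Real.log ε := by congr 1; ring
  have l2 : Real.log (c - ε - c) = Real.log ε := by
    rw [← Real.log_neg_eq_log]; congr 1; ring
  rw [e0, e1, e2, l1, l2]
  push_cast
  ring

theorem ofReal_mem_slitPlane' {t : ℝ} (ht : 0 < t) : (t : ℂ) ∈ slitPlane :=
  ofReal_mem_slitPlane.2 ht

theorem analyticAt_mul_cpow {G : ℂ → ℂ} {z : ℂ} (hG : AnalyticAt ℂ G z) (hz : z ∈ slitPlane)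
    (s : ℂ) : AnalyticAt ℂ (fun z => G z * z ^ (s - 1)) z :=
  hG.mul (analyticAt_id.cpow analyticAt_const hz)

/-- The finite-part Mellin integral over a compact interval with at most one pole is entire. -/
theorem exists_entire_hasFP {G : ℂ → ℂ} {A B c : ℝ} (hA : 0 < A) (hAc : A < c) (hcB : c < B)
    (hGc : MeromorphicAt G c) (hG : ∀ x ∈ Set.Icc A B, x ≠ c → AnalyticAt ℂ G (x : ℂ)) :
    ∃ v : ℂ → ℂ, Differentiable ℂ v ∧
      ∀ s : ℂ, HasFP (fun t : ℝ => G t * (t : ℂ) ^ (s - 1)) A B (v s) := by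
  obtain ⟨r₁, hr₁, hball⟩ := Metric.eventually_nhds_iff_ball.1
    (eventually_nhdsWithin_iff.1 hGc.eventually_analyticAt)
  set r := min r₁ (min (c - A) (B - c)) with hr
  have hr0 : 0 < r := lt_min hr₁ (lt_min (by linarith) (by linarith))
  have hrA : r ≤ c - A := (min_le_right _ _).trans (min_le_left _ _)
  have hrB : r ≤ B - c := (min_le_right _ _).trans (min_le_right _ _)
  set ε := r / 2
  have hε : 0 < ε := by positivity
  have hεr : ε < r := by simp only [ε]; linarith
  have hslit : ∀ z ∈ Metric.ball (c : ℂ) r, z ∈ slitPlane := by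
    intro z hz
    left
    rw [Metric.mem_ball, dist_eq_norm] at hz
    have h1 := (neg_abs_le _).trans' (neg_le_neg ((abs_re_le_norm (z - c)).trans hz.le))
    rw [sub_re, ofReal_re] at h1
    linarith
  have hGa : ∀ z ∈ Metric.ball (c : ℂ) r, z ≠ c → AnalyticAt ℂ G z := fun z hz hne =>
    hball z (Metric.ball_subset_ball (min_le_left _ _) hz) hne
  have hcirc : ∀ θ : ℝ, circleMap (c : ℂ) ε θ ∈ Metric.ball (c : ℂ) r ∧ circleMap (c : ℂ) ε θ ≠ c := by
    intro θ
    refine ⟨?_, circleMap_ne_center hε.ne'⟩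
    rw [Metric.mem_ball, dist_eq_norm, circleMap_sub_center, norm_circleMap_zero, abs_of_pos hε]
    exact hεr
  have hcontG : ∀ a b : ℝ, A ≤ a → b ≤ B → (c < a ∨ b < c) →
      ∀ x ∈ Set.Icc a b, AnalyticAt ℂ G x := by
    intro a b ha hb hab x hx
    refine hG x ⟨ha.trans hx.1, hx.2.trans hb⟩ ?_
    rcases hab with h | h
    · exact (h.trans_le hx.1).ne'
    · exact (hx.2.trans_lt h).ne
  have hseg : ∀ a b : ℝ, A ≤ a → b ≤ B → a ≤ b → (c < a ∨ b < c) →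
      Differentiable ℂ fun s : ℂ => ∫ t in a..b, G t * (t : ℂ) ^ (s - 1) := by
    intro a b ha hb hab hc
    refine differentiable_integral_mul_cpow hab (fun x hx => ?_) (by fun_prop) fun t ht =>
      ofReal_mem_slitPlane' (hA.trans_le (ha.trans ht.1))
    exact (analyticAt_comp_ofReal (hcontG a b ha hb hc x hx)).continuousAt.continuousWithinAt
  have hsemi : ∀ a b : ℝ, a ≤ b → Differentiable ℂ fun s : ℂ =>
      ∫ θ in a..b, (G (circleMap c ε θ) * circleMap c ε θ ^ (s - 1)) * (circleMap 0 ε θ * I) := by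
    intro a b hab
    have := differentiable_integral_mul_cpow (g := fun θ => G (circleMap c ε θ) *
      (circleMap 0 ε θ * I)) (γ := circleMap c ε) hab ?_ (continuous_circleMap _ _).continuousOn
      fun θ _ => hslit _ (hcirc θ).1
    · convert this using 4
      ring
    · refine ContinuousOn.mul (fun θ _ => ContinuousAt.continuousWithinAt ?_) (by fun_prop)
      exact ContinuousAt.comp (g := G) (hGa _ (hcirc θ).1 (hcirc θ).2).continuousAt
        (continuous_circleMap _ _).continuousAt
  -- Two segments and two semicircles: s enters only through integrands that are continuous on
  -- compact paths avoiding the pole, so the sum is entire.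
  refine ⟨fun s => (∫ t in A..(c - ε), G t * (t : ℂ) ^ (s - 1)) +
    semicircleMean (fun z => G z * z ^ (s - 1)) c ε + ∫ t in (c + ε)..B, G t * (t : ℂ) ^ (s - 1),
    ?_, fun s => ?_⟩
  · refine Differentiable.add (Differentiable.add ?_ ?_) ?_
    · exact hseg _ _ le_rfl (by linarith) (by linarith) (Or.inr (by linarith))
    · refine Differentiable.const_mul (Differentiable.add (Differentiable.neg ?_) ?_) _
      · exact hsemi _ _ Real.pi_pos.le
      · exact hsemi _ _ (by linarith [Real.pi_pos])
    · exact hseg _ _ (by linarith) le_rfl (by linarith) (Or.inl (by linarith))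
  · have hKa : ∀ x ∈ Set.Icc A B, x ≠ c → AnalyticAt ℂ (fun z => G z * z ^ (s - 1)) (x : ℂ) :=
      fun x hx hxc => analyticAt_mul_cpow (hG x hx hxc)
        (ofReal_mem_slitPlane' (hA.trans_le hx.1)) s
    have hKc : MeromorphicAt (fun z => G z * z ^ (s - 1)) (c : ℂ) :=
      hGc.mul (analyticAt_id.cpow analyticAt_const
        (ofReal_mem_slitPlane' (hA.trans hAc))).meromorphicAt
    obtain ⟨Φ, hΦ⟩ := exists_isFPPrim {c} (G := fun z => G z * z ^ (s - 1)) (A := A) (B := B)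
      (fun x hx => by
        rcases eq_or_ne x c with rfl | hne
        · exact hKc
        · exact (hKa x hx hne).meromorphicAt)
      (fun x hx hxc => hKa x hx (by simpa using hxc))
    have hint : ∀ a b : ℝ, A ≤ a → a ≤ b → b ≤ B → (c < a ∨ b < c) →
        ∫ t in a..b, G t * (t : ℂ) ^ (s - 1) = Φ b - Φ a := by
      intro a b ha hab hb hc
      refine HasFP.unique (hasFP_integral (G := fun z => G z * z ^ (s - 1)) hab fun x hx => ?_)
        (hΦ.hasFP ha hab hb ?_ ?_)
      · exact analyticAt_mul_cpow (hcontG a b ha hb hc x hx)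
          (ofReal_mem_slitPlane' (hA.trans_le (ha.trans hx.1))) s
      · rw [Finset.mem_singleton]
        rintro rfl
        rcases hc with h | h <;> linarith
      · rw [Finset.mem_singleton]
        rintro rfl
        rcases hc with h | h <;> linarith
    have hsc : semicircleMean (fun z => G z * z ^ (s - 1)) c ε = Φ (c + ε) - Φ (c - ε) := by
      refine (hasHadamardIntegral_semicircleMean hε hεr hKc fun z hz hne =>
        analyticAt_mul_cpow (hGa z hz hne) (hslit z hz) s).unique
        (hΦ.hasHadamardIntegral (by linarith) (by linarith) (by linarith) (by linarith) ?_)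
      intro d hd _ _
      simpa using hd
    beta_reduce
    rw [hint A (c - ε) le_rfl (by linarith) (by linarith) (Or.inr (by linarith)),
      hint (c + ε) B (by linarith) (by linarith) le_rfl (Or.inl (by linarith)), hsc]
    have := hΦ.hasFP le_rfl (hAc.trans hcB).le le_rfl (by simpa using hAc.ne)
      (by simpa using hcB.ne')
    convert this using 1
    ring

theorem exists_entire_hasFP_of_analyticAt {G : ℂ → ℂ} {A B : ℝ} (hA : 0 < A) (hAB : A ≤ B)
    (hG : ∀ x ∈ Set.Icc A B, AnalyticAt ℂ G (x : ℂ)) :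
    ∃ v : ℂ → ℂ, Differentiable ℂ v ∧
      ∀ s : ℂ, HasFP (fun t : ℝ => G t * (t : ℂ) ^ (s - 1)) A B (v s) := by
  refine ⟨fun s => ∫ t in A..B, G t * (t : ℂ) ^ (s - 1), ?_, fun s => ?_⟩
  · exact differentiable_integral_mul_cpow hAB (fun x hx =>
      (analyticAt_comp_ofReal (hG x hx)).continuousAt.continuousWithinAt) (by fun_prop)
      fun t ht => ofReal_mem_slitPlane' (hA.trans_le ht.1)
  · exact hasFP_integral (G := fun z => G z * z ^ (s - 1)) hAB fun x hx =>
      analyticAt_mul_cpow (hG x hx) (ofReal_mem_slitPlane' (hA.trans_le hx.1)) s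

end QMF

end

noncomputable section

namespace QMF

/-! ### Bounds for complex powers and Mellin tails -/

/-- Powers grow subexponentially, uniformly in bounded exponents. For |z| ≥ 1 use log x ≤ x with x =
δ|z|/M; for m ≤ |z| ≤ 1 use m^(-M); the argument contributes at most e^(πK). -/
theorem exists_norm_cpow_le {m K δ : ℝ} (hm : 0 < m) (hK : 0 ≤ K) (hδ : 0 < δ) :
    ∃ C, 0 ≤ C ∧ ∀ z w : ℂ, m ≤ ‖z‖ → ‖w‖ ≤ K → ‖z ^ w‖ ≤ C * Real.exp (δ * ‖z‖) := by
  set M : ℝ := K + 1 with hM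
  have hM0 : 0 < M := by positivity
  refine ⟨(Real.exp (M * Real.log (M / δ)) + m ^ (-M)) * Real.exp (π * K), by positivity, ?_⟩
  intro z w hz hw
  have hz0 : 0 < ‖z‖ := hm.trans_le hz
  have hwre : |w.re| ≤ M := (abs_re_le_norm w).trans (by linarith)
  have hexp : (1 : ℝ) ≤ Real.exp (δ * ‖z‖) := Real.one_le_exp (by positivity)
  have h1 : ‖z‖ ^ w.re ≤ (Real.exp (M * Real.log (M / δ)) + m ^ (-M)) * Real.exp (δ * ‖z‖) := by
    rcases le_total 1 ‖z‖ with h | h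
    · have h2 : ‖z‖ ^ w.re ≤ ‖z‖ ^ M :=
        Real.rpow_le_rpow_of_exponent_le h (le_trans (le_abs_self _) hwre)
      have h3 : ‖z‖ ^ M ≤ Real.exp (M * Real.log (M / δ)) * Real.exp (δ * ‖z‖) := by
        rw [Real.rpow_def_of_pos hz0, ← Real.exp_add]
        refine Real.exp_le_exp.2 ?_
        have h4 : Real.log ‖z‖ = Real.log (δ * ‖z‖ / M) + Real.log (M / δ) := by
          rw [← Real.log_mul (by positivity) (by positivity)]
          congr 1
          field_simp
        have h5 : Real.log (δ * ‖z‖ / M) ≤ δ * ‖z‖ / M :=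
          (Real.log_le_sub_one_of_pos (by positivity)).trans (by linarith)
        have h6 : M * (δ * ‖z‖ / M) = δ * ‖z‖ := by field_simp
        rw [h4]
        nlinarith
      have h7 : 0 ≤ m ^ (-M) * Real.exp (δ * ‖z‖) := by positivity
      linarith
    · have h2 : ‖z‖ ^ w.re ≤ ‖z‖ ^ (-M) :=
        Real.rpow_le_rpow_of_exponent_ge hz0 h (by linarith [neg_abs_le w.re])
      have h3 : ‖z‖ ^ (-M) ≤ m ^ (-M) := Real.rpow_le_rpow_of_nonpos hm hz (by linarith)
      have h4 : m ^ (-M) ≤ m ^ (-M) * Real.exp (δ * ‖z‖) :=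
        le_mul_of_one_le_right (by positivity) hexp
      have h7 : 0 ≤ Real.exp (M * Real.log (M / δ)) * Real.exp (δ * ‖z‖) := by positivity
      linarith
  have h8 : (Real.exp (z.arg * w.im))⁻¹ ≤ Real.exp (π * K) := by
    rw [← Real.exp_neg]
    refine Real.exp_le_exp.2 ?_
    have h9 : |z.arg * w.im| ≤ π * K := by
      rw [abs_mul]
      exact mul_le_mul (abs_arg_le_pi z) ((abs_im_le_norm w).trans hw) (abs_nonneg _)
        Real.pi_pos.le
    linarith [neg_abs_le (z.arg * w.im)]
  calc ‖z ^ w‖ ≤ ‖z‖ ^ w.re / Real.exp (z.arg * w.im) := norm_cpow_le z w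
    _ ≤ (Real.exp (M * Real.log (M / δ)) + m ^ (-M)) * Real.exp (δ * ‖z‖) * Real.exp (π * K) := by
        rw [div_eq_mul_inv]
        exact mul_le_mul h1 h8 (by positivity) (by positivity)
    _ = _ := by ring

theorem continuousOn_ofReal_cpow {T : ℝ} (hT : 0 ≤ T) (s : ℂ) :
    ContinuousOn (fun t : ℝ => (t : ℂ) ^ s) (Set.Ioi T) := fun t ht =>
  (ContinuousAt.cpow (by fun_prop) continuousAt_const
    (ofReal_mem_slitPlane.2 (hT.trans_lt ht))).continuousWithinAt

section MellinTail

variable {g : ℝ → ℂ} {T C δ : ℝ}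

theorem mellinTail_bound (hT : 0 < T) (hδ : 0 < δ) (hC : 0 ≤ C)
    (hb : ∀ t, T < t → ‖g t‖ ≤ C * Real.exp (-δ * t)) {K : ℝ} (hK : 0 ≤ K) :
    ∃ C', 0 ≤ C' ∧ ∀ w : ℂ, ‖w‖ ≤ K → ∀ t, T < t →
      ‖g t * (t : ℂ) ^ w‖ ≤ C' * Real.exp (-(δ / 2) * t) := by
  obtain ⟨D, hD, h⟩ := exists_norm_cpow_le hT hK (half_pos hδ)
  refine ⟨C * D, by positivity, fun w hw t ht => ?_⟩
  have ht0 : 0 < t := hT.trans ht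
  have hn : ‖(t : ℂ)‖ = t := by rw [norm_real, Real.norm_of_nonneg ht0.le]
  have h1 := h t w (by rw [hn]; exact ht.le) hw
  rw [hn] at h1
  rw [norm_mul]
  calc ‖g t‖ * ‖(t : ℂ) ^ w‖ ≤ (C * Real.exp (-δ * t)) * (D * Real.exp (δ / 2 * t)) :=
        mul_le_mul (hb t ht) h1 (norm_nonneg _) (by positivity)
    _ = C * D * (Real.exp (-δ * t) * Real.exp (δ / 2 * t)) := by ring
    _ = _ := by rw [← Real.exp_add]; ring_nf

theorem integrableOn_mellinTail (hT : 0 < T) (hδ : 0 < δ) (hC : 0 ≤ C)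
    (hg : AEStronglyMeasurable g (volume.restrict (Set.Ioi T)))
    (hb : ∀ t, T < t → ‖g t‖ ≤ C * Real.exp (-δ * t)) (w : ℂ) :
    IntegrableOn (fun t : ℝ => g t * (t : ℂ) ^ w) (Set.Ioi T) := by
  obtain ⟨C', -, h⟩ := mellinTail_bound hT hδ hC hb (norm_nonneg w)
  refine Integrable.mono' ((exp_neg_integrableOn_Ioi T (half_pos hδ)).const_mul C')
    (hg.mul ((continuousOn_ofReal_cpow hT.le w).aestronglyMeasurable measurableSet_Ioi)) ?_
  filter_upwards [ae_restrict_mem measurableSet_Ioi] with t ht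
  exact h w le_rfl t ht

theorem differentiable_mellinTail (hT : 0 < T) (hδ : 0 < δ) (hC : 0 ≤ C)
    (hg : AEStronglyMeasurable g (volume.restrict (Set.Ioi T)))
    (hb : ∀ t, T < t → ‖g t‖ ≤ C * Real.exp (-δ * t)) :
    Differentiable ℂ fun s : ℂ => ∫ t in Set.Ioi T, g t * (t : ℂ) ^ (s - 1) := by
  rw [← differentiableOn_univ]
  refine differentiableOn_integral_param isOpen_univ (fun s _ => hg.mul
    ((continuousOn_ofReal_cpow hT.le _).aestronglyMeasurable measurableSet_Ioi)) ?_ ?_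
  · filter_upwards [ae_restrict_mem measurableSet_Ioi] with t ht
    have ht0 : (t : ℂ) ≠ 0 := ofReal_ne_zero.2 (hT.trans ht).ne'
    intro s _
    refine DifferentiableAt.differentiableWithinAt ?_
    exact (((differentiableAt_id.sub_const 1).const_cpow (Or.inl ht0)).const_mul _)
  · intro s _
    obtain ⟨C', -, h⟩ := mellinTail_bound hT hδ hC hb (K := ‖s‖ + 2) (by positivity)
    refine ⟨1, one_pos, _, (exp_neg_integrableOn_Ioi T (half_pos hδ)).const_mul C', ?_⟩
    filter_upwards [ae_restrict_mem measurableSet_Ioi] with t ht z hz _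
    refine h _ ?_ t ht
    have h1 : ‖z - s‖ < 1 := by simpa [dist_eq_norm] using hz
    calc ‖z - 1‖ = ‖(z - s) + s - 1‖ := by congr 1; ring
      _ ≤ ‖z - s‖ + ‖s‖ + ‖(1 : ℂ)‖ :=
          (norm_sub_le _ _).trans (by linarith [norm_add_le (z - s) s])
      _ ≤ ‖s‖ + 2 := by rw [norm_one]; linarith

end MellinTail

/-! ### The incomplete gamma function -/

theorem norm_ray_lower {x u : ℝ} (hu : 0 ≤ u) : |x| / 2 ≤ ‖(x : ℂ) + (1 + I) * u‖ := by
  have h1 := abs_re_le_norm ((x : ℂ) + (1 + I) * u)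
  have h2 := abs_im_le_norm ((x : ℂ) + (1 + I) * u)
  simp only [add_re, ofReal_re, mul_re, one_re, I_re, add_zero, one_mul, add_im, one_im, I_im,
    ofReal_im, zero_add, mul_zero, sub_zero, mul_im] at h1 h2
  rw [abs_of_nonneg hu] at h2
  rcases abs_cases x with h | h <;> rcases abs_cases (x + u) with h' | h' <;> linarith

theorem norm_ray_upper {x u : ℝ} (hu : 0 ≤ u) : ‖(x : ℂ) + (1 + I) * u‖ ≤ |x| + 2 * u := by
  refine (norm_add_le _ _).trans ?_
  have h1 : ‖(1 + I : ℂ)‖ ≤ 2 := (norm_add_le _ _).trans (by norm_num)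
  rw [norm_mul, norm_real, norm_real, Real.norm_eq_abs, Real.norm_of_nonneg hu]
  nlinarith

/-- On the ray the exponential decays like e^(-u) and the modulus of the argument lies between |x|/2
and |x| + 2u. So the power, bounded with δ = 1/4, costs at most a multiple of e^(u/2), locally
uniformly in s. -/
theorem differentiable_upperGamma {x : ℝ} (hx : x ≠ 0) :
    Differentiable ℂ fun s => upperGamma s x := by
  have hx0 : 0 < |x| / 2 := by positivity
  have hz : ∀ u : ℝ, 0 < u → (x : ℂ) + (1 + I) * u ∈ slitPlane := fun u hu =>
    Or.inr (by simp [hu.ne'])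
  refine Differentiable.const_mul ?_ _
  rw [← differentiableOn_univ]
  refine differentiableOn_integral_param isOpen_univ (fun s _ => ?_) ?_ ?_
  · refine ContinuousOn.aestronglyMeasurable (fun u hu => ?_) measurableSet_Ioi
    refine ContinuousAt.continuousWithinAt ?_
    have h1 : Continuous fun u : ℝ => (x : ℂ) + (1 + I) * u := by fun_prop
    exact (h1.continuousAt.cpow continuousAt_const (hz u hu)).mul (by fun_prop)
  · filter_upwards [ae_restrict_mem measurableSet_Ioi] with u hu
    intro s _
    refine DifferentiableAt.differentiableWithinAt ?_
    exact (((differentiableAt_id.sub_const 1).const_cpow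
      (Or.inl (slitPlane_ne_zero (hz u hu)))).mul_const _)
  · intro s _
    obtain ⟨C, hC, h⟩ := exists_norm_cpow_le hx0 (K := ‖s‖ + 2) (by positivity)
      (δ := 1 / 4) (by norm_num)
    refine ⟨1, one_pos, _, (exp_neg_integrableOn_Ioi 0 (b := 1 / 2) (by norm_num)).const_mul
      (C * Real.exp (|x| / 4 - x)), ?_⟩
    filter_upwards [ae_restrict_mem measurableSet_Ioi] with u hu z hz' _
    have hu : 0 < u := hu
    have h1 : ‖z - s‖ < 1 := by simpa [dist_eq_norm] using hz'
    have h2 : ‖z - 1‖ ≤ ‖s‖ + 2 := by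
      calc ‖z - 1‖ = ‖(z - s) + s - 1‖ := by congr 1; ring
        _ ≤ ‖z - s‖ + ‖s‖ + ‖(1 : ℂ)‖ :=
            (norm_sub_le _ _).trans (by linarith [norm_add_le (z - s) s])
        _ ≤ ‖s‖ + 2 := by rw [norm_one]; linarith
    have h3 := h _ _ (norm_ray_lower (x := x) hu.le) h2
    have h4 : ‖exp (-((x : ℂ) + (1 + I) * u))‖ = Real.exp (-x - u) := by
      rw [norm_exp]; congr 1; simp; ring
    have h5 : Real.exp (1 / 4 * ‖(x : ℂ) + (1 + I) * u‖) ≤ Real.exp (|x| / 4 + u / 2) :=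
      Real.exp_le_exp.2 (by linarith [norm_ray_upper (x := x) hu.le])
    rw [norm_mul, h4]
    calc _ ≤ C * Real.exp (|x| / 4 + u / 2) * Real.exp (-x - u) := by
          refine mul_le_mul_of_nonneg_right (h3.trans ?_) (Real.exp_nonneg _)
          exact mul_le_mul_of_nonneg_left h5 hC
      _ = C * (Real.exp (|x| / 4 + u / 2) * Real.exp (-x - u)) := by ring
      _ = C * (Real.exp (|x| / 4 - x) * Real.exp (-(1 / 2) * u)) := by
          rw [← Real.exp_add, ← Real.exp_add]; ring_nf
      _ = _ := by ring

theorem differentiable_gammaTerm (a : ℤ → ℂ) {T : ℝ} (hT : T ≠ 0) (n : {n : ℤ // n ≠ 0}) :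
    Differentiable ℂ fun s => gammaTerm a s T n := by
  have hn : (2 * π * (n : ℤ) : ℝ) ≠ 0 :=
    mul_ne_zero (by positivity) (Int.cast_ne_zero.2 n.2)
  have hn' : ((2 * π * (n : ℤ) : ℝ) : ℂ) ≠ 0 := ofReal_ne_zero.2 hn
  intro s
  refine ((differentiable_upperGamma (mul_ne_zero hn hT) s).const_mul (a n)).div
    (differentiableAt_id.const_cpow (Or.inl hn')) ?_
  exact fun h => hn' ((cpow_eq_zero_iff _ _).1 h).1

/-! ### The Laplace transform of a power -/

/-- The Laplace integral `∫_T^∞ e^{-(1+i)μt} t^{s-1} dt`, along the ray `T + ℝ₊/μ`. -/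
def rayLaplace (s : ℂ) (T : ℝ) (μ : ℂ) : ℂ :=
  μ⁻¹ * ∫ u in Set.Ioi (0 : ℝ), exp (-((1 + I) * (μ * T + u))) * (T + u / μ) ^ (s - 1)

theorem add_div_mem_slitPlane {T u : ℝ} {μ : ℂ} (hT : 0 < T) (hu : 0 ≤ u) (hμ : μ ∈ slitPlane) :
    (T : ℂ) + u / μ ∈ slitPlane := by
  have h0 : 0 < normSq μ := normSq_pos.2 (slitPlane_ne_zero hμ)
  rcases hu.eq_or_lt with rfl | hu
  · simp [hT]
  rw [div_eq_mul_inv, mem_slitPlane_iff]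
  simp only [add_re, ofReal_re, mul_re, inv_re, ofReal_im, zero_mul, sub_zero, add_im, mul_im,
    inv_im, zero_add, add_zero]
  by_cases him : μ.im = 0
  · left
    have : 0 < μ.re := (mem_slitPlane_iff.1 hμ).resolve_right (not_not.2 him)
    positivity
  · right
    rw [neg_div, mul_neg, neg_ne_zero]
    exact mul_ne_zero hu.ne' (div_ne_zero him h0.ne')

/-- The exponential always decays like e^(-u), whatever the direction of μ; only the branch of the
power restricts μ. This is how the Laplace integral continues beyond its half-plane of convergence.
-/
theorem differentiableOn_rayLaplace (s : ℂ) {T : ℝ} (hT : 0 < T) :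
    DifferentiableOn ℂ (rayLaplace s T) slitPlane := by
  refine DifferentiableOn.mul (differentiableOn_inv.mono fun μ hμ => slitPlane_ne_zero hμ) ?_
  refine differentiableOn_integral_param isOpen_slitPlane (fun μ hμ => ?_) ?_ ?_
  · refine ContinuousOn.aestronglyMeasurable (fun u hu => ?_) measurableSet_Ioi
    refine ContinuousAt.continuousWithinAt ?_
    exact ContinuousAt.mul (by fun_prop) (ContinuousAt.cpow (by fun_prop) continuousAt_const
      (add_div_mem_slitPlane hT (le_of_lt hu) hμ))
  · filter_upwards [ae_restrict_mem measurableSet_Ioi] with u hu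
    intro μ hμ
    have hμ0 := slitPlane_ne_zero hμ
    refine DifferentiableAt.differentiableWithinAt ?_
    refine DifferentiableAt.mul (by fun_prop) (DifferentiableAt.cpow ?_
      (differentiableAt_const _) (add_div_mem_slitPlane hT (le_of_lt hu) hμ))
    exact (differentiableAt_const _).add
      ((differentiableAt_const _).div differentiableAt_id hμ0)
  · intro μ₀ hμ₀
    obtain ⟨R, hR, hball⟩ := Metric.isOpen_iff.1 isOpen_slitPlane μ₀ hμ₀
    set r := R / 2 with hr
    have hr0 : 0 < r := half_pos hR
    set M : ℝ := ‖μ₀‖ + r with hM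
    have hM0 : 0 < M := by positivity
    -- If |μ + v| < r, then -v would lie within 2r = R of μ₀, hence in the slit plane, which is
    -- absurd for v ≥ 0. With v = u/T this keeps T + u/μ away from 0.
    have hlow : ∀ μ ∈ Metric.ball μ₀ r, ∀ v : ℝ, 0 ≤ v → r ≤ ‖μ + v‖ := by
      intro μ hμ v hv
      by_contra hlt
      push Not at hlt
      have h1 : (-v : ℂ) ∈ Metric.ball μ₀ R := by
        rw [Metric.mem_ball] at hμ ⊢
        have h2 : dist (-v : ℂ) μ < r := by
          rw [dist_comm, dist_eq_norm]; simpa using hlt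
        calc dist (-v : ℂ) μ₀ ≤ dist (-v : ℂ) μ + dist μ μ₀ := dist_triangle _ _ _
          _ < R := by linarith
      have h2 := hball h1
      rw [mem_slitPlane_iff] at h2
      simp at h2
      linarith
    obtain ⟨C, hC, h⟩ := exists_norm_cpow_le (m := r * T / M) (by positivity)
      (norm_nonneg (s - 1)) (δ := r / 2) (by positivity)
    refine ⟨r, hr0, _, (exp_neg_integrableOn_Ioi 0 (b := 1 / 2) (by norm_num)).const_mul
      (Real.exp (2 * M * T) * (C * Real.exp (r / 2 * T))), ?_⟩
    filter_upwards [ae_restrict_mem measurableSet_Ioi] with u hu μ hμ _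
    have hu : 0 < u := hu
    have hμr : r ≤ ‖μ‖ := by simpa using hlow μ hμ 0 le_rfl
    have hμ0 : μ ≠ 0 := norm_pos_iff.1 (hr0.trans_le hμr)
    have hμM : ‖μ‖ ≤ M := by
      have h1 : ‖μ - μ₀‖ < r := by simpa [dist_eq_norm] using hμ
      have := norm_add_le (μ - μ₀) μ₀
      rw [sub_add_cancel] at this
      linarith
    have h1 : r * T / M ≤ ‖(T : ℂ) + u / μ‖ := by
      have h2 : (T : ℂ) + u / μ = T * (μ + (u / T : ℝ)) / μ := by
        have : (T : ℂ) ≠ 0 := ofReal_ne_zero.2 hT.ne'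
        push_cast
        field_simp
      rw [h2, norm_div, norm_mul, norm_real, Real.norm_of_nonneg hT.le, mul_comm r T]
      have h3 := hlow μ hμ (u / T) (by positivity)
      gcongr
    have h2 : ‖(T : ℂ) + u / μ‖ ≤ T + u / r := by
      refine (norm_add_le _ _).trans ?_
      rw [norm_div, norm_real, norm_real, Real.norm_of_nonneg hT.le, Real.norm_of_nonneg hu.le]
      gcongr
    have h3 := h _ _ h1 le_rfl
    have h4 : ‖exp (-((1 + I) * (μ * T + u)))‖ ≤ Real.exp (2 * M * T) * Real.exp (-u) := by
      rw [norm_exp, ← Real.exp_add]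
      refine Real.exp_le_exp.2 ?_
      have e1 := (abs_re_le_norm μ).trans hμM
      have e2 := (abs_im_le_norm μ).trans hμM
      rw [abs_le] at e1 e2
      simp
      nlinarith
    have h5 : Real.exp (r / 2 * ‖(T : ℂ) + u / μ‖) ≤ Real.exp (r / 2 * T) * Real.exp (u / 2) := by
      rw [← Real.exp_add]
      refine Real.exp_le_exp.2 ?_
      have h6 : r / 2 * (T + u / r) = r / 2 * T + u / 2 := by field_simp
      nlinarith
    rw [norm_mul]
    calc _ ≤ (Real.exp (2 * M * T) * Real.exp (-u)) *
          (C * (Real.exp (r / 2 * T) * Real.exp (u / 2))) := by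
          refine mul_le_mul h4 (h3.trans ?_) (norm_nonneg _) (by positivity)
          exact mul_le_mul_of_nonneg_left h5 hC
      _ = Real.exp (2 * M * T) * (C * Real.exp (r / 2 * T)) *
          (Real.exp (-u) * Real.exp (u / 2)) := by ring
      _ = _ := by rw [← Real.exp_add]; ring_nf

end QMF

end

/-! ### Rotating the ray: the regularized Mellin integral of an exponential -/

noncomputable section

namespace QMF

theorem setIntegral_Ioi_comp_add_div {f : ℝ → ℂ} (T : ℝ) {ν : ℝ} (hν : 0 < ν) :
    ∫ u in Set.Ioi (0 : ℝ), f (T + u / ν) = ν * ∫ t in Set.Ioi T, f t := by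
  have h1 := integral_comp_mul_left_Ioi (fun x => f (T + x)) 0 (inv_pos.2 hν)
  have h2 : ∫ x in Set.Ioi (0 : ℝ), f (T + x) = ∫ t in Set.Ioi T, f t := by
    have := (measurePreserving_add_left (volume : Measure ℝ) T).setIntegral_preimage_emb
      (measurableEmbedding_addLeft T) f (Set.Ioi T)
    simpa using this
  rw [mul_zero, h2, inv_inv, real_smul] at h1
  rw [← h1]
  simp only [div_eq_inv_mul]

/-- The condition Im μ < Re μ says that (1 + i)μ has positive real part. -/
theorem differentiableOn_laplace_cpow (s : ℂ) {T : ℝ} (hT : 0 < T) :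
    DifferentiableOn ℂ (fun μ : ℂ => ∫ t in Set.Ioi T, exp (-((1 + I) * μ * t)) *
      (t : ℂ) ^ (s - 1)) {μ | μ.im < μ.re} := by
  have hU : IsOpen {μ : ℂ | μ.im < μ.re} := isOpen_lt continuous_im continuous_re
  refine differentiableOn_integral_param hU (fun μ _ => ?_) ?_ ?_
  · exact AEStronglyMeasurable.mul (Continuous.aestronglyMeasurable (by fun_prop))
      ((continuousOn_ofReal_cpow hT.le _).aestronglyMeasurable measurableSet_Ioi)
  · exact Eventually.of_forall fun t μ _ => by fun_prop
  · intro μ₀ hμ₀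
    have hμ₀ : μ₀.im < μ₀.re := hμ₀
    set δ := (μ₀.re - μ₀.im) / 4 with hδ
    have hδ0 : 0 < δ := by rw [hδ]; linarith
    have hint : IntegrableOn (fun t : ℝ => ((Real.exp (-δ * t) : ℝ) : ℂ) * (t : ℂ) ^ (s - 1))
        (Set.Ioi T) := by
      refine integrableOn_mellinTail hT hδ0 zero_le_one
        (Continuous.aestronglyMeasurable (by fun_prop)) (fun t _ => ?_) _
      rw [norm_real, Real.norm_of_nonneg (Real.exp_nonneg _), one_mul]
    refine ⟨δ, hδ0, _, hint.norm, ?_⟩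
    filter_upwards [ae_restrict_mem measurableSet_Ioi] with t ht μ hμ _
    have ht0 : 0 < t := hT.trans ht
    rw [norm_mul, norm_mul, norm_real, Real.norm_of_nonneg (Real.exp_nonneg _), norm_exp]
    refine mul_le_mul_of_nonneg_right (Real.exp_le_exp.2 ?_) (norm_nonneg _)
    have h1 : ‖μ - μ₀‖ < δ := by simpa [dist_eq_norm] using hμ
    have h2 := (abs_re_le_norm (μ - μ₀)).trans h1.le
    have h3 := (abs_im_le_norm (μ - μ₀)).trans h1.le
    rw [abs_le, sub_re] at h2
    rw [abs_le, sub_im] at h3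
    have h4 : (-((1 + I) * μ * t)).re = -((μ.re - μ.im) * t) := by simp
    rw [h4]
    nlinarith

/-- For real μ > 0 the two sides differ by the substitution t = T + u/μ. Both are holomorphic on the
convex set Im μ < Re μ, so the identity theorem replaces a contour rotation. -/
theorem rayLaplace_eq (s : ℂ) {T : ℝ} (hT : 0 < T) {μ : ℂ} (hμ : μ.im < μ.re) :
    rayLaplace s T μ = ∫ t in Set.Ioi T, exp (-((1 + I) * μ * t)) * (t : ℂ) ^ (s - 1) := by
  have hU : IsOpen {μ : ℂ | μ.im < μ.re} := isOpen_lt continuous_im continuous_re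
  have hsub : {μ : ℂ | μ.im < μ.re} ⊆ slitPlane := by
    intro z hz
    have hz : z.im < z.re := hz
    rw [mem_slitPlane_iff]
    by_contra hcon
    push Not at hcon
    linarith [hcon.1, hcon.2]
  have hconv : Convex ℝ {μ : ℂ | μ.im < μ.re} := by
    intro x hx y hy a b ha hb hab
    simp only [Set.mem_ofPred_eq] at hx hy ⊢
    simp only [real_smul, add_im, mul_im, ofReal_re, ofReal_im, zero_mul, add_zero, add_re,
      mul_re, sub_zero]
    rcases ha.eq_or_lt with rfl | ha
    · simp only [zero_add] at hab; subst hab; linarith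
    · nlinarith
  have hA := ((differentiableOn_rayLaplace s hT).mono hsub).analyticOnNhd hU
  have hB := (differentiableOn_laplace_cpow s hT).analyticOnNhd hU
  refine hA.eqOn_of_preconnected_of_frequently_eq hB hconv.isPreconnected (z₀ := 1) (by simp)
    ?_ hμ
  have h1 : ∀ x : ℝ, 0 < x → rayLaplace s T x =
      ∫ t in Set.Ioi T, exp (-((1 + I) * x * t)) * (t : ℂ) ^ (s - 1) := by
    intro x hx
    have hx' : (x : ℂ) ≠ 0 := ofReal_ne_zero.2 hx.ne'
    have h2 := setIntegral_Ioi_comp_add_div T hx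
      (f := fun t : ℝ => exp (-((1 + I) * x * t)) * (t : ℂ) ^ (s - 1))
    rw [rayLaplace, inv_mul_eq_iff_eq_mul₀ hx', ← h2]
    congr 1
    ext u
    push_cast
    congr 2
    field_simp
  have h2 : Tendsto (fun x : ℝ => (x : ℂ)) (𝓝[≠] 1) (𝓝[≠] (1 : ℂ)) := by
    simpa using tendsto_ofReal_nhdsNE 1
  refine h2.frequently (Eventually.frequently ?_)
  filter_upwards [nhdsWithin_le_nhds (lt_mem_nhds one_pos)] with x hx
  exact h1 x hx

/-- For ν < 0 the principal argument of ν is π, so the logarithms add without a jump because arg z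
is negative. -/
theorem mul_cpow_of_im_neg {ν : ℝ} (hν : ν ≠ 0) {z : ℂ} (hz : z ≠ 0) (h : ν < 0 → z.im < 0)
    (w : ℂ) : ((ν : ℂ) * z) ^ w = (ν : ℂ) ^ w * z ^ w := by
  have hν' : (ν : ℂ) ≠ 0 := ofReal_ne_zero.2 hν
  have h1 : log ((ν : ℂ) * z) = log ν + log z := by
    rw [log_mul_eq_add_log_iff hν' hz]
    rcases hν.lt_or_gt with h0 | h0
    · rw [arg_ofReal_of_neg h0]
      have := arg_neg_iff.2 (h h0)
      have := neg_pi_lt_arg z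
      constructor <;> linarith [Real.pi_pos]
    · rw [arg_ofReal_of_nonneg h0.le, zero_add]
      exact ⟨neg_pi_lt_arg z, arg_le_pi z⟩
  rw [cpow_def_of_ne_zero (mul_ne_zero hν' hz), cpow_def_of_ne_zero hν', cpow_def_of_ne_zero hz,
    h1, ← exp_add]
  ring_nf

theorem div_one_add_I_re_im (z : ℂ) : (z / (1 + I)).re = (z.re + z.im) / 2 ∧
    (z / (1 + I)).im = (z.im - z.re) / 2 := by
  have h : z / (1 + I) = z * (1 - I) / 2 := by
    have h1 : (1 + I) * (1 - I) = 2 := by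
      have := I_mul_I; linear_combination -this
    have h2 : (1 + I : ℂ) ≠ 0 := fun h0 => by rw [h0] at h1; simp at h1
    rw [div_eq_div_iff h2 two_ne_zero]
    linear_combination -z * h1
  rw [h]
  constructor <;> simp <;> ring

/-- The point νT + (1 + i)u of the gamma contour equals ν(T + (1 + i)u/ν). For ν < 0 the second
factor has negative imaginary part, so its power separates from ν^(s-1) taken with argument π. This
matches the branches of Γ(s, νT) and of ν^s. -/
theorem rayLaplace_ofReal (s : ℂ) {T ν : ℝ} (hT : 0 < T) (hν : ν ≠ 0) :
    rayLaplace s T (ν / (1 + I)) = upperGamma s (ν * T) / (ν : ℂ) ^ s := by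
  have hν' : (ν : ℂ) ≠ 0 := ofReal_ne_zero.2 hν
  have hI : (1 + I : ℂ) ≠ 0 := fun h => by simpa using congrArg re h
  have hνs : (ν : ℂ) ^ s ≠ 0 := fun h => hν' ((cpow_eq_zero_iff _ _).1 h).1
  have hcp : (ν : ℂ) ^ s = (ν : ℂ) ^ (s - 1) * ν := by
    conv_lhs => rw [show s = (s - 1) + 1 by ring, cpow_add _ _ hν', cpow_one]
  have hνs1 : (ν : ℂ) ^ (s - 1) ≠ 0 := fun h => hν' ((cpow_eq_zero_iff _ _).1 h).1
  have hslit : (ν : ℂ) / (1 + I) ∈ slitPlane := by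
    rw [mem_slitPlane_iff, (div_one_add_I_re_im _).2]
    right; simpa using hν
  have h1 : ∀ u ∈ Set.Ioi (0 : ℝ),
      ((ν * T : ℝ) + (1 + I) * u : ℂ) ^ (s - 1) * exp (-((ν * T : ℝ) + (1 + I) * u)) =
      (ν : ℂ) ^ (s - 1) * (exp (-((1 + I) * (ν / (1 + I) * T + u))) *
        (T + u / (ν / (1 + I))) ^ (s - 1)) := by
    intro u hu
    have hu : 0 < u := hu
    have e1 : ((ν * T : ℝ) + (1 + I) * u : ℂ) = ν * (T + u / (ν / (1 + I))) := by
      push_cast; field_simp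
    have e2 : (1 + I) * (ν / (1 + I) * T + u) = ((ν * T : ℝ) + (1 + I) * u : ℂ) := by
      push_cast; field_simp
    have hz := add_div_mem_slitPlane hT hu.le hslit
    rw [e2, e1, mul_cpow_of_im_neg hν (slitPlane_ne_zero hz)]
    · ring
    · intro h0
      have e3 : (T : ℂ) + u / (ν / (1 + I)) = ((T + u / ν : ℝ) : ℂ) + ((u / ν : ℝ) : ℂ) * I := by
        push_cast; field_simp; ring
      rw [e3]
      simpa using div_neg_of_pos_of_neg hu h0
  rw [rayLaplace, upperGamma, setIntegral_congr_fun measurableSet_Ioi h1,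
    integral_const_mul, hcp]
  field_simp

/-- The regularized Mellin integral of an exponential, decreasing or increasing. -/
theorem hasRegIntegralAtInfinity_exp_mul_cpow (s : ℂ) {T ν : ℝ} (hT : 0 < T) (hν : ν ≠ 0) :
    HasRegIntegralAtInfinity (fun t : ℝ => exp (-(ν * t : ℂ)) * (t : ℂ) ^ (s - 1)) T
      (upperGamma s (ν * T) / (ν : ℂ) ^ s) := by
  have hI : (1 + I : ℂ) ≠ 0 := fun h => by simpa using congrArg re h
  -- Division by 1 + i leaves the slit plane only if Re = Im ≤ 0 for w + ν. That is excluded when Re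
  -- or Im is positive, and at w = 0 because ν is real and nonzero. So the continuation is analytic
  -- even at w = 0, whence the limit.
  have hslit : ∀ w : ℂ, (0 < (w + ν).re ∨ 0 < (w + ν).im ∨ w = 0) →
      (w + ν) / (1 + I) ∈ slitPlane := by
    intro w hw
    rw [mem_slitPlane_iff, (div_one_add_I_re_im _).1, (div_one_add_I_re_im _).2]
    by_cases h : (w + ν).im = (w + ν).re
    · left
      rcases hw with hw | hw | rfl
      · linarith
      · linarith
      · exact absurd (by simpa using h.symm) hν
    · right
      intro h0
      exact h (by linarith)
  have hd : DifferentiableOn ℂ (fun w : ℂ => rayLaplace s T ((w + ν) / (1 + I)))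
      {w | (w + ν) / (1 + I) ∈ slitPlane} :=
    (differentiableOn_rayLaplace s hT).comp (by fun_prop) fun w hw => hw
  have hopen : IsOpen {w : ℂ | (w + ν) / (1 + I) ∈ slitPlane} :=
    isOpen_slitPlane.preimage (by fun_prop)
  refine ⟨|ν| + 1, fun w => rayLaplace s T ((w + ν) / (1 + I)), by positivity, ?_, ?_, ?_⟩
  · intro w hw
    have hre : 0 < (w + ν).re := by
      rw [add_re, ofReal_re]; linarith [neg_abs_le ν]
    have he : ∀ t : ℝ, exp (-w * t) * (exp (-(ν * t : ℂ)) * (t : ℂ) ^ (s - 1)) =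
        exp (-((w + ν) * t)) * (t : ℂ) ^ (s - 1) := by
      intro t; rw [← mul_assoc, ← exp_add]; ring_nf
    simp only [he]
    refine ⟨?_, ?_⟩
    · refine integrableOn_mellinTail hT hre zero_le_one
        (Continuous.aestronglyMeasurable (by fun_prop)) (fun t _ => ?_) _
      rw [norm_exp, one_mul]
      simp only [neg_re, mul_re, ofReal_re, ofReal_im, mul_zero, sub_zero, neg_mul, le_refl]
    · rw [rayLaplace_eq s hT]
      · simp only [mul_div_cancel₀ _ hI]
      · rw [(div_one_add_I_re_im _).1, (div_one_add_I_re_im _).2]; linarith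
  · refine (hd.mono fun w hw => hslit w ?_).analyticOnNhd (isOpen_laplaceDomain _)
    rcases hw with hw | hw
    · left
      rw [add_re, ofReal_re]; linarith [neg_abs_le ν]
    · right; left
      simpa using hw.2
  · have h0 : (0 : ℂ) ∈ {w : ℂ | (w + ν) / (1 + I) ∈ slitPlane} := hslit 0 (Or.inr (Or.inr rfl))
    have hc := (hd.differentiableAt (hopen.mem_nhds h0)).continuousAt
    have ht := hc.tendsto
    rw [zero_add, rayLaplace_ofReal s hT hν] at ht
    exact ht.mono_left nhdsWithin_le_nhds

end QMF

end

noncomputable section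

namespace QMF

/-! ### Removable singularities -/

theorem eventually_nhdsNE_eventually_nhds {X : Type*} [TopologicalSpace X] [T1Space X] {x : X}
    {P : X → Prop} (h : ∀ᶠ y in 𝓝[≠] x, P y) : ∀ᶠ y in 𝓝[≠] x, ∀ᶠ z in 𝓝 y, P z := by
  obtain ⟨U, hU, hxU, hsub⟩ := mem_nhdsWithin.1 h
  filter_upwards [mem_nhdsWithin_of_mem_nhds (hU.mem_nhds hxU), self_mem_nhdsWithin] with y hy hyx
  filter_upwards [hU.mem_nhds hy, isOpen_compl_singleton.mem_nhds hyx] with z hz hzx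
  exact hsub ⟨hz, hzx⟩

/-- `h` has at most a removable singularity at `x`. -/
def IsRemovableAt (h : ℂ → ℂ) (x : ℂ) : Prop := ∃ a, AnalyticAt ℂ a x ∧ h =ᶠ[𝓝[≠] x] a

namespace IsRemovableAt

variable {h h₁ h₂ : ℂ → ℂ} {x : ℂ}

theorem of_analyticAt (ha : AnalyticAt ℂ h x) : IsRemovableAt h x := ⟨h, ha, EventuallyEq.rfl⟩

theorem congr (h1 : IsRemovableAt h₁ x) (he : h₁ =ᶠ[𝓝[≠] x] h₂) : IsRemovableAt h₂ x := by
  obtain ⟨a, ha, hae⟩ := h1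
  exact ⟨a, ha, he.symm.trans hae⟩

theorem sub (h1 : IsRemovableAt h₁ x) (h2 : IsRemovableAt h₂ x) :
    IsRemovableAt (fun z => h₁ z - h₂ z) x := by
  obtain ⟨a, ha, hae⟩ := h1
  obtain ⟨b, hb, hbe⟩ := h2
  exact ⟨_, ha.sub hb, hae.sub hbe⟩

theorem meromorphicAt (h1 : IsRemovableAt h x) : MeromorphicAt h x := by
  obtain ⟨a, ha, hae⟩ := h1
  exact ha.meromorphicAt.congr hae.symm

theorem meromorphicOrderAt_nonneg (h1 : IsRemovableAt h x) : 0 ≤ meromorphicOrderAt h x := by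
  obtain ⟨a, ha, hae⟩ := h1
  rw [meromorphicOrderAt_congr hae]
  exact ha.meromorphicOrderAt_nonneg

theorem of_order_nonneg (hm : MeromorphicAt h x) (ho : 0 ≤ meromorphicOrderAt h x) :
    IsRemovableAt h x := by
  have he := hm.eq_nhdsNE_toMeromorphicNFAt
  refine ⟨toMeromorphicNFAt h x, ?_, he⟩
  rw [meromorphicOrderAt_congr he] at ho
  exact meromorphicNFAt_toMeromorphicNFAt.meromorphicOrderAt_nonneg_iff_analyticAt.1 ho

theorem comp_add_const {c : ℂ} (h1 : IsRemovableAt h (x + c)) :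
    IsRemovableAt (fun z => h (z + c)) x := by
  obtain ⟨a, ha, hae⟩ := h1
  refine ⟨fun z => a (z + c), ha.fun_comp (f := fun z => z + c) (by fun_prop), ?_⟩
  have ht : Tendsto (fun z : ℂ => z + c) (𝓝[≠] x) (𝓝[≠] (x + c)) := by
    refine tendsto_nhdsWithin_of_tendsto_nhds_of_eventually_within _ ?_ ?_
    · exact (Continuous.tendsto (by fun_prop) x).mono_left nhdsWithin_le_nhds
    · filter_upwards [self_mem_nhdsWithin] with z hz
      simpa using hz
  exact ht.eventually hae

end IsRemovableAt

theorem poleOrder_pos_iff {f : ℂ → ℂ} {x : ℂ} :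
    0 < poleOrder f x ↔ meromorphicOrderAt f x < 0 := by
  rw [poleOrder]
  rcases eq_or_ne (meromorphicOrderAt f x) ⊤ with h | h
  · simp [h]
  · obtain ⟨n, hn⟩ := WithTop.ne_top_iff_exists.1 h
    rw [← hn]
    simp

theorem poleOrder_eq_zero_iff {f : ℂ → ℂ} {x : ℂ} :
    poleOrder f x = 0 ↔ 0 ≤ meromorphicOrderAt f x := by
  rw [← not_lt, ← poleOrder_pos_iff]; omega

theorem poleOrder_congr {f g : ℂ → ℂ} {x : ℂ} (h : f =ᶠ[𝓝[≠] x] g) :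
    poleOrder f x = poleOrder g x := by
  rw [poleOrder, poleOrder, meromorphicOrderAt_congr h]

theorem _root_.MeromorphicAt.isRemovableAt_mul_pow_poleOrder {f : ℂ → ℂ} {x : ℂ}
    (hf : MeromorphicAt f x) : IsRemovableAt (fun z => (z - x) ^ poleOrder f x * f z) x := by
  have h1 : MeromorphicAt (fun z : ℂ => z - x) x := by fun_prop
  have h2 := h1.pow (poleOrder f x)
  refine IsRemovableAt.of_order_nonneg (h2.mul hf) ?_
  change 0 ≤ meromorphicOrderAt ((fun z : ℂ => z - x) ^ poleOrder f x * f) x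
  rw [meromorphicOrderAt_mul h2 hf, meromorphicOrderAt_pow h1, meromorphicOrderAt_id_sub_const,
    mul_one]
  rcases eq_or_ne (meromorphicOrderAt f x) ⊤ with h | h
  · simp [h]
  · obtain ⟨n, hn⟩ := WithTop.ne_top_iff_exists.1 h
    rw [poleOrder, ← hn]
    norm_cast
    simp only [WithTop.untop₀_coe]
    omega

/-- The principal part of `f` at `α` has the coefficients `polarCoeff f α`. -/
theorem isRemovableAt_sub_principalPart {f : ℂ → ℂ} {α : ℂ} (hf : MeromorphicAt f α) :
    IsRemovableAt (fun z => f z - ∑ m ∈ Finset.Icc 1 (poleOrder f α),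
      polarCoeff f α m * (z - α) ^ (-(m : ℤ))) α := by
  set N := poleOrder f α with hN
  have hrem := hf.isRemovableAt_mul_pow_poleOrder
  rw [← hN] at hrem
  have he := hrem.meromorphicAt.eq_nhdsNE_toMeromorphicNFAt
  set φ := toMeromorphicNFAt (fun z => (z - α) ^ N * f z) α with hφ
  have hφa : AnalyticAt ℂ φ α :=
    meromorphicNFAt_toMeromorphicNFAt.meromorphicOrderAt_nonneg_iff_analyticAt.1
      (by rw [← meromorphicOrderAt_congr he]; exact hrem.meromorphicOrderAt_nonneg)
  have hψ : AnalyticAt ℂ (fun z => φ (z + α)) 0 :=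
    AnalyticAt.fun_comp (g := φ) (f := fun z => z + α) (by simpa using hφa) (by fun_prop)
  obtain ⟨F, hF, hsum⟩ := hψ.exists_eq_sum_add_pow_mul N
  refine ⟨fun z => F (z - α), AnalyticAt.fun_comp (g := F) (f := fun z => z - α)
    (by simpa using hF) (by fun_prop), ?_⟩
  filter_upwards [he, self_mem_nhdsWithin] with z hz hzα
  have hz0 : z - α ≠ 0 := sub_ne_zero.2 hzα
  have h1 := hsum (z - α)
  rw [sub_add_cancel, ← hz] at h1
  have h2 : ∑ m ∈ Finset.Icc 1 N, polarCoeff f α m * (z - α) ^ (-(m : ℤ)) =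
      ((z - α) ^ N)⁻¹ * ∑ i ∈ Finset.range N,
        ((z - α) ^ i / i.factorial) • iteratedDeriv i (fun z => φ (z + α)) 0 := by
    rw [Finset.mul_sum]
    refine Finset.sum_bij' (fun m _ => N - m) (fun i _ => N - i) ?_ ?_ ?_ ?_ ?_
    · intro m hm; rw [Finset.mem_Icc] at hm; rw [Finset.mem_range]; omega
    · intro i hi; rw [Finset.mem_range] at hi; rw [Finset.mem_Icc]; omega
    · intro m hm; rw [Finset.mem_Icc] at hm; omega
    · intro i hi; rw [Finset.mem_range] at hi; omega
    · intro m hm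
      rw [Finset.mem_Icc] at hm
      have h3 : iteratedDeriv (N - m) (fun z => φ (z + α)) 0 = iteratedDeriv (N - m) φ α := by
        rw [iteratedDeriv_comp_add_const]; simp
      have h4 : (z - α) ^ N = (z - α) ^ (N - m) * (z - α) ^ m := by
        rw [← pow_add]; congr 1; omega
      rw [polarCoeff, ← hN, ← hφ, h3, h4, zpow_neg, zpow_natCast, smul_eq_mul]
      have h5 : ((N - m).factorial : ℂ) ≠ 0 := Nat.cast_ne_zero.2 (Nat.factorial_ne_zero _)
      field_simp
  rw [h2]
  have hzN : (z - α) ^ N ≠ 0 := pow_ne_zero _ hz0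
  have h3 : f z = ((z - α) ^ N)⁻¹ * ((z - α) ^ N * f z) := by field_simp
  rw [h3, h1, smul_eq_mul, mul_add, add_sub_cancel_left, inv_mul_cancel_left₀ hzN]

/-! ### Polylogarithms -/

theorem e_add_intCast (z : ℂ) (n : ℤ) : e (z + n) = e z := by
  rw [e, e, exp_eq_exp_iff_exists_int]
  exact ⟨n, by ring⟩

theorem e_eq_one_iff {z : ℂ} : e z = 1 ↔ ∃ n : ℤ, z = n := by
  rw [e, exp_eq_one_iff]
  have h : (2 * π * I : ℂ) ≠ 0 := by simp [Real.pi_ne_zero]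
  refine exists_congr fun n => ?_
  rw [mul_comm (n : ℂ), mul_right_inj' h]

theorem e_zero : e 0 = 1 := by simp [e]

theorem e_add (z w : ℂ) : e (z + w) = e z * e w := by rw [e, e, e, ← exp_add]; ring_nf

theorem e_ne_zero (z : ℂ) : e z ≠ 0 := exp_ne_zero _

theorem norm_e (z : ℂ) : ‖e z‖ = Real.exp (-(2 * π * z.im)) := by
  rw [e, norm_exp]; simp

theorem hasDerivAt_e (z : ℂ) : HasDerivAt e (2 * π * I * e z) z := by
  have := ((hasDerivAt_id z).const_mul (2 * π * I : ℂ)).cexp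
  refine HasDerivAt.congr_deriv (f := e) this ?_
  rw [mul_one, e, mul_comm]; rfl

theorem differentiable_e : Differentiable ℂ e := fun z => (hasDerivAt_e z).differentiableAt

theorem analyticAt_e (z : ℂ) : AnalyticAt ℂ e z := differentiable_e.analyticAt z

theorem polylogNeg_succ (m : ℕ) : polylogNeg (m + 1) = fun z => z * deriv (polylogNeg m) z := by
  rw [polylogNeg, Function.iterate_succ_apply']; rfl

theorem analyticAt_polylogNeg (m : ℕ) {z : ℂ} (hz : z ≠ 1) : AnalyticAt ℂ (polylogNeg m) z := by
  induction m with
  | zero =>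
    change AnalyticAt ℂ (fun z : ℂ => z / (1 - z)) z
    exact analyticAt_id.div (by fun_prop) (sub_ne_zero.2 hz.symm)
  | succ m ih =>
    rw [polylogNeg_succ]
    exact analyticAt_id.mul ih.deriv

theorem polylogNeg_zero_right (m : ℕ) : polylogNeg m 0 = 0 := by
  cases m with
  | zero => simp [polylogNeg]
  | succ m => simp [polylogNeg_succ]

theorem exists_norm_polylogNeg_le (m : ℕ) :
    ∃ C r : ℝ, 0 ≤ C ∧ 0 < r ∧ r < 1 ∧ ∀ z : ℂ, ‖z‖ < r → ‖polylogNeg m z‖ ≤ C * ‖z‖ := by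
  have h := (analyticAt_polylogNeg m zero_ne_one).differentiableAt.isBigO_sub
  simp only [polylogNeg_zero_right, sub_zero] at h
  obtain ⟨C, hC, hb⟩ := h.exists_nonneg
  obtain ⟨r, hr, hball⟩ := Metric.eventually_nhds_iff_ball.1 hb.bound
  refine ⟨C, min r (1 / 2), hC, by positivity, by linarith [min_le_right r (1 / 2)], ?_⟩
  intro z hz
  exact hball z (by simpa using hz.trans_le (min_le_left _ _))

theorem analyticAt_polylogNeg_e (m : ℕ) {w : ℂ} (hw : e w ≠ 1) :
    AnalyticAt ℂ (fun w => polylogNeg m (e w)) w :=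
  (analyticAt_polylogNeg m hw).comp (analyticAt_e w)

theorem polylogNeg_succ_e (m : ℕ) {w : ℂ} (hw : e w ≠ 1) :
    polylogNeg (m + 1) (e w) = (2 * π * I)⁻¹ * deriv (fun w => polylogNeg m (e w)) w := by
  have h := (analyticAt_polylogNeg m hw).differentiableAt.hasDerivAt.comp w (hasDerivAt_e w)
  have h2 : deriv (fun w => polylogNeg m (e w)) w = _ := h.deriv
  have h0 : (2 * π * I : ℂ) ≠ 0 := by simp [Real.pi_ne_zero]
  rw [h2, polylogNeg_succ]
  field_simp

theorem eventually_e_ne_one (x : ℂ) : ∀ᶠ w in 𝓝[≠] x, e w ≠ 1 := by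
  by_contra h
  have h1 := (differentiable_e.differentiableOn (s := Set.univ)).analyticOnNhd isOpen_univ
  have h2 : AnalyticOnNhd ℂ (fun _ : ℂ => (1 : ℂ)) Set.univ := fun _ _ => analyticAt_const
  have h3 := h1.eqOn_of_preconnected_of_frequently_eq h2 isPreconnected_univ (Set.mem_univ x)
    h (Set.mem_univ (1 / 2 : ℂ))
  obtain ⟨n, hn⟩ := e_eq_one_iff.1 h3
  have h4 : (1 : ℂ) = ((2 * n : ℤ) : ℂ) := by push_cast; rw [← hn]; norm_num
  have h5 : (1 : ℤ) = 2 * n := by exact_mod_cast h4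
  omega

/-- For m = 0 write 1 - e(w) = wE(w) with E(0) = -2πi, and q/(1 - q) = 1/(1 - q) - 1. Raising m
differentiates in w and divides by 2πi. There is a single polar term, and its coefficient explains
the factors (-2πi)^m/(m-1)! in the pole terms. -/
theorem exists_polylogNeg_e_eq (m : ℕ) : ∃ a : ℂ → ℂ, AnalyticAt ℂ a 0 ∧
    ∀ᶠ w in 𝓝[≠] (0 : ℂ), polylogNeg m (e w) =
      m.factorial / (-2 * π * I) ^ (m + 1) * w ^ (-(m + 1 : ℤ)) + a w := by
  have hpi : (2 * π * I : ℂ) ≠ 0 := by simp [Real.pi_ne_zero]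
  induction m with
  | zero =>
    set E : ℂ → ℂ := dslope (fun w => 1 - e w) 0 with hE
    have hEa : AnalyticAt ℂ E 0 := by
      have h1 : AnalyticAt ℂ (fun w => 1 - e w) 0 := analyticAt_const.sub (analyticAt_e 0)
      obtain ⟨p, hp⟩ := h1
      exact hp.has_fpower_series_dslope_fslope.analyticAt
    have hE0 : E 0 = -2 * π * I := by
      rw [hE, dslope_same]
      have := ((hasDerivAt_e 0).const_sub 1).deriv
      rw [this, e_zero]; ring
    have hE0' : E 0 ≠ 0 := by rw [hE0, neg_mul, neg_mul, neg_ne_zero]; exact hpi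
    have hia : AnalyticAt ℂ (fun w => (E w)⁻¹) 0 := hEa.inv hE0'
    obtain ⟨q, hq⟩ := hia
    refine ⟨fun w => dslope (fun w => (E w)⁻¹) 0 w - 1,
      hq.has_fpower_series_dslope_fslope.analyticAt.sub analyticAt_const, ?_⟩
    filter_upwards [self_mem_nhdsWithin, eventually_e_ne_one 0] with w hw hew
    have hw0 : w ≠ 0 := hw
    have h1 : w * E w = 1 - e w := by
      have := sub_smul_dslope (fun w => 1 - e w) 0 w
      simpa [e_zero] using this
    have h2 := sub_smul_dslope (fun w => (E w)⁻¹) 0 w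
    rw [sub_zero, smul_eq_mul] at h2
    have h3 : dslope (fun w => (E w)⁻¹) 0 w = w⁻¹ * ((E w)⁻¹ - (E 0)⁻¹) := by
      rw [← h2, inv_mul_cancel_left₀ hw0]
    have h4 : (1 - e w) ≠ 0 := sub_ne_zero.2 hew.symm
    have h5 : (E w)⁻¹ = w / (1 - e w) := by
      rw [← h1] at h4 ⊢
      have := right_ne_zero_of_mul h4
      field_simp
    change e w / (1 - e w) = _
    rw [h3, h5, hE0]
    simp only [Nat.factorial_zero, Nat.cast_one, zero_add, pow_one, Nat.cast_zero, zpow_neg,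
      zpow_one]
    field_simp
    ring
  | succ m ih =>
    obtain ⟨a, ha, hae⟩ := ih
    refine ⟨fun w => (2 * π * I)⁻¹ * deriv a w, analyticAt_const.mul ha.deriv, ?_⟩
    filter_upwards [self_mem_nhdsWithin, eventually_e_ne_one 0,
      eventually_nhdsNE_eventually_nhds hae,
      mem_nhdsWithin_of_mem_nhds ha.eventually_analyticAt] with w hw hew hloc hwa
    have hw0 : w ≠ 0 := hw
    have h1 : HasDerivAt (fun w : ℂ => m.factorial / (-2 * π * I) ^ (m + 1) *
        w ^ (-(m + 1 : ℤ)) + a w) (m.factorial / (-2 * π * I) ^ (m + 1) *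
        (((-(m + 1 : ℤ) : ℤ) : ℂ) * w ^ (-(m + 1 : ℤ) - 1)) + deriv a w) w :=
      ((hasDerivAt_zpow _ w (Or.inl hw0)).const_mul _).add hwa.differentiableAt.hasDerivAt
    rw [polylogNeg_succ_e m hew, EventuallyEq.deriv_eq hloc, h1.deriv]
    have h2 : -(m + 1 : ℤ) - 1 = -((m + 1 : ℕ) + 1 : ℤ) := by push_cast; ring
    rw [h2, mul_add]
    congr 1
    rw [Nat.factorial_succ, pow_succ _ (m + 1)]
    have h3 : (-2 * π * I : ℂ) ≠ 0 := by rw [neg_mul, neg_mul, neg_ne_zero]; exact hpi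
    push_cast
    field_simp

theorem RegularOrPole.congr_nhds {f g : ℂ → ℂ} {x : ℂ} (h : RegularOrPole f x)
    (he : f =ᶠ[𝓝 x] g) : RegularOrPole g x := by
  rcases h with h | ⟨h1, h2⟩
  · exact Or.inl (h.congr he)
  · have he' : f =ᶠ[𝓝[≠] x] g := he.filter_mono nhdsWithin_le_nhds
    exact Or.inr ⟨h1.congr he', by rwa [← meromorphicOrderAt_congr he']⟩

theorem RegularOrPole.comp_of_deriv_ne_zero {f g : ℂ → ℂ} {x : ℂ} (h : RegularOrPole f (g x))
    (hg : AnalyticAt ℂ g x) (hd : deriv g x ≠ 0) : RegularOrPole (fun z => f (g z)) x := by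
  rcases h with h | ⟨h1, h2⟩
  · exact Or.inl (h.fun_comp hg)
  · exact Or.inr ⟨h1.comp_analyticAt hg,
      (meromorphicOrderAt_comp_of_deriv_ne_zero (f := f) hg hd).trans_lt h2⟩

theorem RegularOrPole.mul_of_ne_zero {f g : ℂ → ℂ} {x : ℂ} (h : RegularOrPole f x)
    (hg : AnalyticAt ℂ g x) (h0 : g x ≠ 0) : RegularOrPole (fun z => f z * g z) x := by
  rcases h with h | ⟨h1, h2⟩
  · exact Or.inl (h.mul hg)
  · refine Or.inr ⟨h1.mul hg.meromorphicAt, ?_⟩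
    change meromorphicOrderAt (f * g) x < 0
    have h3 : meromorphicOrderAt g x = 0 := by
      rw [hg.meromorphicOrderAt_eq, hg.analyticOrderAt_eq_zero.2 h0]; rfl
    rw [meromorphicOrderAt_mul h1 hg.meromorphicAt, h3, add_zero]
    exact h2

/-- Poles are exactly at the integers: at 0 the polar coefficient is nonzero, and the other integers
follow by periodicity. -/
theorem regularOrPole_polylogNeg_e (m : ℕ) (w : ℂ) :
    RegularOrPole (fun w => polylogNeg m (e w)) w := by
  by_cases hw : e w = 1
  · obtain ⟨n, rfl⟩ := e_eq_one_iff.1 hw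
    have h0 : RegularOrPole (fun w => polylogNeg m (e w)) 0 := by
      obtain ⟨a, ha, hae⟩ := exists_polylogNeg_e_eq m
      have hc : (m.factorial / (-2 * π * I) ^ (m + 1) : ℂ) ≠ 0 :=
        div_ne_zero (Nat.cast_ne_zero.2 (Nat.factorial_ne_zero _))
          (pow_ne_zero _ (by simp [Real.pi_ne_zero]))
      have h1 : MeromorphicAt (fun w : ℂ => m.factorial / (-2 * π * I) ^ (m + 1) *
          w ^ (-(m + 1 : ℤ))) 0 := (MeromorphicAt.const _ _).mul (MeromorphicAt.id 0 |>.zpow _)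
      have h2 : meromorphicOrderAt (fun w : ℂ => m.factorial / (-2 * π * I) ^ (m + 1) *
          w ^ (-(m + 1 : ℤ))) 0 < 0 := by
        have : meromorphicOrderAt (fun w : ℂ => m.factorial / (-2 * π * I) ^ (m + 1) *
          w ^ (-(m + 1 : ℤ))) 0 = ((-(m + 1 : ℤ) : ℤ) : WithTop ℤ) := by
          refine (meromorphicOrderAt_eq_int_iff h1).2 ⟨_, analyticAt_const, hc, ?_⟩
          filter_upwards with z
          rw [sub_zero, smul_eq_mul, mul_comm]
        rw [this]
        have : (-(m + 1 : ℤ)) < 0 := by omega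
        exact_mod_cast this
      have h3 : meromorphicOrderAt (fun w : ℂ => m.factorial / (-2 * π * I) ^ (m + 1) *
          w ^ (-(m + 1 : ℤ)) + a w) 0 < 0 := by
        refine (meromorphicOrderAt_add_eq_left_of_lt ha.meromorphicAt
          (h2.trans_le ha.meromorphicOrderAt_nonneg)).trans_lt h2
      exact Or.inr ⟨(h1.add ha.meromorphicAt).congr (EventuallyEq.symm hae),
        (meromorphicOrderAt_congr hae).trans_lt h3⟩
    have h1 : RegularOrPole (fun w => polylogNeg m (e (w - n))) n :=
      RegularOrPole.comp_of_deriv_ne_zero (f := fun w => polylogNeg m (e w))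
        (g := fun w => w - n) (by simpa using h0) (by fun_prop) (by simp)
    refine h1.congr_nhds (Eventually.of_forall fun z => ?_)
    have := e_add_intCast z (-n)
    push_cast at this
    simp only [sub_eq_add_neg, this]
  · exact Or.inl (analyticAt_polylogNeg_e m hw)

/-! ### Pole parts -/

theorem polePart_add_intCast (f : ℂ → ℂ) (α τ : ℂ) (n : ℤ) :
    polePart f α (τ + n) = polePart f α τ := by
  simp only [polePart, show τ + n - α = (τ - α) + n by ring, e_add_intCast]

theorem analyticAt_polePart (f : ℂ → ℂ) {α τ : ℂ} (h : ∀ n : ℤ, τ - α ≠ n) :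
    AnalyticAt ℂ (polePart f α) τ := by
  have h1 : e (τ - α) ≠ 1 := fun h0 => by
    obtain ⟨n, hn⟩ := e_eq_one_iff.1 h0
    exact h n hn
  unfold polePart
  refine Finset.analyticAt_fun_sum _ fun m _ => analyticAt_const.mul ?_
  exact AnalyticAt.fun_comp (g := fun w => polylogNeg (m - 1) (e w)) (f := fun τ => τ - α)
    (analyticAt_polylogNeg_e _ h1) (by fun_prop)

theorem regularOrPole_polylogNeg_e_sub (m : ℕ) (α τ : ℂ) :
    RegularOrPole (fun τ => polylogNeg m (e (τ - α))) τ :=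
  RegularOrPole.comp_of_deriv_ne_zero (f := fun w => polylogNeg m (e w)) (g := fun τ => τ - α)
    (regularOrPole_polylogNeg_e m _) (by fun_prop) (by simp)

theorem meromorphicAt_polePart (f : ℂ → ℂ) (α τ : ℂ) : MeromorphicAt (polePart f α) τ := by
  unfold polePart
  refine MeromorphicAt.fun_sum fun m _ => (MeromorphicAt.const _ _).mul ?_
  exact (regularOrPole_polylogNeg_e_sub _ α τ).meromorphicAt

/-- By the normalizing constants, the m-th polylogarithm term has principal part c(m)(z - α)^(-m),
the corresponding term of that of f. -/
theorem isRemovableAt_sub_polePart {f : ℂ → ℂ} {α : ℂ} (hf : MeromorphicAt f α) :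
    IsRemovableAt (fun z => f z - polePart f α z) α := by
  choose a ha hae using exists_polylogNeg_e_eq
  obtain ⟨b, hb, hbe⟩ := isRemovableAt_sub_principalPart hf
  set c : ℕ → ℂ := fun m => (-2 * π * I) ^ m / ((m - 1).factorial : ℂ) * polarCoeff f α m with hc
  refine ⟨fun z => b z - ∑ m ∈ Finset.Icc 1 (poleOrder f α), c m * a (m - 1) (z - α), ?_, ?_⟩
  · refine hb.sub (Finset.analyticAt_fun_sum _ fun m _ => analyticAt_const.mul ?_)
    exact AnalyticAt.fun_comp (g := a (m - 1)) (f := fun z => z - α) (by simpa using ha _)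
      (by fun_prop)
  · have ht : Tendsto (fun z : ℂ => z - α) (𝓝[≠] α) (𝓝[≠] 0) := by
      refine tendsto_nhdsWithin_of_tendsto_nhds_of_eventually_within _ ?_ ?_
      · have : Continuous fun z : ℂ => z - α := by fun_prop
        exact (by simpa using this.tendsto α : Tendsto (fun z : ℂ => z - α) (𝓝 α) (𝓝 0)).mono_left
          nhdsWithin_le_nhds
      · filter_upwards [self_mem_nhdsWithin] with z hz
        simpa [sub_eq_zero] using hz
    have hall : ∀ᶠ z in 𝓝[≠] α, ∀ m ∈ Finset.Icc 1 (poleOrder f α),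
        polylogNeg (m - 1) (e (z - α)) = (m - 1).factorial / (-2 * π * I) ^ (m - 1 + 1) *
          (z - α) ^ (-((m - 1 : ℕ) + 1 : ℤ)) + a (m - 1) (z - α) :=
      (Finset.eventually_all _).2 fun m _ => ht.eventually (hae (m - 1))
    filter_upwards [hbe, hall] with z hz hzm
    rw [← hz, sub_sub, polePart, ← Finset.sum_add_distrib]
    congr 1
    refine Finset.sum_congr rfl fun m hm => ?_
    rw [hzm m hm, hc]
    have h1 : m - 1 + 1 = m := Nat.sub_add_cancel (Finset.mem_Icc.1 hm).1
    have h2 : ((m - 1 : ℕ) + 1 : ℤ) = m := by exact_mod_cast h1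
    rw [h1, h2]
    have h3 : (-2 * π * I : ℂ) ≠ 0 := by simp [Real.pi_ne_zero]
    have h4 : ((m - 1).factorial : ℂ) ≠ 0 := Nat.cast_ne_zero.2 (Nat.factorial_ne_zero _)
    field_simp

end QMF

end

noncomputable section

namespace QMF

/-! ### Fourier expansions of periodic holomorphic functions -/

theorem _root_.HasSum.congr_eq {ι : Type*} {f g : ι → ℂ} {a : ℂ} (h : HasSum f a)
    (he : ∀ n, f n = g n) : HasSum g a := by
  rwa [← funext he]

theorem e_intCast_mul (n : ℤ) (z : ℂ) : e (n * z) = e z ^ n := by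
  rw [e, e, ← exp_int_mul]; ring_nf

/-- After multiplication by e(Nτ) the function stays bounded at infinity, so as a function of q it
extends holomorphically to the disc |q| < e^(-2πT). Its Taylor series, shifted by N, is the Fourier
series. -/
theorem exists_hasSum_fourier {H : ℂ → ℂ} {T C Y : ℝ} {N : ℕ}
    (hH : ∀ τ : ℂ, T < τ.im → AnalyticAt ℂ H τ) (hper : ∀ τ : ℂ, T < τ.im → H (τ + 1) = H τ)
    (hb : ∀ τ : ℂ, Y < τ.im → ‖e (N * τ) * H τ‖ ≤ C) :
    ∃ b : ℤ → ℂ, (∀ n < -(N : ℤ), b n = 0) ∧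
      ∀ τ : ℂ, T < τ.im → HasSum (fun n : ℤ => b n * e (n * τ)) (H τ) := by
  classical
  -- The cut-off at height T makes the function periodic on all of ℂ, as the cusp function requires;
  -- its values below T do not matter.
  set K : ℂ → ℂ := fun τ => if T < τ.im then e (N * τ) * H τ else 0 with hK
  have hKp : Function.Periodic K (1 : ℝ) := by
    intro τ
    have h1 : e (N * (τ + 1)) = e (N * τ) := by
      have := e_add_intCast (N * τ) N
      push_cast at this
      rw [mul_add, mul_one, this]
    simp only [hK, ofReal_one, add_im, one_im, add_zero]
    split_ifs with h
    · rw [h1, hper τ h]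
    · rfl
  have hKd : ∀ τ : ℂ, T < τ.im → DifferentiableAt ℂ K τ := by
    intro τ hτ
    have h1 : DifferentiableAt ℂ (fun τ => e (N * τ) * H τ) τ :=
      (differentiable_e.differentiableAt.comp τ (by fun_prop)).mul (hH τ hτ).differentiableAt
    refine h1.congr_of_eventuallyEq ?_
    filter_upwards [(isOpen_lt continuous_const continuous_im).mem_nhds hτ] with z hz
    exact if_pos hz
  have him : ∀ A : ℝ, ∀ᶠ z in comap im atTop, A < z.im := fun A =>
    tendsto_comap.eventually (eventually_gt_atTop A)
  have hbd : BoundedAtFilter (comap im atTop) K := by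
    refine Asymptotics.IsBigO.of_bound C ?_
    filter_upwards [him (max T Y)] with z hz
    rw [hK, Pi.one_apply, norm_one, mul_one]
    simp only [if_pos ((le_max_left _ _).trans_lt hz)]
    exact hb z ((le_max_right _ _).trans_lt hz)
  set Ψ := Function.Periodic.cuspFunction 1 K with hΨ
  have hΨd : DifferentiableOn ℂ Ψ (Metric.ball 0 (Real.exp (-(2 * π * T)))) := by
    intro q hq
    refine DifferentiableAt.differentiableWithinAt ?_
    rcases eq_or_ne q 0 with rfl | hq0
    · exact Function.Periodic.differentiableAt_cuspFunction_zero one_pos hKp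
        ((him T).mono hKd) hbd
    · rw [← Function.Periodic.qParam_right_inv (h := 1) one_ne_zero hq0]
      refine Function.Periodic.differentiableAt_cuspFunction one_ne_zero hKp (hKd _ ?_)
      rw [Function.Periodic.im_invQParam]
      have h1 : Real.log ‖q‖ < -(2 * π * T) := by
        rw [Real.log_lt_iff_lt_exp (norm_pos_iff.2 hq0)]
        simpa using hq
      have h2 : -1 / (2 * π) * Real.log ‖q‖ = -Real.log ‖q‖ / (2 * π) := by ring
      rw [h2, lt_div_iff₀ (by positivity)]
      linarith
  set c : ℕ → ℂ := fun n => (n.factorial : ℂ)⁻¹ * iteratedDeriv n Ψ 0 with hc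
  have hsum : ∀ τ : ℂ, T < τ.im → HasSum (fun n : ℕ => c n * e τ ^ n) (e (N * τ) * H τ) := by
    intro τ hτ
    have h1 : e τ ∈ Metric.ball (0 : ℂ) (Real.exp (-(2 * π * T))) := by
      rw [mem_ball_zero_iff, norm_e, Real.exp_lt_exp, neg_lt_neg_iff]
      have := Real.pi_pos
      nlinarith
    have h2 := hasSum_taylorSeries_on_ball hΨd h1
    have h3 : Ψ (e τ) = e (N * τ) * H τ := by
      have := Function.Periodic.eq_cuspFunction one_ne_zero hKp τ
      rw [Function.Periodic.qParam] at this
      rw [e, hΨ, ← div_one (2 * π * I * τ), ← ofReal_one, this]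
      exact if_pos hτ
    rw [h3] at h2
    have h4 : (fun n : ℕ => c n * e τ ^ n) =
        fun n : ℕ => (n.factorial : ℂ)⁻¹ • (e τ - 0) ^ n • iteratedDeriv n Ψ 0 := by
      funext n
      rw [sub_zero, smul_eq_mul, smul_eq_mul, hc]
      ring
    rw [h4]
    exact h2
  refine ⟨fun n => if -(N : ℤ) ≤ n then c (n + N).toNat else 0, fun n hn => if_neg (not_le.2 hn),
    fun τ hτ => ?_⟩
  have hinj : Function.Injective (fun n : ℕ => (n : ℤ) - N) := fun a b h => by
    simpa using h
  rw [← hinj.hasSum_iff]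
  · have h1 := (hsum τ hτ).mul_left (e (N * τ))⁻¹
    rw [inv_mul_cancel_left₀ (e_ne_zero _)] at h1
    refine h1.congr_eq fun n => ?_
    have h2 : e (N * τ) = e τ ^ (N : ℤ) := by simpa using e_intCast_mul N τ
    have h3 : -(N : ℤ) ≤ n - N := by omega
    have h4 : ((n : ℤ) - N + N).toNat = n := by simp
    simp only [Function.comp_apply, if_pos h3, h4]
    rw [e_intCast_mul, zpow_sub₀ (e_ne_zero _), h2, zpow_natCast, zpow_natCast]
    field_simp
  · intro n hn
    have : ¬ -(N : ℤ) ≤ n := fun h => hn ⟨(n + N).toNat, by simp; omega⟩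
    simp only [if_neg this, zero_mul]

theorem integral_e_intCast_mul (T : ℝ) (n : ℤ) :
    ∫ x in (0 : ℝ)..1, e (n * (x + T * I)) = if n = 0 then 1 else 0 := by
  split_ifs with h
  · simp [h, e_zero]
  · have hc : (2 * π * I * n : ℂ) ≠ 0 := by simp [Real.pi_ne_zero, h]
    have h1 : ∀ x : ℝ, e (n * (x + T * I)) = e (n * (T * I)) * exp (2 * π * I * n * x) := by
      intro x
      rw [e, e, ← exp_add]
      ring_nf
    have h2 : exp (2 * π * I * n) = 1 := exp_eq_one_iff.2 ⟨n, by ring⟩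
    simp only [h1]
    rw [intervalIntegral.integral_const_mul, integral_exp_mul_complex hc]
    simp [h2]

/-- On a horizontal line each term has constant modulus, so convergence at one point is a summable
bound for all, and orthogonality of the exponentials applies. -/
theorem integral_mul_e_of_hasSum {H : ℂ → ℂ} {T : ℝ} {b : ℤ → ℂ}
    (h : ∀ x : ℝ, HasSum (fun m : ℤ => b m * e (m * (x + T * I))) (H (x + T * I))) (n : ℤ) :
    ∫ x in (0 : ℝ)..1, H (x + T * I) * e (-(n * (x + T * I))) = b n := by
  set F : ℤ → ℝ → ℂ := fun m x => b m * e (((m - n : ℤ) : ℂ) * (x + T * I)) with hF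
  have hce : Continuous e := differentiable_e.continuous
  have hs : ∀ x : ℝ, HasSum (fun m => F m x) (H (x + T * I) * e (-(n * (x + T * I)))) := by
    intro x
    refine ((h x).mul_right (e (-(n * (x + T * I))))).congr_eq fun m => ?_
    rw [mul_assoc, ← e_add, hF]
    push_cast
    ring_nf
  have hn : ∀ m x, ‖F m x‖ = ‖F m 0‖ := by
    intro m x
    simp [hF, norm_e]
  have hsn : Summable fun m => ‖F m 0‖ := (hs 0).summable.norm
  have hint : ∀ m, ∫ x in (0 : ℝ)..1, F m x = if m = n then b n else 0 := by
    intro m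
    rw [hF, intervalIntegral.integral_const_mul, integral_e_intCast_mul]
    rcases eq_or_ne m n with rfl | hmn
    · simp
    · simp [hmn, sub_eq_zero]
  have key := hasSum_integral_of_summable_integral_norm
    (μ := volume.restrict (Set.Ioc (0 : ℝ) 1)) (F := F) (fun m => ?_) ?_
  · simp only [← intervalIntegral.integral_of_le zero_le_one, hint, (hs _).tsum_eq] at key
    exact key.unique (hasSum_ite_eq n (b n))
  · exact (Continuous.integrableOn_Icc (by fun_prop)).mono_set Set.Ioc_subset_Icc_self
  · have h1 : ∀ m, ∫ x in Set.Ioc (0 : ℝ) 1, ‖F m x‖ = ‖F m 0‖ := by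
      intro m
      rw [integral_congr_ae (ae_of_all _ (hn m))]
      simp
    simpa only [h1] using hsn

end QMF

end

noncomputable section

namespace QMF

/-! ### Periodic meromorphic functions on the upper half-plane -/

theorem isOpen_upperHalf : IsOpen upperHalf := isOpen_lt continuous_const continuous_im

theorem eventually_codiscreteWithin_iff {U : Set ℂ} (hU : IsOpen U) {P : ℂ → Prop} :
    (∀ᶠ z in codiscreteWithin U, P z) ↔ ∀ x ∈ U, ∀ᶠ z in 𝓝[≠] x, P z := by
  rw [Filter.Eventually, mem_codiscreteWithin]
  refine forall₂_congr fun x hx => ?_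
  rw [disjoint_principal_right, Filter.Eventually]
  have h1 : U ∈ 𝓝[≠] x := mem_nhdsWithin_of_mem_nhds (hU.mem_nhds hx)
  constructor
  · intro h
    filter_upwards [h, h1] with z hz hzU
    by_contra hcon
    exact hz ⟨hzU, hcon⟩
  · intro h
    filter_upwards [h] with z hz hcon
    exact hcon.2 hz

theorem tendsto_add_const_nhdsNE (x c : ℂ) :
    Tendsto (fun z : ℂ => z + c) (𝓝[≠] x) (𝓝[≠] (x + c)) := by
  refine tendsto_nhdsWithin_of_tendsto_nhds_of_eventually_within _ ?_ ?_
  · exact (Continuous.tendsto (by fun_prop) x).mono_left nhdsWithin_le_nhds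
  · filter_upwards [self_mem_nhdsWithin] with z hz
    simpa using hz

theorem eq_of_eventuallyEq_nhdsNE {f g : ℂ → ℂ} {x : ℂ} (hf : AnalyticAt ℂ f x)
    (hg : AnalyticAt ℂ g x) (h : f =ᶠ[𝓝[≠] x] g) : f x = g x :=
  ((hf.continuousAt.eventuallyEq_nhds_iff_eventuallyEq_nhdsNE hg.continuousAt).1 h).eq_of_nhds

/-- `g` is meromorphic on the upper half-plane and at infinity, and has period `1`. -/
structure IsPeriodicMeromorphic (g : ℂ → ℂ) : Prop where
  meromorphic : MeromorphicOn g upperHalf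
  atInfinity : MeromorphicAtInfinity g
  periodic : ∀ τ ∈ upperHalf, (fun z => g (z + 1)) =ᶠ[𝓝[≠] τ] g

theorem MeromorphicAtInfinity.exists_analyticAt {g : ℂ → ℂ} (h : MeromorphicAtInfinity g) :
    ∃ (φ : ℂ → ℂ) (Y : ℝ), 0 < Y ∧ MeromorphicAt φ 0 ∧
      ∀ τ : ℂ, Y < τ.im → g =ᶠ[𝓝[≠] τ] (fun z => φ (e z)) ∧ AnalyticAt ℂ φ (e τ) := by
  obtain ⟨φ, Y, hY, hφ, he⟩ := h
  have he' := (eventually_codiscreteWithin_iff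
    (isOpen_lt (continuous_const (y := Y)) continuous_im)).1 he
  obtain ⟨ρ, hρ, hball⟩ := Metric.eventually_nhds_iff_ball.1
    (eventually_nhdsWithin_iff.1 hφ.eventually_analyticAt)
  refine ⟨φ, max Y (-Real.log ρ / (2 * π)), lt_max_of_lt_left hY, hφ, fun τ hτ => ⟨?_, ?_⟩⟩
  · exact he' τ ((le_max_left _ _).trans_lt hτ)
  · refine hball _ ?_ (e_ne_zero τ)
    rw [mem_ball_zero_iff, norm_e, ← Real.lt_log_iff_exp_lt hρ]
    have h1 := (le_max_right _ _).trans_lt hτ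
    rw [div_lt_iff₀ (by positivity)] at h1
    linarith

theorem MeromorphicAtInfinity.exists_isRemovableAt {g : ℂ → ℂ} (h : MeromorphicAtInfinity g) :
    ∃ Y : ℝ, 0 < Y ∧ ∀ τ : ℂ, Y < τ.im → IsRemovableAt g τ := by
  obtain ⟨φ, Y, hY, -, h⟩ := h.exists_analyticAt
  exact ⟨Y, hY, fun τ hτ => ⟨_, (h τ hτ).2.fun_comp (analyticAt_e τ), (h τ hτ).1⟩⟩

namespace IsPeriodicMeromorphic

variable {g : ℂ → ℂ} (hg : IsPeriodicMeromorphic g) {T : ℝ}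

include hg

theorem eventuallyEq_add_natCast (n : ℕ) {τ : ℂ} (hτ : τ ∈ upperHalf) :
    (fun z => g (z + n)) =ᶠ[𝓝[≠] τ] g := by
  induction n with
  | zero => simp
  | succ n ih =>
    have h1 : τ + n ∈ upperHalf := by simpa [upperHalf] using hτ
    have h2 := (tendsto_add_const_nhdsNE τ n).eventually (hg.periodic _ h1)
    filter_upwards [ih, h2] with z hz hz2
    push_cast
    rw [← add_assoc, hz2, hz]

theorem eventuallyEq_add_intCast (n : ℤ) {τ : ℂ} (hτ : τ ∈ upperHalf) :
    (fun z => g (z + n)) =ᶠ[𝓝[≠] τ] g := by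
  obtain ⟨m, rfl | rfl⟩ := n.eq_nat_or_neg
  · simpa using hg.eventuallyEq_add_natCast m hτ
  · have h1 : τ + -m ∈ upperHalf := by simpa [upperHalf] using hτ
    have h2 := (tendsto_add_const_nhdsNE τ (-m)).eventually (hg.eventuallyEq_add_natCast m h1)
    filter_upwards [h2] with z hz
    simpa using hz.symm

/-- Above some height Y there are no poles, by meromorphy at infinity; what remains is a compact
rectangle. -/
theorem finite_stripPoles (hT : 0 < T) : (stripPoles g T).Finite := by
  obtain ⟨Y, hY, hrem⟩ := hg.atInfinity.exists_isRemovableAt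
  have hK : IsCompact (Set.Icc (-(1 / 2) : ℝ) (1 / 2) ×ℂ Set.Icc T Y) :=
    isCompact_Icc.reProdIm isCompact_Icc
  have hm : MeromorphicOn g (Set.Icc (-(1 / 2) : ℝ) (1 / 2) ×ℂ Set.Icc T Y) := fun z hz =>
    hg.meromorphic z (hT.trans_le hz.2.1)
  refine (hK.finite_sdiff_of_mem_codiscreteWithin
    (MeromorphicOn.eventually_codiscreteWithin_analyticAt g hm)).subset ?_
  intro α hα
  refine ⟨⟨⟨hα.1, hα.2.1.le⟩, hα.2.2.1, ?_⟩, fun h => ?_⟩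
  · by_contra hY'
    have := poleOrder_eq_zero_iff.2 (hrem α (not_le.1 hY')).meromorphicOrderAt_nonneg
    exact hα.2.2.2.ne' this
  · have := poleOrder_eq_zero_iff.2 (AnalyticAt.meromorphicOrderAt_nonneg h)
    exact hα.2.2.2.ne' this

theorem removePoles_eq (hT : 0 < T) (τ : ℂ) : removePoles g T τ =
    g τ - ∑ α ∈ (hg.finite_stripPoles hT).toFinset, polePart g α τ := by
  rw [removePoles, finsum_mem_eq_finite_toFinset_sum]

theorem meromorphicOn_removePoles (hT : 0 < T) : MeromorphicOn (removePoles g T) upperHalf := by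
  intro τ hτ
  rw [funext (hg.removePoles_eq hT)]
  exact (hg.meromorphic τ hτ).fun_sub
    (MeromorphicAt.fun_sum fun α _ => meromorphicAt_polePart g α τ)

theorem removePoles_add_intCast (hT : 0 < T) (n : ℤ) {τ : ℂ} (hτ : τ ∈ upperHalf) :
    (fun z => removePoles g T (z + n)) =ᶠ[𝓝[≠] τ] removePoles g T := by
  filter_upwards [hg.eventuallyEq_add_intCast n hτ] with z hz
  simp only [hg.removePoles_eq hT, hz, polePart_add_intCast]

/-- Two points of the half-open strip never differ by a nonzero integer, so the only pole part that
can be singular at τ is the one attached to τ itself. -/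
theorem isRemovableAt_removePoles_of_mem_strip (hT : 0 < T) {τ : ℂ} (h1 : -(1 / 2) ≤ τ.re)
    (h2 : τ.re < 1 / 2) (h3 : T ≤ τ.im) : IsRemovableAt (removePoles g T) τ := by
  have hmer : MeromorphicAt g τ := hg.meromorphic τ (hT.trans_le h3)
  set S := (hg.finite_stripPoles hT).toFinset with hS
  have hother : ∀ α ∈ S.erase τ, AnalyticAt ℂ (polePart g α) τ := by
    intro α hα
    rw [Finset.mem_erase, hS, Set.Finite.mem_toFinset] at hα
    refine analyticAt_polePart g fun n hn => hα.1 ?_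
    have hre : τ.re - α.re = n := by simpa using congrArg re hn
    have e1 : (-1 : ℝ) < n := by rw [← hre]; linarith [hα.2.2.1]
    have e2 : (n : ℝ) < 1 := by rw [← hre]; linarith [hα.2.1]
    have e3 : n = 0 := by
      have e1' : (-1 : ℤ) < n := by exact_mod_cast e1
      have e2' : n < (1 : ℤ) := by exact_mod_cast e2
      omega
    rw [e3, Int.cast_zero, sub_eq_zero] at hn
    exact hn.symm
  have hrest : AnalyticAt ℂ (fun z => ∑ α ∈ S.erase τ, polePart g α z) τ :=
    Finset.analyticAt_fun_sum _ hother
  rw [funext (hg.removePoles_eq hT)]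
  by_cases hmem : τ ∈ S
  · refine ((isRemovableAt_sub_polePart hmer).sub (.of_analyticAt hrest)).congr ?_
    filter_upwards with z
    rw [← Finset.add_sum_erase _ _ hmem]
    ring
  · rw [Finset.erase_eq_of_notMem hmem] at hrest
    refine (IsRemovableAt.of_order_nonneg hmer ?_).sub (.of_analyticAt hrest)
    rw [← poleOrder_eq_zero_iff]
    by_contra h0
    exact hmem ((hg.finite_stripPoles hT).mem_toFinset.2 ⟨h1, h2, h3, Nat.pos_of_ne_zero h0⟩)

theorem isRemovableAt_removePoles_of_shift (hT : 0 < T) {τ : ℂ} (hτ : τ ∈ upperHalf) (n : ℤ)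
    (h : IsRemovableAt (removePoles g T) (τ + n)) : IsRemovableAt (removePoles g T) τ :=
  (IsRemovableAt.comp_add_const h).congr (hg.removePoles_add_intCast hT n hτ)

/-- The expansion is needed on the closed half-plane Im τ ≥ T, hence the margin below T. Below
height T only finitely many singular points occur modulo 1 at heights in [T/2, T), so some T' < T
lies above or level with all of them. -/
theorem exists_isRemovableAt_removePoles (hT : 0 < T) :
    ∃ T', 0 < T' ∧ T' < T ∧ ∀ τ : ℂ, T' < τ.im → IsRemovableAt (removePoles g T) τ := by
  have hK : IsCompact (Set.Icc (-(1 / 2) : ℝ) (1 / 2) ×ℂ Set.Icc (T / 2) T) :=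
    isCompact_Icc.reProdIm isCompact_Icc
  have hm : MeromorphicOn (removePoles g T) (Set.Icc (-(1 / 2) : ℝ) (1 / 2) ×ℂ Set.Icc (T / 2) T) :=
    fun z hz => hg.meromorphicOn_removePoles hT z ((half_pos hT).trans_le hz.2.1)
  have hfin := hK.finite_sdiff_of_mem_codiscreteWithin
    (MeromorphicOn.eventually_codiscreteWithin_analyticAt _ hm)
  set s : Finset ℝ := insert (T / 2) ((hfin.toFinset.image im).filter (· < T)) with hs
  have hne : s.Nonempty := Finset.insert_nonempty _ _
  have hlt : s.max' hne < T := by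
    rw [Finset.max'_lt_iff]
    intro y hy
    rw [hs, Finset.mem_insert, Finset.mem_filter] at hy
    rcases hy with rfl | hy
    · exact half_lt_self hT
    · exact hy.2
  have hge : T / 2 ≤ s.max' hne := Finset.le_max' _ _ (Finset.mem_insert_self _ _)
  refine ⟨s.max' hne, (half_pos hT).trans_le hge, hlt, fun τ hτ => ?_⟩
  have hτ' : τ ∈ upperHalf := ((half_pos hT).trans_le hge).trans hτ
  set n : ℤ := -⌊τ.re + 1 / 2⌋ with hn
  have hre : (τ + n).re = τ.re + n := by simp
  have him : (τ + n).im = τ.im := by simp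
  have h1 : -(1 / 2) ≤ (τ + n).re := by
    rw [hre, hn]; push_cast; linarith [Int.floor_le (τ.re + 1 / 2)]
  have h2 : (τ + n).re < 1 / 2 := by
    rw [hre, hn]; push_cast; linarith [Int.lt_floor_add_one (τ.re + 1 / 2)]
  refine hg.isRemovableAt_removePoles_of_shift hT hτ' n ?_
  rcases le_or_gt T τ.im with h3 | h3
  · exact hg.isRemovableAt_removePoles_of_mem_strip hT h1 h2 (by rwa [him])
  · by_cases ha : AnalyticAt ℂ (removePoles g T) (τ + n)
    · exact .of_analyticAt ha
    · exfalso
      have hmem : (τ + n).im ∈ s := by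
        rw [hs, Finset.mem_insert, Finset.mem_filter]
        refine Or.inr ⟨Finset.mem_image_of_mem _ (hfin.mem_toFinset.2 ⟨⟨⟨h1, h2.le⟩, ?_⟩, ha⟩), ?_⟩
        · exact ⟨by rw [him]; linarith, by rw [him]; exact h3.le⟩
        · rwa [him]
      exact absurd (Finset.le_max' _ _ hmem) (not_le.2 (hτ.trans_eq him.symm))

/-- The function obtained from `removePoles g T` by filling in the removable singularities. -/
theorem exists_fourier (hT : 0 < T) : ∃ (h : ℂ → ℂ) (T' : ℝ) (N : ℤ), T' < T ∧ 0 < T' ∧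
    (∀ τ : ℂ, T' < τ.im → AnalyticAt ℂ h τ ∧ removePoles g T =ᶠ[𝓝[≠] τ] h) ∧
    (∀ n < N, tildeCoeff g T n = 0) ∧
    ∀ τ : ℂ, T' < τ.im → HasSum (fun n : ℤ => tildeCoeff g T n * e (n * τ)) (h τ) := by
  obtain ⟨T', hT'0, hT', hrem⟩ := hg.exists_isRemovableAt_removePoles hT
  have hmer := hg.meromorphicOn_removePoles hT
  set h := toMeromorphicNFOn (removePoles g T) upperHalf with hh
  have hmem : ∀ τ : ℂ, T' < τ.im → τ ∈ upperHalf := fun τ hτ => hT'0.trans hτ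
  have heq : ∀ τ : ℂ, T' < τ.im → removePoles g T =ᶠ[𝓝[≠] τ] h := fun τ hτ =>
    (hmer.toMeromorphicNFOn_eq_self_on_nhdsNE (hmem τ hτ)).symm
  have han : ∀ τ : ℂ, T' < τ.im → AnalyticAt ℂ h τ := fun τ hτ => by
    refine (meromorphicNFOn_toMeromorphicNFOn _ _
      (hmem τ hτ)).meromorphicOrderAt_nonneg_iff_analyticAt.1 ?_
    rw [meromorphicOrderAt_toMeromorphicNFOn hmer (hmem τ hτ)]
    exact (hrem τ hτ).meromorphicOrderAt_nonneg
  have hper : ∀ τ : ℂ, T' < τ.im → h (τ + 1) = h τ := by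
    intro τ hτ
    have hτ1 : T' < (τ + 1).im := by simpa using hτ
    refine eq_of_eventuallyEq_nhdsNE (f := fun z => h (z + 1))
      (AnalyticAt.fun_comp (g := h) (f := fun z => z + 1) (han _ hτ1) (by fun_prop))
      (han τ hτ) ?_
    have h1 := (tendsto_add_const_nhdsNE τ 1).eventually (heq _ hτ1)
    have h2 := hg.removePoles_add_intCast hT 1 (hmem τ hτ)
    filter_upwards [h1, h2, heq τ hτ] with z e1 e2 e3
    rw [← e1, ← e3, ← e2, Int.cast_one]
  -- Each pole part is a function of q analytic at q = 0, namely a polylogarithm of q e(-α). So near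
  -- infinity `removePoles` is meromorphic in q, and a power q^N makes it bounded.
  obtain ⟨N, C, Y, hb⟩ : ∃ (N : ℕ) (C Y : ℝ), ∀ τ : ℂ, Y < τ.im → ‖e (N * τ) * h τ‖ ≤ C := by
    obtain ⟨φ, Y, hY, hφ, hφe⟩ := hg.atInfinity.exists_analyticAt
    set S := (hg.finite_stripPoles hT).toFinset with hS
    set ψ : ℂ → ℂ := fun q => φ q - ∑ α ∈ S, ∑ m ∈ Finset.Icc 1 (poleOrder g α),
      (-2 * π * I) ^ m / ((m - 1).factorial : ℂ) * polarCoeff g α m *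
        polylogNeg (m - 1) (q * e (-α)) with hψ
    have hψm : MeromorphicAt ψ 0 := by
      refine hφ.fun_sub (AnalyticAt.meromorphicAt ?_)
      refine Finset.analyticAt_fun_sum _ fun α _ => Finset.analyticAt_fun_sum _ fun m _ =>
        analyticAt_const.mul ?_
      exact AnalyticAt.fun_comp (g := polylogNeg (m - 1)) (f := fun q => q * e (-α))
        (analyticAt_polylogNeg _ (by simp)) (by fun_prop)
    have hψeq : ∀ τ : ℂ, Y < τ.im → removePoles g T =ᶠ[𝓝[≠] τ] fun z => ψ (e z) := by
      intro τ hτ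
      filter_upwards [(hφe τ hτ).1] with z hz
      simp only [hg.removePoles_eq hT, hz, hψ, polePart, sub_eq_add_neg z, e_add]
      rfl
    obtain ⟨N, hN⟩ := hψm
    simp only [sub_zero, smul_eq_mul] at hN
    obtain ⟨ρ, hρ, hball⟩ := Metric.eventually_nhds_iff_ball.1 (hN.eventually_analyticAt.and
      (hN.continuousAt.norm.eventually (ge_mem_nhds (lt_add_one _))))
    refine ⟨N, ‖(0 : ℂ) ^ N * ψ 0‖ + 1, max (max T' Y) (-Real.log ρ / (2 * π)), fun τ hτ => ?_⟩
    have hτT : T' < τ.im := ((le_max_left _ _).trans (le_max_left _ _)).trans_lt hτ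
    have hτY : Y < τ.im := ((le_max_right _ _).trans (le_max_left _ _)).trans_lt hτ
    have hq : e τ ∈ Metric.ball (0 : ℂ) ρ := by
      rw [mem_ball_zero_iff, norm_e, ← Real.lt_log_iff_exp_lt hρ]
      have h1 := (le_max_right _ _).trans_lt hτ
      rw [div_lt_iff₀ (by positivity)] at h1
      linarith
    obtain ⟨hqa, hqb⟩ := hball _ hq
    have hval : e (N * τ) * h τ = e τ ^ N * ψ (e τ) := by
      refine eq_of_eventuallyEq_nhdsNE (f := fun z => e (N * z) * h z)
        (g := fun z => e z ^ N * ψ (e z)) ?_ ?_ ?_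
      · exact ((analyticAt_e _).fun_comp (f := fun z : ℂ => (N : ℂ) * z) (by fun_prop)).mul (han τ hτT)
      · exact AnalyticAt.fun_comp (g := fun q => q ^ N * ψ q) hqa (analyticAt_e τ)
      · filter_upwards [heq τ hτT, hψeq τ hτY] with z e1 e2
        have e3 : e (N * z) = e z ^ N := by simpa using e_intCast_mul N z
        rw [← e1, e2, e3]
    rw [hval]
    exact hqb
  obtain ⟨b, hbN, hsum⟩ := exists_hasSum_fourier han hper hb
  -- The coefficients are defined by integrating `removePoles` itself over the line Im τ = T; there
  -- it differs from h on a discrete set only, so the integral is that of h.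
  have hcoef : ∀ n, tildeCoeff g T n = b n := by
    intro n
    have him : ∀ x : ℝ, ((x : ℂ) + T * I).im = T := fun x => by simp
    rw [← integral_mul_e_of_hasSum (fun x => hsum (x + T * I) (by rw [him]; exact hT')) n,
      tildeCoeff]
    refine intervalIntegral.integral_congr_ae_restrict ?_
    have hae : ∀ᵐ x : ℝ, removePoles g T (x + T * I) = h (x + T * I) := by
      have h1 : ∀ᶠ x : ℝ in codiscreteWithin Set.univ,
          removePoles g T (x + T * I) = h (x + T * I) := by
        rw [Filter.Eventually, mem_codiscreteWithin]
        intro x _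
        rw [disjoint_principal_right]
        have h2 := ((tendsto_add_const_nhdsNE x (T * I)).comp (tendsto_ofReal_nhdsNE x)).eventually
          (heq (x + T * I) (by rw [him]; exact hT'))
        filter_upwards [h2] with y hy hcon
        exact hcon.2 hy
      have h2 := ae_restrict_le_codiscreteWithin (μ := (volume : Measure ℝ)) MeasurableSet.univ h1
      rwa [Measure.restrict_univ] at h2
    filter_upwards [ae_restrict_of_ae hae] with x hx
    rw [hx]
  simp only [← hcoef] at hbN hsum
  exact ⟨h, T', -(N : ℤ), hT', hT'0, fun τ hτ => ⟨han τ hτ, heq τ hτ⟩, hbN, hsum⟩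

theorem isFourierExpansion (hT : 0 < T) :
    IsFourierExpansion (removePoles g T) T (tildeCoeff g T) := by
  obtain ⟨h, T', N, hT', -, hloc, hN, hsum⟩ := hg.exists_fourier hT
  refine ⟨⟨N, hN⟩, fun τ hτ ha => ?_⟩
  have hτ' := hT'.trans_le hτ
  rw [eq_of_eventuallyEq_nhdsNE ha (hloc τ hτ').1 (hloc τ hτ').2]
  exact hsum τ hτ'

end IsPeriodicMeromorphic

end QMF

end

noncomputable section

namespace QMF

/-! ### The Mellin transform of a Fourier expansion -/

/-- Separates the exponents n ≥ 1 from the finitely many n ≤ 0 that can occur. -/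
theorem hasSum_int_of_nat {f : ℤ → ℂ} {N : ℤ} (hN : ∀ n < N, f n = 0) {S : ℂ}
    (h : HasSum (fun n : ℕ => f (n + 1)) S) :
    HasSum f (S + (f 0 + ∑ n ∈ Finset.Ico N 0, f n)) := by
  have hinj : Function.Injective (fun n : ℕ => (n + 1 : ℤ)) := fun a b h => by simpa using h
  set f₁ : ℤ → ℂ := fun n => if 0 < n then f n else 0 with hf₁
  set f₂ : ℤ → ℂ := fun n => if 0 < n then 0 else f n with hf₂
  have h1 : HasSum f₁ S := by
    rw [← hinj.hasSum_iff]
    · refine h.congr_eq fun n => ?_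
      simp only [Function.comp_apply, hf₁]
      rw [if_pos (by omega)]
    · intro n hn
      exact if_neg fun h0 => hn ⟨(n - 1).toNat, by simp; omega⟩
  have h2 : HasSum f₂ (f 0 + ∑ n ∈ Finset.Ico N 0, f n) := by
    have h3 : ∑ n ∈ insert 0 (Finset.Ico N 0), f₂ n = f 0 + ∑ n ∈ Finset.Ico N 0, f n := by
      rw [Finset.sum_insert (by simp)]
      refine congrArg₂ _ (by simp [hf₂]) (Finset.sum_congr rfl fun n hn => ?_)
      rw [Finset.mem_Ico] at hn
      exact if_neg (by omega)
    rw [← h3]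
    refine hasSum_sum_of_ne_finset_zero fun n hn => ?_
    rw [Finset.mem_insert, Finset.mem_Ico] at hn
    by_cases h0 : 0 < n
    · exact if_pos h0
    · exact (if_neg h0).trans (hN n (by omega))
  refine (h1.add h2).congr_eq fun n => ?_
  by_cases h0 : 0 < n <;> simp [hf₁, hf₂, h0]

theorem e_intCast_mul_I_mul (n : ℤ) (t : ℝ) :
    e (n * (I * t)) = exp (-(((2 * π * n : ℝ) : ℂ) * t)) := by
  rw [e]
  congr 1
  push_cast
  linear_combination (2 * π * n * t : ℂ) * I_mul_I

section FourierMellin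

variable {a : ℤ → ℂ} {N : ℤ} {h : ℂ → ℂ} {T : ℝ}

/-- The part of a Fourier expansion with positive exponents, on the imaginary axis. -/
def positivePart (a : ℤ → ℂ) (N : ℤ) (h : ℂ → ℂ) (t : ℝ) : ℂ :=
  h (I * t) - (a 0 + ∑ n ∈ Finset.Ico N 0, a n * exp (-(((2 * π * n : ℝ) : ℂ) * t)))

theorem hasSum_positivePart (hN : ∀ n < N, a n = 0) {t : ℝ}
    (hs : HasSum (fun n : ℤ => a n * e (n * (I * t))) (h (I * t))) :
    HasSum (fun n : ℕ => a (n + 1) * exp (-(((2 * π * (n + 1 : ℤ) : ℝ) : ℂ) * t)))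
      (positivePart a N h t) := by
  have hinj : Function.Injective (fun n : ℕ => (n + 1 : ℤ)) := fun a b h => by simpa using h
  simp only [e_intCast_mul_I_mul] at hs
  obtain ⟨S, hS⟩ := hs.summable.comp_injective hinj
  have h1 := hasSum_int_of_nat (f := fun n : ℤ => a n * exp (-(((2 * π * n : ℝ) : ℂ) * t)))
    (N := N) (fun n hn => by simp only [hN n hn, zero_mul]) hS
  have h2 := h1.unique hs
  have h3 : positivePart a N h t = S := by
    rw [positivePart, ← h2]
    simp
  rw [h3]
  exact hS

variable (hN : ∀ n < N, a n = 0)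
  (hs : ∀ t : ℝ, T ≤ t → HasSum (fun n : ℤ => a n * e (n * (I * t))) (h (I * t)))

include hN hs

theorem summable_positivePart :
    Summable fun n : ℕ => ‖a (n + 1)‖ * Real.exp (-(2 * π * (n + 1 : ℤ) * T)) := by
  refine ((hasSum_positivePart hN (hs T le_rfl)).summable.norm).congr fun n => ?_
  rw [norm_mul, norm_exp, ← ofReal_mul, ← ofReal_neg, ofReal_re]

omit hN hs in
-- Since (n + 1)(t - T) ≥ t - T, the coefficient bound at T and a common decay rate 2π in t
-- separate. This one estimate gives both the decay of the positive part and the interchange of sum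
-- and integral.
theorem norm_positiveTerm_le (n : ℕ) {t : ℝ} (ht : T < t) :
    ‖a (n + 1) * exp (-(((2 * π * (n + 1 : ℤ) : ℝ) : ℂ) * t))‖ ≤
      ‖a (n + 1)‖ * Real.exp (-(2 * π * (n + 1 : ℤ) * T)) *
        (Real.exp (2 * π * T) * Real.exp (-(2 * π) * t)) := by
  rw [norm_mul, norm_exp, ← ofReal_mul, ← ofReal_neg, ofReal_re, mul_assoc ‖a (n + 1)‖]
  refine mul_le_mul_of_nonneg_left ?_ (norm_nonneg _)
  rw [← Real.exp_add, ← Real.exp_add]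
  refine Real.exp_le_exp.2 ?_
  push_cast
  have h1 : 0 ≤ 2 * π * n * (t - T) := by
    have := Real.pi_pos
    have : 0 ≤ t - T := by linarith
    positivity
  linarith

theorem exists_norm_positivePart_le : ∃ C, 0 ≤ C ∧ ∀ t, T < t →
    ‖positivePart a N h t‖ ≤ C * Real.exp (-(2 * π) * t) := by
  have hsum := summable_positivePart hN hs
  refine ⟨(∑' n : ℕ, ‖a (n + 1)‖ * Real.exp (-(2 * π * (n + 1 : ℤ) * T))) *
    Real.exp (2 * π * T), mul_nonneg (tsum_nonneg fun n => by positivity) (by positivity),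
    fun t ht => ?_⟩
  rw [← (hasSum_positivePart hN (hs t ht.le)).tsum_eq, mul_assoc]
  exact tsum_of_norm_bounded (hsum.hasSum.mul_right _) fun n => norm_positiveTerm_le n ht

variable (hT : 0 < T)

include hT

/-- Term-by-term integration for positive exponents, where everything converges absolutely, for all
s. -/
theorem hasSum_gammaTerm_nat (s : ℂ) :
    HasSum (fun n : ℕ => a (n + 1) * upperGamma s (2 * π * (n + 1 : ℤ) * T) /
      ((2 * π * (n + 1 : ℤ) : ℝ) : ℂ) ^ s)
      (∫ t in Set.Ioi T, positivePart a N h t * (t : ℂ) ^ (s - 1)) := by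
  have hsum := summable_positivePart hN hs
  set F : ℕ → ℝ → ℂ := fun n t =>
    a (n + 1) * exp (-(((2 * π * (n + 1 : ℤ) : ℝ) : ℂ) * t)) * (t : ℂ) ^ (s - 1) with hF
  have hνpos : ∀ n : ℕ, 0 < 2 * π * (n + 1 : ℤ) := fun n => by
    have := Real.pi_pos
    have : (0 : ℝ) < (n + 1 : ℤ) := by push_cast; positivity
    positivity
  have hFi : ∀ n, IntegrableOn (F n) (Set.Ioi T) := by
    intro n
    refine integrableOn_mellinTail hT (hνpos n) (norm_nonneg (a (n + 1)))
      (Continuous.aestronglyMeasurable (by fun_prop)) (fun t _ => ?_) _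
    rw [norm_mul, norm_exp, ← ofReal_mul, ← ofReal_neg, ofReal_re, neg_mul]
  have hval : ∀ n, ∫ t in Set.Ioi T, F n t = a (n + 1) * upperGamma s (2 * π * (n + 1 : ℤ) * T) /
      ((2 * π * (n + 1 : ℤ) : ℝ) : ℂ) ^ s := by
    intro n
    have h1 := (hasRegIntegralAtInfinity_exp_mul_cpow s hT (hνpos n).ne').const_mul (a (n + 1))
    -- A convergent integral is its own regularized integral, so uniqueness gives its value from the
    -- formula for the exponential.
    have h2 := HasRegIntegralAtInfinity.of_integrableOn (hFi n) hT.le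
    simp only [hF, mul_assoc] at h2 h1 ⊢
    rw [h2.unique h1, mul_div_assoc]
  set J : ℝ → ℂ := fun t => ((Real.exp (2 * π * T) * Real.exp (-(2 * π) * t) : ℝ) : ℂ) *
    (t : ℂ) ^ (s - 1) with hJ
  have hJi : IntegrableOn J (Set.Ioi T) := by
    refine integrableOn_mellinTail hT Real.two_pi_pos (Real.exp_nonneg (2 * π * T))
      (Continuous.aestronglyMeasurable (by fun_prop)) (fun t _ => ?_) _
    rw [norm_real, Real.norm_of_nonneg (by positivity)]
  have hbound : ∀ n, ∀ t ∈ Set.Ioi T, ‖F n t‖ ≤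
      ‖a (n + 1)‖ * Real.exp (-(2 * π * (n + 1 : ℤ) * T)) * ‖J t‖ := by
    intro n t ht
    have h1 : ‖J t‖ = Real.exp (2 * π * T) * Real.exp (-(2 * π) * t) * ‖(t : ℂ) ^ (s - 1)‖ := by
      rw [hJ, norm_mul, norm_real, Real.norm_of_nonneg (by positivity)]
    rw [h1, ← mul_assoc, hF, norm_mul]
    exact mul_le_mul_of_nonneg_right (norm_positiveTerm_le n ht) (norm_nonneg _)
  have key := hasSum_integral_of_summable_integral_norm hFi ?_
  · simp only [hval] at key
    have h1 : ∀ t ∈ Set.Ioi T, positivePart a N h t * (t : ℂ) ^ (s - 1) = ∑' n, F n t :=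
      fun t ht => (((hasSum_positivePart hN (hs t (le_of_lt ht))).mul_right _).tsum_eq).symm
    rw [setIntegral_congr_fun measurableSet_Ioi h1]
    exact key
  · refine Summable.of_nonneg_of_le (fun n => integral_nonneg fun t => norm_nonneg _) (fun n => ?_)
      (hsum.mul_right (∫ t in Set.Ioi T, ‖J t‖))
    rw [← integral_const_mul]
    exact setIntegral_mono_on (hFi n).norm (hJi.norm.const_mul _) measurableSet_Ioi (hbound n)

theorem hasSum_gammaTerm (s : ℂ) : HasSum (gammaTerm a s T)
    ((∫ t in Set.Ioi T, positivePart a N h t * (t : ℂ) ^ (s - 1)) +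
      ∑ n ∈ Finset.Ico N 0, a n * upperGamma s (2 * π * n * T) / ((2 * π * n : ℝ) : ℂ) ^ s) := by
  set γ : ℤ → ℂ := fun n => a n * upperGamma s (2 * π * n * T) / ((2 * π * n : ℝ) : ℂ) ^ s with hγ
  have hind : ∀ n : ℤ, n ≠ 0 → {n : ℤ | n ≠ 0}.indicator γ n = γ n := fun n hn =>
    Set.indicator_of_mem hn _
  have h1 : HasSum ({n : ℤ | n ≠ 0}.indicator γ)
      ((∫ t in Set.Ioi T, positivePart a N h t * (t : ℂ) ^ (s - 1)) +
        ∑ n ∈ Finset.Ico N 0, γ n) := by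
    have h2 := hasSum_int_of_nat (f := {n : ℤ | n ≠ 0}.indicator γ) (N := N) (fun n hn => ?_)
      ((hasSum_gammaTerm_nat hN hs hT s).congr_eq fun n => (hind (n + 1) (by omega)).symm)
    · convert h2 using 2
      rw [Set.indicator_of_notMem (by simp), zero_add]
      refine Finset.sum_congr rfl fun n hn => (hind n ?_).symm
      rw [Finset.mem_Ico] at hn
      omega
    · by_cases h0 : n = 0
      · exact Set.indicator_of_notMem (by simpa using h0) _
      · rw [hind n h0, hγ]
        simp only [hN n hn, zero_mul, zero_div]
  exact (hasSum_subtype_iff_indicator (s := {n : ℤ | n ≠ 0}) (f := γ)).2 h1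

variable (hc : ContinuousOn (fun t : ℝ => h (I * t)) (Set.Ioi T))

include hc

omit hN hs hT in
theorem aestronglyMeasurable_positivePart :
    AEStronglyMeasurable (positivePart a N h) (volume.restrict (Set.Ioi T)) := by
  refine ContinuousOn.aestronglyMeasurable ?_ measurableSet_Ioi
  refine hc.sub (Continuous.continuousOn ?_)
  fun_prop

theorem differentiable_tsum_gammaTerm : Differentiable ℂ fun s => ∑' n, gammaTerm a s T n := by
  obtain ⟨C, hC, hb⟩ := exists_norm_positivePart_le hN hs
  simp only [(hasSum_gammaTerm hN hs hT _).tsum_eq]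
  refine (differentiable_mellinTail hT Real.two_pi_pos hC
    (aestronglyMeasurable_positivePart hc) hb).add ?_
  refine Differentiable.fun_sum fun n hn => ?_
  rw [Finset.mem_Ico] at hn
  exact differentiable_gammaTerm a hT.ne' ⟨n, by omega⟩

/-- Only the constant term needs Re s < 0: there the integral of t^(s-1) over (T, ∞) converges to
-T^s/s. Positive exponents converge, and the finitely many negative ones are regularized for every
s. -/
theorem hasRegIntegralAtInfinity_fourier {s : ℂ} (hre : s.re < 0) :
    HasRegIntegralAtInfinity (fun t : ℝ => h (I * t) * (t : ℂ) ^ (s - 1)) T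
      (-(a 0 * ((T : ℂ) ^ s / s)) + ∑' n, gammaTerm a s T n) := by
  obtain ⟨C, hC, hb⟩ := exists_norm_positivePart_le hN hs
  have h1 := HasRegIntegralAtInfinity.of_integrableOn
    (integrableOn_mellinTail hT Real.two_pi_pos hC (aestronglyMeasurable_positivePart hc) hb
      (s - 1)) hT.le
  have hre' : (s - 1).re < -1 := by
    rw [sub_re, one_re]; linarith
  have h2 := (HasRegIntegralAtInfinity.of_integrableOn
    (integrableOn_Ioi_cpow_of_lt hre' hT) hT.le).const_mul (a 0)
  rw [integral_Ioi_cpow_of_lt hre' hT, sub_add_cancel] at h2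
  have h3 := HasRegIntegralAtInfinity.sum (T := T) (s := Finset.Ico N 0)
    (g := fun (n : ℤ) (t : ℝ) => a n * (exp (-(((2 * π * n : ℝ) : ℂ) * t)) * (t : ℂ) ^ (s - 1)))
    (v := fun n => a n * (upperGamma s (2 * π * n * T) / ((2 * π * n : ℝ) : ℂ) ^ s))
    fun n hn => (hasRegIntegralAtInfinity_exp_mul_cpow s hT (by
      rw [Finset.mem_Ico] at hn
      exact mul_ne_zero (by positivity) (Int.cast_ne_zero.2 (by omega)))).const_mul (a n)
  have h4 := (h1.add h2).add h3
  convert h4 using 1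
  · funext t
    simp only [positivePart, ← mul_assoc, ← Finset.sum_mul, ← add_mul]
    congr 1
    ring
  · rw [(hasSum_gammaTerm hN hs hT s).tsum_eq]
    simp only [mul_div_assoc]
    ring

end FourierMellin

end QMF

end

noncomputable section

namespace QMF

/-! ### Mellin transforms of polylogarithms -/

theorem exists_entire_hasFP_of_one_pole {G : ℂ → ℂ} {A B c : ℝ} (hA : 0 < A) (hAB : A < B)
    (hcB : c < B) (hGc : MeromorphicAt G c) (hGA : AnalyticAt ℂ G A)
    (hG : ∀ x : ℝ, A ≤ x → x ≠ c → AnalyticAt ℂ G x) :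
    ∃ v : ℂ → ℂ, Differentiable ℂ v ∧
      ∀ s : ℂ, HasFP (fun t : ℝ => G t * (t : ℂ) ^ (s - 1)) A B (v s) := by
  rcases lt_or_ge A c with h | h
  · exact exists_entire_hasFP hA h hcB hGc fun x hx hxc => hG x hx.1 hxc
  · refine exists_entire_hasFP_of_analyticAt hA hAB.le fun x hx => ?_
    rcases eq_or_ne x A with rfl | hxA
    · exact hGA
    · exact hG x hx.1 fun hxc => hxA (le_antisymm (hxc.trans_le h) hx.1)

theorem regularOrPole_polylogNeg_I_mul (m : ℕ) (α z : ℂ) :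
    RegularOrPole (fun z => polylogNeg m (e (I * z - α))) z := by
  refine RegularOrPole.comp_of_deriv_ne_zero (f := fun w => polylogNeg m (e w))
    (g := fun z => I * z - α) (regularOrPole_polylogNeg_e m _) (by fun_prop) ?_
  have h : HasDerivAt (fun z : ℂ => I * z - α) (I * 1) z :=
    ((hasDerivAt_id z).const_mul I).sub_const α
  rw [h.deriv, mul_one]
  exact I_ne_zero

theorem analyticAt_polylogNeg_I_mul (m : ℕ) {α z : ℂ} (h : e (I * z - α) ≠ 1) :
    AnalyticAt ℂ (fun z => polylogNeg m (e (I * z - α))) z :=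
  AnalyticAt.fun_comp (g := fun w => polylogNeg m (e w)) (f := fun z => I * z - α)
    (analyticAt_polylogNeg_e m h) (by fun_prop)

theorem e_I_mul_sub_ne_one {α : ℂ} (h1 : -1 < α.re) (h2 : α.re < 1) {t : ℝ}
    (h : α.re = 0 → t ≠ α.im) : e (I * t - α) ≠ 1 := by
  intro h0
  obtain ⟨n, hn⟩ := e_eq_one_iff.1 h0
  have hre : -α.re = n := by simpa using congrArg re hn
  have him : t - α.im = 0 := by simpa using congrArg im hn
  have hn0 : n = 0 := by
    have e1 : (-1 : ℝ) < n := by linarith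
    have e2 : (n : ℝ) < 1 := by linarith
    have e1' : (-1 : ℤ) < n := by exact_mod_cast e1
    have e2' : n < (1 : ℤ) := by exact_mod_cast e2
    omega
  rw [hn0, Int.cast_zero, neg_eq_zero] at hre
  exact h hre (sub_eq_zero.1 him)

theorem RegularOrPole.mul_cpow {G : ℂ → ℂ} {x : ℝ} (h : RegularOrPole G x) (hx : 0 < x) (s : ℂ) :
    RegularOrPole (fun z => G z * z ^ (s - 1)) x :=
  h.mul_of_ne_zero (analyticAt_id.cpow analyticAt_const (ofReal_mem_slitPlane' hx))
    fun h0 => ofReal_ne_zero.2 hx.ne' ((cpow_eq_zero_iff _ _).1 h0).1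

/-- On the imaginary axis the polylogarithm has at most the pole t = Im α, and it decays
exponentially. So G is an entire finite part plus an entire tail. The split is provided for all
large B, so that finitely many such terms can share one B. -/
theorem polylog_mellin (m : ℕ) {α : ℂ} {T : ℝ} (hT : 0 < T) (h1 : -1 < α.re) (h2 : α.re < 1)
    (hTα : e (I * T - α) ≠ 1) :
    Differentiable ℂ (fun s => G m s α T) ∧ ∀ᶠ B in atTop, ∃ w : ℂ → ℂ, Differentiable ℂ w ∧
      ∀ s : ℂ, HasFP (fun t : ℝ => polylogNeg m (e (I * t - α)) * (t : ℂ) ^ (s - 1)) T B (w s) ∧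
        HasRegIntegralAtInfinity
          (fun t : ℝ => polylogNeg m (e (I * t - α)) * (t : ℂ) ^ (s - 1)) B (G m s α T - w s) := by
  obtain ⟨C, r, hC, hr, hr1, hb⟩ := exists_norm_polylogNeg_le m
  have key : ∀ᶠ B in atTop, ∃ w v : ℂ → ℂ, Differentiable ℂ w ∧ Differentiable ℂ v ∧
      ∀ s : ℂ, HasFP (fun t : ℝ => polylogNeg m (e (I * t - α)) * (t : ℂ) ^ (s - 1)) T B (w s) ∧
        HasRegIntegralAtInfinity
          (fun t : ℝ => polylogNeg m (e (I * t - α)) * (t : ℂ) ^ (s - 1)) B (v s) := by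
    -- B is beyond the possible pole, and so large that e(it - α) stays within the radius r of the
    -- linear bound for t > B.
    filter_upwards [eventually_gt_atTop T, eventually_gt_atTop α.im,
      eventually_gt_atTop (α.im - Real.log r / (2 * π))] with B hTB hαB hB
    have hB0 : 0 < B := hT.trans hTB
    have hne : ∀ x : ℝ, x ≠ α.im → e (I * x - α) ≠ 1 := fun x hx =>
      e_I_mul_sub_ne_one h1 h2 fun _ => hx
    have hnorm : ∀ t : ℝ, ‖e (I * t - α)‖ = Real.exp (2 * π * α.im) * Real.exp (-(2 * π) * t) := by
      intro t
      rw [norm_e, ← Real.exp_add]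
      congr 1
      simp
      ring
    have hbt : ∀ t : ℝ, B < t → ‖polylogNeg m (e (I * t - α))‖ ≤
        C * Real.exp (2 * π * α.im) * Real.exp (-(2 * π) * t) := by
      intro t ht
      rw [mul_assoc, ← hnorm]
      refine hb _ ?_
      rw [norm_e, ← Real.lt_log_iff_exp_lt hr]
      have h3 : α.im - Real.log r / (2 * π) < t := hB.trans ht
      have h4 : Real.log r / (2 * π) * (2 * π) = Real.log r := by field_simp
      have h5 : (I * t - α).im = t - α.im := by simp
      rw [h5]
      nlinarith [Real.pi_pos]
    have hmeas : AEStronglyMeasurable (fun t : ℝ => polylogNeg m (e (I * t - α)))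
        (volume.restrict (Set.Ioi B)) := by
      refine ContinuousOn.aestronglyMeasurable (fun t ht => ?_) measurableSet_Ioi
      have h3 := (analyticAt_polylogNeg_I_mul m (hne t (hαB.trans ht).ne')).continuousAt
      exact (ContinuousAt.comp (f := fun t : ℝ => (t : ℂ)) h3
        continuous_ofReal.continuousAt).continuousWithinAt
    obtain ⟨w, hw, hwFP⟩ := exists_entire_hasFP_of_one_pole
      (G := fun z => polylogNeg m (e (I * z - α))) hT hTB hαB
      (regularOrPole_polylogNeg_I_mul m α _).meromorphicAt
      (analyticAt_polylogNeg_I_mul m hTα)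
      fun x _ hx => analyticAt_polylogNeg_I_mul m (hne x hx)
    refine ⟨w, _, hw, differentiable_mellinTail hB0 Real.two_pi_pos (by positivity) hmeas hbt,
      fun s => ⟨hwFP s, ?_⟩⟩
    exact HasRegIntegralAtInfinity.of_integrableOn
      (integrableOn_mellinTail hB0 Real.two_pi_pos (by positivity) hmeas hbt (s - 1)) hB0.le
  have hG : ∀ {B : ℝ} {s w v : ℂ},
      HasFP (fun t : ℝ => polylogNeg m (e (I * t - α)) * (t : ℂ) ^ (s - 1)) T B w →
      HasRegIntegralAtInfinity
          (fun t : ℝ => polylogNeg m (e (I * t - α)) * (t : ℂ) ^ (s - 1)) B v →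
      G m s α T = w + v := by
    intro B s w v hw hv
    exact regIntegralIoi_eq
      (G := fun z => polylogNeg m (e (I * z - α)) * z ^ (s - 1))
      (fun x hx => (regularOrPole_polylogNeg_I_mul m α x).mul_cpow (hT.trans_le hx) s)
      (hw.hasRegIntegralIoi hv)
  refine ⟨?_, ?_⟩
  · obtain ⟨B, w, v, hw, hv, h⟩ := key.exists
    rw [funext fun s => hG (h s).1 (h s).2]
    exact hw.add hv
  · filter_upwards [key] with B ⟨w, v, hw, hv, h⟩
    refine ⟨w, hw, fun s => ⟨(h s).1, ?_⟩⟩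
    rw [hG (h s).1 (h s).2, add_sub_cancel_left]
    exact (h s).2

/-! ### The Mellin transform over a half-line -/

/-- The contribution of the half-line `(T, ∞)` to the completed `L`-function. -/
def halfLineMellin (g : ℂ → ℂ) (T : ℝ) (s : ℂ) : ℂ :=
  poleTerm g s T - tildeCoeff g T 0 * ((T : ℂ) ^ s / s) +
    ∑' n, gammaTerm (tildeCoeff g T) s T n

namespace IsPeriodicMeromorphic

variable {g : ℂ → ℂ} (hg : IsPeriodicMeromorphic g) {T : ℝ}

include hg

theorem poleTerm_eq (hT : 0 < T) (s : ℂ) : poleTerm g s T =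
    ∑ α ∈ (hg.finite_stripPoles hT).toFinset, ∑ m ∈ Finset.Icc 1 (poleOrder g α),
      (-2 * π * I) ^ m / ((m - 1).factorial : ℂ) * polarCoeff g α m * G (m - 1) s α T := by
  rw [poleTerm, finsum_mem_eq_finite_toFinset_sum]

omit hg in
theorem _root_.QMF.strip_bounds {α : ℂ} (hα : α ∈ stripPoles g T) : -1 < α.re ∧ α.re < 1 :=
  ⟨by linarith [hα.1], by linarith [hα.2.1]⟩

omit hg in
theorem _root_.QMF.stripPoles_e_ne_one (hpole : poleOrder g (I * T) = 0) {α : ℂ}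
    (hα : α ∈ stripPoles g T) : e (I * T - α) ≠ 1 := by
  refine e_I_mul_sub_ne_one (strip_bounds hα).1 (strip_bounds hα).2 fun hre hT => ?_
  have h1 : α = I * T := by apply Complex.ext <;> simp [hre, hT]
  have := hα.2.2.2
  rw [h1, hpole] at this
  exact lt_irrefl _ this

theorem differentiable_poleTerm (hT : 0 < T) (hpole : poleOrder g (I * T) = 0) :
    Differentiable ℂ fun s => poleTerm g s T := by
  simp only [hg.poleTerm_eq hT]
  refine Differentiable.fun_sum fun α hα => Differentiable.fun_sum fun m _ => ?_
  rw [Set.Finite.mem_toFinset] at hα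
  exact (polylog_mellin (m - 1) hT (strip_bounds hα).1 (strip_bounds hα).2
    (stripPoles_e_ne_one hpole hα)).1.const_mul _

omit hg in
theorem continuousOn_comp_I_mul {h : ℂ → ℂ} (hh : ∀ t : ℝ, T ≤ t → AnalyticAt ℂ h (I * t)) :
    ContinuousOn (fun t : ℝ => h (I * t)) (Set.Ioi T) := fun t ht =>
  (ContinuousAt.comp (f := fun t : ℝ => I * (t : ℂ)) (hh t (le_of_lt ht)).continuousAt
    (by fun_prop)).continuousWithinAt

theorem summable_gammaTerm (hT : 0 < T) (s : ℂ) : Summable (gammaTerm (tildeCoeff g T) s T) := by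
  obtain ⟨h, T', N, hT', -, hloc, hN, hsum⟩ := hg.exists_fourier hT
  exact (hasSum_gammaTerm hN (fun t ht => hsum (I * t) (by simpa using hT'.trans_le ht)) hT
    s).summable

theorem differentiable_tsum_gammaTerm (hT : 0 < T) :
    Differentiable ℂ fun s => ∑' n, gammaTerm (tildeCoeff g T) s T n := by
  obtain ⟨h, T', N, hT', -, hloc, hN, hsum⟩ := hg.exists_fourier hT
  have him : ∀ t : ℝ, T ≤ t → T' < (I * t).im := fun t ht => by simpa using hT'.trans_le ht
  exact QMF.differentiable_tsum_gammaTerm hN (fun t ht => hsum (I * t) (him t ht)) hT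
    (continuousOn_comp_I_mul fun t ht => (hloc _ (him t ht)).1)

/-- All constituents are entire except T^s/s, which is multiplied by the constant coefficient and is
harmless if that is zero. -/
theorem analyticAt_halfLineMellin (hT : 0 < T) (hpole : poleOrder g (I * T) = 0) {s : ℂ}
    (hs : s = 0 → tildeCoeff g T 0 = 0) : AnalyticAt ℂ (halfLineMellin g T) s := by
  have hT0 : (T : ℂ) ≠ 0 := ofReal_ne_zero.2 hT.ne'
  have hTs : Differentiable ℂ fun s : ℂ => (T : ℂ) ^ s := fun s =>
    differentiableAt_id.const_cpow (Or.inl hT0)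
  refine (((hg.differentiable_poleTerm hT hpole).analyticAt s).sub ?_).add
    ((hg.differentiable_tsum_gammaTerm hT).analyticAt s)
  by_cases h0 : tildeCoeff g T 0 = 0
  · simp only [h0, zero_mul]
    exact analyticAt_const
  · exact analyticAt_const.mul ((hTs.analyticAt s).div analyticAt_id fun h => h0 (hs h))

theorem meromorphicOn_halfLineMellin (hT : 0 < T) (hpole : poleOrder g (I * T) = 0) :
    MeromorphicOn (halfLineMellin g T) Set.univ := by
  intro s _
  have hT0 : (T : ℂ) ≠ 0 := ofReal_ne_zero.2 hT.ne'
  have hTs : Differentiable ℂ fun s : ℂ => (T : ℂ) ^ s := fun s =>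
    differentiableAt_id.const_cpow (Or.inl hT0)
  refine MeromorphicAt.fun_add (MeromorphicAt.fun_sub
    ((hg.differentiable_poleTerm hT hpole).analyticAt s).meromorphicAt ?_)
    ((hg.differentiable_tsum_gammaTerm hT).analyticAt s).meromorphicAt
  exact (MeromorphicAt.const _ _).fun_mul
    ((hTs.analyticAt s).meromorphicAt.fun_div (MeromorphicAt.id s))

/-- On the imaginary axis, `g` in normal form is the sum of its pole parts and the regular part,
off the poles. -/
theorem toMeromorphicNFOn_eq (hT : 0 < T) {h : ℂ → ℂ} {τ : ℂ} (hτ : τ ∈ upperHalf)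
    (hha : AnalyticAt ℂ h τ) (hhe : removePoles g T =ᶠ[𝓝[≠] τ] h)
    (hα : ∀ α ∈ stripPoles g T, e (τ - α) ≠ 1) :
    AnalyticAt ℂ (toMeromorphicNFOn g upperHalf) τ ∧ toMeromorphicNFOn g upperHalf τ =
      ∑ α ∈ (hg.finite_stripPoles hT).toFinset, polePart g α τ + h τ := by
  set S := (hg.finite_stripPoles hT).toFinset with hS
  have hR : AnalyticAt ℂ (fun z => ∑ α ∈ S, polePart g α z + h z) τ := by
    refine (Finset.analyticAt_fun_sum _ fun α hαS => analyticAt_polePart g fun n hn => ?_).add hha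
    rw [hS, Set.Finite.mem_toFinset] at hαS
    exact hα α hαS (e_eq_one_iff.2 ⟨n, hn⟩)
  have he : toMeromorphicNFOn g upperHalf =ᶠ[𝓝[≠] τ] fun z => ∑ α ∈ S, polePart g α z + h z := by
    filter_upwards [hg.meromorphic.toMeromorphicNFOn_eq_self_on_nhdsNE hτ, hhe] with z h1 h2
    rw [h1, ← h2, hg.removePoles_eq hT, add_sub_cancel]
  have ha : AnalyticAt ℂ (toMeromorphicNFOn g upperHalf) τ := by
    refine (meromorphicNFOn_toMeromorphicNFOn _ _
      hτ).meromorphicOrderAt_nonneg_iff_analyticAt.1 ?_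
    rw [meromorphicOrderAt_congr he]
    exact hR.meromorphicOrderAt_nonneg
  exact ⟨ha, eq_of_eventuallyEq_nhdsNE ha hR he⟩

/-- Sum of the polylogarithm integrals and the Fourier integral, each split at a common large B. The
finite part u is entire; the tail is known for Re s < 0, and there it equals the meromorphic
function `halfLineMellin` minus u. The normal form of g is used so that non-analytic points are
genuine poles. -/
theorem mellin_halfLine (hT : 0 < T) (hpole : poleOrder g (I * T) = 0) :
    ∀ᶠ B in atTop, T < B ∧ (∀ t : ℝ, B ≤ t → AnalyticAt ℂ (toMeromorphicNFOn g upperHalf) (I * t)) ∧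
      ∃ u : ℂ → ℂ, Differentiable ℂ u ∧
      (∀ s : ℂ, HasFP (fun t : ℝ => toMeromorphicNFOn g upperHalf (I * t) * (t : ℂ) ^ (s - 1))
        T B (u s)) ∧
      ∀ s : ℂ, s.re < 0 → HasRegIntegralAtInfinity
        (fun t : ℝ => toMeromorphicNFOn g upperHalf (I * t) * (t : ℂ) ^ (s - 1)) B
        (halfLineMellin g T s - u s) := by
  obtain ⟨h, T', N, hT', hT'0, hloc, hN, hsum⟩ := hg.exists_fourier hT
  set S := (hg.finite_stripPoles hT).toFinset with hS
  have hmemS : ∀ α ∈ S, α ∈ stripPoles g T := fun α hα => by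
    rwa [hS, Set.Finite.mem_toFinset] at hα
  have him : ∀ t : ℝ, T ≤ t → T' < (I * t).im := fun t ht => by simpa using hT'.trans_le ht
  have hha : ∀ t : ℝ, T ≤ t → AnalyticAt ℂ h (I * t) := fun t ht => (hloc _ (him t ht)).1
  have hcont := continuousOn_comp_I_mul hha
  -- Only poles α with Re α = 0 can make a pole part singular on the imaginary axis, as -1 < Re α <
  -- 1.
  set E : Finset ℝ := (S.filter fun α => α.re = 0).image im with hE
  have hTE : T ∉ E := by
    rw [hE, Finset.mem_image]
    rintro ⟨α, hα, rfl⟩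
    rw [Finset.mem_filter] at hα
    refine stripPoles_e_ne_one hpole (hmemS α hα.1) (e_eq_one_iff.2 ⟨0, ?_⟩)
    apply Complex.ext <;> simp [hα.2]
  have hEne : ∀ t : ℝ, t ∉ E → ∀ α ∈ stripPoles g T, e (I * t - α) ≠ 1 := by
    intro t ht α hα
    refine e_I_mul_sub_ne_one (strip_bounds hα).1 (strip_bounds hα).2 fun h0 h1 => ht ?_
    rw [hE, Finset.mem_image]
    exact ⟨α, Finset.mem_filter.2 ⟨(hg.finite_stripPoles hT).mem_toFinset.2 hα, h0⟩, h1.symm⟩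
  have heq : ∀ t : ℝ, T ≤ t → t ∉ E → AnalyticAt ℂ (toMeromorphicNFOn g upperHalf) (I * t) ∧
      toMeromorphicNFOn g upperHalf (I * t) = ∑ α ∈ S, polePart g α (I * t) + h (I * t) :=
    fun t ht htE => hg.toMeromorphicNFOn_eq hT (by
      simpa [upperHalf] using hT.trans_le ht) (hha t ht) (hloc _ (him t ht)).2 (hEne t htE)
  have hpoly : ∀ᶠ B in atTop, ∀ α ∈ S, ∀ m ∈ Finset.Icc 1 (poleOrder g α),
      ∃ w : ℂ → ℂ, Differentiable ℂ w ∧ ∀ s : ℂ,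
        HasFP (fun t : ℝ => polylogNeg (m - 1) (e (I * t - α)) * (t : ℂ) ^ (s - 1)) T B (w s) ∧
        HasRegIntegralAtInfinity
          (fun t : ℝ => polylogNeg (m - 1) (e (I * t - α)) * (t : ℂ) ^ (s - 1)) B
          (G (m - 1) s α T - w s) := by
    refine (Finset.eventually_all _).2 fun α hα => (Finset.eventually_all _).2 fun m _ => ?_
    exact (polylog_mellin (m - 1) hT (strip_bounds (hmemS α hα)).1 (strip_bounds (hmemS α hα)).2
      (stripPoles_e_ne_one hpole (hmemS α hα))).2
  have hEB : ∀ᶠ B in atTop, ∀ x ∈ E, x < B :=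
    (Finset.eventually_all _).2 fun x _ => eventually_gt_atTop x
  filter_upwards [hpoly, hEB, eventually_gt_atTop T] with B hB hBE hTB
  have hBE' : ∀ t : ℝ, B ≤ t → t ∉ E := fun t ht h0 => (hBE t h0).not_ge ht
  refine ⟨hTB, fun t ht => (heq t (hTB.le.trans ht) (hBE' t ht)).1, ?_⟩
  choose! w hwd hw using hB
  set c : ℂ → ℕ → ℂ := fun α m =>
    (-2 * π * I) ^ m / ((m - 1).factorial : ℂ) * polarCoeff g α m with hc
  set H : ℂ → ℂ := fun s => ∫ t in T..B, h (I * t) * (t : ℂ) ^ (s - 1) with hH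
  have hhI : ∀ t ∈ Set.Icc T B, AnalyticAt ℂ (fun z => h (I * z)) (t : ℂ) := fun t ht =>
    AnalyticAt.fun_comp (g := h) (f := fun z => I * z) (hha t ht.1) (by fun_prop)
  have hHd : Differentiable ℂ H := by
    refine differentiable_integral_mul_cpow hTB.le (fun t ht => ?_) (by fun_prop)
      fun t ht => ofReal_mem_slitPlane' (hT.trans_le ht.1)
    exact (ContinuousAt.comp (f := fun t : ℝ => (t : ℂ)) (hhI t ht).continuousAt
      continuous_ofReal.continuousAt).continuousWithinAt
  have hHFP : ∀ s, HasFP (fun t : ℝ => h (I * t) * (t : ℂ) ^ (s - 1)) T B (H s) := fun s =>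
    hasFP_integral (G := fun z => h (I * z) * z ^ (s - 1)) hTB.le fun t ht =>
      analyticAt_mul_cpow (hhI t ht) (ofReal_mem_slitPlane' (hT.trans_le ht.1)) s
  have hdecomp : ∀ (s : ℂ) (t : ℝ), T ≤ t → t ∉ E →
      ∑ α ∈ S, ∑ m ∈ Finset.Icc 1 (poleOrder g α),
        c α m * (polylogNeg (m - 1) (e (I * t - α)) * (t : ℂ) ^ (s - 1)) +
        h (I * t) * (t : ℂ) ^ (s - 1) =
      toMeromorphicNFOn g upperHalf (I * t) * (t : ℂ) ^ (s - 1) := by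
    intro s t ht htE
    rw [(heq t ht htE).2, add_mul]
    simp only [polePart, Finset.sum_mul, hc, mul_assoc]
  refine ⟨fun s => ∑ α ∈ S, ∑ m ∈ Finset.Icc 1 (poleOrder g α), c α m * w α m s + H s, ?_,
    fun s => ?_, fun s hs => ?_⟩
  · exact (Differentiable.fun_sum fun α hα => Differentiable.fun_sum fun m hm =>
      (hwd α hα m hm).const_mul _).add hHd
  · refine HasFP.congr (HasFP.add (HasFP.sum S hTB.le fun α hα => HasFP.sum _ hTB.le fun m hm =>
      ((hw α hα m hm s).1.const_mul (c α m))) (hHFP s)) E hTE (hBE' B le_rfl)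
      fun t ht htE => hdecomp s t ht.1 htE
  · have h1 := (hasRegIntegralAtInfinity_fourier hN
      (fun t ht => hsum (I * t) (him t ht)) hT hcont hs).shift hTB.le
    have h2 := HasRegIntegralAtInfinity.sum S fun α hα =>
      HasRegIntegralAtInfinity.sum _ fun m hm => (hw α hα m hm s).2.const_mul (c α m)
    have h3 := (h2.add h1).congr_ae (g₂ := fun t : ℝ =>
      toMeromorphicNFOn g upperHalf (I * t) * (t : ℂ) ^ (s - 1)) (by
        filter_upwards [ae_restrict_mem measurableSet_Ioi] with t ht
        exact hdecomp s t (hTB.le.trans (le_of_lt ht)) (hBE' t (le_of_lt ht)))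
    convert h3 using 1
    rw [halfLineMellin, hg.poleTerm_eq hT]
    simp only [mul_sub, Finset.sum_sub_distrib, hc, hH, hS]
    ring

end IsPeriodicMeromorphic

end QMF

end

noncomputable section

namespace QMF

/-! ### Quasi-modular forms: periodicity and the inversion relation -/

namespace IsMeromorphicQuasimodular

variable {k : ℤ} {p : ℕ} {f : ℂ → ℂ} {F : ℕ → ℂ → ℂ} (hf : IsMeromorphicQuasimodular k p f F)

include hf

theorem eventuallyEq_component_zero {τ : ℂ} (hτ : τ ∈ upperHalf) : f =ᶠ[𝓝[≠] τ] F 0 := by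
  have h := (eventually_codiscreteWithin_iff isOpen_upperHalf).1 (hf.transform 1) τ hτ
  filter_upwards [h] with z hz
  rw [Finset.sum_range_succ'] at hz
  simpa using hz

theorem eventually_add_one {τ : ℂ} (hτ : τ ∈ upperHalf) : (fun z => f (z + 1)) =ᶠ[𝓝[≠] τ] f := by
  have h := (eventually_codiscreteWithin_iff isOpen_upperHalf).1
    (hf.transform ⟨!![1, 1; 0, 1], by simp [Matrix.det_fin_two]⟩) τ hτ
  filter_upwards [h, hf.eventuallyEq_component_zero hτ] with z hz hz0
  rw [Finset.sum_range_succ'] at hz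
  rw [hz0]
  simpa using hz

theorem eventually_inversion (d : ℕ) {τ : ℂ} (hτ : τ ∈ upperHalf) :
    ∀ᶠ z in 𝓝[≠] τ, (z + d) ^ (-k) * f (-1 / (z + d)) =
      ∑ r ∈ Finset.range (p + 1), F r z * (1 / (z + d)) ^ r := by
  have h := (eventually_codiscreteWithin_iff isOpen_upperHalf).1
    (hf.transform ⟨!![0, -1; 1, d], by simp [Matrix.det_fin_two]⟩) τ hτ
  filter_upwards [h] with z hz
  simpa using hz

/-- The matrix (0, -1; 1, d) at z + 1 and the matrix (0, -1; 1, d + 1) at z have the same left-hand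
side. So the differences F_r(z + 1) - F_r(z) are coefficients of a polynomial of degree at most p
vanishing at the p + 1 distinct points 1/(z + 1 + d), 0 ≤ d ≤ p. By Vandermonde they are zero. -/
theorem component_add_one {τ : ℂ} (hτ : τ ∈ upperHalf) :
    ∀ᶠ z in 𝓝[≠] τ, ∀ r ≤ p, F r (z + 1) = F r z := by
  have hτ1 : τ + 1 ∈ upperHalf := by simpa [upperHalf] using hτ
  have h1 : ∀ᶠ z in 𝓝[≠] τ, ∀ d ∈ Finset.range (p + 2), (z + d) ^ (-k) * f (-1 / (z + d)) =
      ∑ r ∈ Finset.range (p + 1), F r z * (1 / (z + d)) ^ r :=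
    (Finset.eventually_all _).2 fun d _ => hf.eventually_inversion d hτ
  have h2 : ∀ᶠ z in 𝓝[≠] τ, ∀ d ∈ Finset.range (p + 1),
      (z + 1 + d) ^ (-k) * f (-1 / (z + 1 + d)) =
      ∑ r ∈ Finset.range (p + 1), F r (z + 1) * (1 / (z + 1 + d)) ^ r :=
    (Finset.eventually_all _).2 fun d _ =>
      (tendsto_add_const_nhdsNE τ 1).eventually (hf.eventually_inversion d hτ1)
  filter_upwards [h1, h2] with z hz1 hz2 r hr
  have hv := Matrix.eq_zero_of_forall_index_sum_pow_mul_eq_zero (n := p + 1)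
    (f := fun j : Fin (p + 1) => 1 / (z + 1 + ((j : ℕ) : ℂ)))
    (v := fun i : Fin (p + 1) => F i (z + 1) - F i z) ?_ fun j => ?_
  · have := congrFun hv ⟨r, by omega⟩
    exact sub_eq_zero.1 this
  · intro i j hij
    simp only [one_div, inv_inj, add_right_inj, Nat.cast_inj] at hij
    exact Fin.ext hij
  · have e1 := hz2 j (Finset.mem_range.2 j.2)
    have e2 := hz1 (j + 1) (Finset.mem_range.2 (by omega))
    have e3 : z + ((j + 1 : ℕ) : ℂ) = z + 1 + ((j : ℕ) : ℂ) := by push_cast; ring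
    rw [e3, e1] at e2
    simp only [mul_sub, Finset.sum_sub_distrib]
    rw [Fin.sum_univ_eq_sum_range
        (fun i => (1 / (z + 1 + ((j : ℕ) : ℂ))) ^ i * F i (z + 1)) (p + 1),
      Fin.sum_univ_eq_sum_range (fun i => (1 / (z + 1 + ((j : ℕ) : ℂ))) ^ i * F i z) (p + 1),
      sub_eq_zero]
    simp only [mul_comm _ (F _ _), e2]

theorem component_isPeriodicMeromorphic {r : ℕ} (hr : r ≤ p) : IsPeriodicMeromorphic (F r) :=
  ⟨hf.component_meromorphic r hr, hf.component_atInfinity r hr, fun τ hτ => by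
    filter_upwards [hf.component_add_one hτ] with z hz using hz r hr⟩

theorem isPeriodicMeromorphic : IsPeriodicMeromorphic f := by
  refine ⟨hf.meromorphic, ?_, fun τ hτ => hf.eventually_add_one hτ⟩
  obtain ⟨φ, Y, hY, hφ, he⟩ := hf.component_atInfinity 0 (Nat.zero_le p)
  refine ⟨φ, Y, hY, hφ, ?_⟩
  have hopen : IsOpen {τ : ℂ | Y < τ.im} := isOpen_lt continuous_const continuous_im
  refine EventuallyEq.trans ((eventually_codiscreteWithin_iff hopen).2 fun τ hτ => ?_) he
  exact hf.eventuallyEq_component_zero (hY.trans hτ)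

end IsMeromorphicQuasimodular

/-- The hypotheses under which the Mellin transform of `f` is computed: `f` and the `Q r` are
periodic meromorphic functions, and `f (-1/τ) = ∑ Q r τ * τ ^ (k - r)`. -/
structure InversionData (k : ℤ) (p : ℕ) (f : ℂ → ℂ) (Q : ℕ → ℂ → ℂ) : Prop where
  periodic : IsPeriodicMeromorphic f
  component : ∀ r ∈ Finset.range (p + 1), IsPeriodicMeromorphic (Q r)
  inversion : ∀ τ ∈ upperHalf, (fun z => f (-1 / z)) =ᶠ[𝓝[≠] τ]
    fun z => ∑ r ∈ Finset.range (p + 1), Q r z * z ^ (k - r)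

/-- The relation comes from S = (0, -1; 1, 0). The component of index 0 is replaced by f, with which
it agrees off a discrete set, since the final formula is stated with f. -/
theorem IsMeromorphicQuasimodular.inversionData {k : ℤ} {p : ℕ} {f : ℂ → ℂ} {F : ℕ → ℂ → ℂ}
    (hf : IsMeromorphicQuasimodular k p f F) :
    InversionData k p f fun r => if r = 0 then f else F r := by
  refine ⟨hf.isPeriodicMeromorphic, fun r hr => ?_, fun τ hτ => ?_⟩
  · split_ifs with h
    · exact hf.isPeriodicMeromorphic
    · exact hf.component_isPeriodicMeromorphic (by rw [Finset.mem_range] at hr; omega)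
  · filter_upwards [hf.eventually_inversion 0 hτ, hf.eventuallyEq_component_zero hτ,
      mem_nhdsWithin_of_mem_nhds (isOpen_upperHalf.mem_nhds hτ)] with z hz hz0 hzU
    have hzne : z ≠ 0 := by
      rintro rfl
      simp [upperHalf] at hzU
    have hzk : z ^ k ≠ 0 := zpow_ne_zero _ hzne
    simp only [Nat.cast_zero, add_zero] at hz
    have h1 : f (-1 / z) = z ^ k * (z ^ (-k) * f (-1 / z)) := by
      rw [zpow_neg, mul_inv_cancel_left₀ hzk]
    rw [h1, hz, Finset.mul_sum]
    refine Finset.sum_congr rfl fun r _ => ?_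
    rw [zpow_sub₀ hzne, zpow_natCast, one_div, inv_pow, div_eq_mul_inv]
    split_ifs with h
    · rw [h, hz0]; ring
    · ring

theorem neg_one_div_mem_upperHalf {τ : ℂ} (hτ : τ ∈ upperHalf) : -1 / τ ∈ upperHalf := by
  have h0 : τ ≠ 0 := by
    rintro rfl
    simp [upperHalf] at hτ
  have hτ' : 0 < τ.im := hτ
  have h1 : 0 < normSq τ := normSq_pos.2 h0
  change 0 < (-1 / τ).im
  rw [div_eq_mul_inv, neg_one_mul, neg_im, inv_im, neg_div, neg_neg]
  positivity

theorem hasDerivAt_neg_one_div {τ : ℂ} (hτ : τ ≠ 0) :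
    HasDerivAt (fun z : ℂ => -1 / z) (1 / τ ^ 2) τ := by
  have := (hasDerivAt_inv hτ).const_mul (-1)
  refine (this.congr_deriv (by ring)).congr_of_eventuallyEq ?_
  filter_upwards with z
  rw [div_eq_mul_inv]

theorem tendsto_neg_one_div {τ : ℂ} (hτ : τ ≠ 0) :
    Tendsto (fun z : ℂ => -1 / z) (𝓝[≠] τ) (𝓝[≠] (-1 / τ)) := by
  refine tendsto_nhdsWithin_of_tendsto_nhds_of_eventually_within _
    ((hasDerivAt_neg_one_div hτ).continuousAt.tendsto.mono_left nhdsWithin_le_nhds) ?_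
  filter_upwards [self_mem_nhdsWithin] with z hz h
  have h' : -1 / z = -1 / τ := h
  rw [div_eq_mul_inv, div_eq_mul_inv, mul_right_inj' (by norm_num), inv_inj] at h'
  exact hz h'

namespace InversionData

variable {k : ℤ} {p : ℕ} {f : ℂ → ℂ} {Q : ℕ → ℂ → ℂ} (hf : InversionData k p f Q)

include hf

/-- The inversion relation holds exactly for functions in normal form, where the right-hand side
is analytic. -/
theorem toMeromorphicNFOn_inversion {τ : ℂ} (hτ : τ ∈ upperHalf)
    (hQ : ∀ r ∈ Finset.range (p + 1), AnalyticAt ℂ (toMeromorphicNFOn (Q r) upperHalf) τ) :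
    AnalyticAt ℂ (toMeromorphicNFOn f upperHalf) (-1 / τ) ∧
      toMeromorphicNFOn f upperHalf (-1 / τ) =
        ∑ r ∈ Finset.range (p + 1), toMeromorphicNFOn (Q r) upperHalf τ * τ ^ (k - r) := by
  have h0 : τ ≠ 0 := by
    rintro rfl
    simp [upperHalf] at hτ
  set fh := toMeromorphicNFOn f upperHalf with hfh
  have hRa : AnalyticAt ℂ (fun z => ∑ r ∈ Finset.range (p + 1),
      toMeromorphicNFOn (Q r) upperHalf z * z ^ (k - r)) τ :=
    Finset.analyticAt_fun_sum _ fun r hr => (hQ r hr).mul (analyticAt_id.zpow h0)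
  have hall : ∀ᶠ z in 𝓝[≠] τ, ∀ r ∈ Finset.range (p + 1),
      toMeromorphicNFOn (Q r) upperHalf z = Q r z :=
    (Finset.eventually_all _).2 fun r hr =>
      (hf.component r hr).meromorphic.toMeromorphicNFOn_eq_self_on_nhdsNE hτ
  have he : (fun z => fh (-1 / z)) =ᶠ[𝓝[≠] τ] fun z => ∑ r ∈ Finset.range (p + 1),
      toMeromorphicNFOn (Q r) upperHalf z * z ^ (k - r) := by
    filter_upwards [hf.inversion τ hτ, hall, (tendsto_neg_one_div h0).eventually
      (hf.periodic.meromorphic.toMeromorphicNFOn_eq_self_on_nhdsNE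
        (neg_one_div_mem_upperHalf hτ))] with z h1 h2 h3
    rw [hfh, h3, h1]
    exact Finset.sum_congr rfl fun r hr => by rw [h2 r hr]
  have hga : AnalyticAt ℂ (fun z : ℂ => -1 / z) τ := analyticAt_const.div analyticAt_id h0
  have ha : AnalyticAt ℂ fh (-1 / τ) := by
    refine (meromorphicNFOn_toMeromorphicNFOn f upperHalf
      (neg_one_div_mem_upperHalf hτ)).meromorphicOrderAt_nonneg_iff_analyticAt.1 ?_
    have h1 := meromorphicOrderAt_comp_of_deriv_ne_zero (f := fh) hga
      (by rw [(hasDerivAt_neg_one_div h0).deriv]; exact div_ne_zero one_ne_zero (pow_ne_zero 2 h0))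
    rw [← hfh, ← h1]
    change 0 ≤ meromorphicOrderAt (fun z => fh (-1 / z)) τ
    rw [meromorphicOrderAt_congr he]
    exact hRa.meromorphicOrderAt_nonneg
  exact ⟨ha, eq_of_eventuallyEq_nhdsNE (f := fun z => fh (-1 / z)) (ha.fun_comp hga) hRa he⟩

theorem inversion_I_mul {t : ℝ} (ht : 0 < t)
    (hQ : ∀ r ∈ Finset.range (p + 1), AnalyticAt ℂ (toMeromorphicNFOn (Q r) upperHalf) (I * t)) :
    AnalyticAt ℂ (toMeromorphicNFOn f upperHalf) (I * ((1 / t : ℝ) : ℂ)) ∧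
      toMeromorphicNFOn f upperHalf (I * ((1 / t : ℝ) : ℂ)) =
        ∑ r ∈ Finset.range (p + 1), toMeromorphicNFOn (Q r) upperHalf (I * t) *
          (I * t) ^ (k - r) := by
  have h1 : -1 / (I * t) = I * ((1 / t : ℝ) : ℂ) := by
    have ht0 : (t : ℂ) ≠ 0 := ofReal_ne_zero.2 ht.ne'
    push_cast
    field_simp
    rw [I_sq]
  rw [← h1]
  exact hf.toMeromorphicNFOn_inversion (by simpa [upperHalf] using ht) hQ

/-- The integrand near `0`, reflected. -/
theorem reflected_integrand {t : ℝ} (ht : 0 < t)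
    (hQ : ∀ r ∈ Finset.range (p + 1), AnalyticAt ℂ (toMeromorphicNFOn (Q r) upperHalf) (I * t))
    (s : ℂ) :
    (1 / (t : ℂ) ^ 2) * (toMeromorphicNFOn f upperHalf (I * ((1 / t : ℝ) : ℂ)) *
        ((1 / t : ℝ) : ℂ) ^ (s - 1)) =
      ∑ r ∈ Finset.range (p + 1), I ^ (k - r) *
        (toMeromorphicNFOn (Q r) upperHalf (I * t) * (t : ℂ) ^ ((k - r - s) - 1)) := by
  have ht0 : (t : ℂ) ≠ 0 := ofReal_ne_zero.2 ht.ne'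
  have harg : (t : ℂ).arg ≠ π := by
    rw [arg_ofReal_of_nonneg ht.le]
    exact Real.pi_pos.ne
  rw [(hf.inversion_I_mul ht hQ).2, Finset.sum_mul, Finset.mul_sum]
  refine Finset.sum_congr rfl fun r _ => ?_
  have h1 : (t : ℂ) ^ ((k - r - s) - 1 : ℂ) =
      (t : ℂ) ^ (k - r : ℤ) * ((t : ℂ) ^ (s - 1))⁻¹ * ((t : ℂ) ^ 2)⁻¹ := by
    have : (k - r - s - 1 : ℂ) = ((k - r : ℤ) : ℂ) + -(s - 1) + -(2 : ℕ) := by push_cast; ring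
    rw [this, cpow_add _ _ ht0, cpow_add _ _ ht0, cpow_intCast, cpow_neg, cpow_neg, cpow_natCast]
  rw [h1, mul_zpow, one_div t, ofReal_inv, inv_cpow _ _ harg]
  ring

end InversionData

end QMF

end

noncomputable section

namespace QMF

/-! ### Existence and uniqueness of the completed `L`-function -/

theorem ae_Ioi_of_forall_nhdsNE {P : ℝ → Prop} {T : ℝ} (h : ∀ t, T < t → ∀ᶠ y in 𝓝[≠] t, P y) :
    ∀ᵐ t ∂volume.restrict (Set.Ioi T), P t := by
  refine ae_restrict_le_codiscreteWithin measurableSet_Ioi ?_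
  change {t | P t} ∈ codiscreteWithin (Set.Ioi T)
  rw [mem_codiscreteWithin]
  intro t ht
  rw [disjoint_principal_right]
  filter_upwards [h t ht] with y hy hcon
  exact hcon.2 hy

theorem tendsto_I_mul_ofReal (t : ℝ) :
    Tendsto (fun y : ℝ => I * (y : ℂ)) (𝓝[≠] t) (𝓝[≠] (I * t)) := by
  refine tendsto_nhdsWithin_of_tendsto_nhds_of_eventually_within _ ?_ ?_
  · exact (Continuous.tendsto (by fun_prop) t).mono_left nhdsWithin_le_nhds
  · filter_upwards [self_mem_nhdsWithin] with y hy
    simpa using hy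

theorem tendsto_one_div_nhdsNE {t : ℝ} (ht : t ≠ 0) :
    Tendsto (fun y : ℝ => 1 / y) (𝓝[≠] t) (𝓝[≠] (1 / t)) := by
  refine tendsto_nhdsWithin_of_tendsto_nhds_of_eventually_within _ ?_ ?_
  · have : ContinuousAt (fun y : ℝ => 1 / y) t := continuousAt_const.div continuousAt_id ht
    exact this.tendsto.mono_left nhdsWithin_le_nhds
  · filter_upwards [self_mem_nhdsWithin] with y hy
    simpa using hy

/-- All integrals involved depend only on almost-everywhere classes. The main use is the passage
between f and its normal form, for which every point is regular or a pole. -/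
theorem IsCompletedL.congr {f g Λ : ℂ → ℂ} (hL : IsCompletedL f Λ)
    (h : ∀ t : ℝ, 0 < t → f =ᶠ[𝓝[≠] (I * t)] g) : IsCompletedL g Λ := by
  obtain ⟨hNF, n, a, c, A, B, H, σ, ha0, hA, hB, hzero, hinf, hHad, hΛ⟩ := hL
  have hpos : ∀ i ≤ n, 0 < a i := fun i hi => ha0.trans_le
    (breakpoints_le (fun i hi => (hHad i hi 0).1.trans (hHad i hi 0).2.1) (Nat.zero_le i) hi)
  have hloc : ∀ t : ℝ, 0 < t → ∀ᶠ y : ℝ in 𝓝[≠] t, f (I * y) = g (I * y) := fun t ht =>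
    (tendsto_I_mul_ofReal t).eventually (h t ht)
  have hae := ae_Ioi_of_forall_nhdsNE hloc
  have hae' : ∀ᵐ t : ℝ ∂volume.restrict (Set.Ioi 0),
      f (I * ((1 / t : ℝ) : ℂ)) = g (I * ((1 / t : ℝ) : ℂ)) :=
    ae_Ioi_of_forall_nhdsNE fun t ht =>
      (tendsto_one_div_nhdsNE ht.ne').eventually (hloc (1 / t) (one_div_pos.2 ht))
  have hsub : ∀ {T : ℝ}, 0 ≤ T → Set.Ioi T ⊆ Set.Ioi (0 : ℝ) := fun hT => Set.Ioi_subset_Ioi hT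
  refine ⟨hNF, n, a, c, A, B, H, σ, ha0, hA, hB, fun s hs => (hzero s hs).congr_ae ?_,
    fun s hs => (hinf s hs).congr_ae ?_, fun i hi s => (hHad i hi s).congr_ae ?_, hΛ⟩
  · filter_upwards [ae_restrict_of_ae_restrict_of_subset (hsub (inv_pos.2 ha0).le) hae'] with t ht
    rw [ht]
  · filter_upwards [ae_restrict_of_ae_restrict_of_subset (hsub (hpos n le_rfl).le) hae] with t ht
    rw [ht]
  · filter_upwards [ae_restrict_of_ae_restrict_of_subset
      (Set.Ioc_subset_Ioi_self.trans (hsub (hpos i hi.le).le)) hae] with t ht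
    rw [ht]

theorem analyticAt_of_mul {f g : ℂ → ℂ} {x : ℂ} (h : AnalyticAt ℂ (fun z => f z * g z) x)
    (hg : AnalyticAt ℂ g x) (h0 : g x ≠ 0) : AnalyticAt ℂ f x := by
  refine (h.mul (hg.inv h0)).congr ?_
  filter_upwards [hg.continuousAt.eventually_ne h0] with z hz
  simp only [Pi.mul_apply, Pi.inv_apply]
  field_simp

theorem analyticAt_cpow_sub_one {x : ℝ} (hx : 0 < x) (s : ℂ) :
    AnalyticAt ℂ (fun z : ℂ => z ^ (s - 1)) x :=
  analyticAt_id.cpow analyticAt_const (ofReal_mem_slitPlane' hx)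

theorem cpow_sub_one_ne_zero {x : ℝ} (hx : 0 < x) (s : ℂ) : (x : ℂ) ^ (s - 1) ≠ 0 := fun h0 =>
  ofReal_ne_zero.2 hx.ne' ((cpow_eq_zero_iff _ _).1 h0).1

/-! ### Reflection of Mellin integrands under t ↦ 1/t -/

section Reflection

variable {K : ℂ → ℂ}

/-- The integrand of a Mellin transform after the reflection `t ↦ 1/t`. -/
def reflectMellin (K : ℂ → ℂ) (s z : ℂ) : ℂ := 1 / z ^ 2 * (K (1 / z) * (1 / z) ^ (s - 1))

theorem reflectMellin_ofReal (K : ℂ → ℂ) (s : ℂ) (t : ℝ) : reflectMellin K s t =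
    1 / (t : ℂ) ^ 2 * (K ((1 / t : ℝ) : ℂ) * ((1 / t : ℝ) : ℂ) ^ (s - 1)) := by
  rw [reflectMellin]; push_cast; rfl

theorem analyticAt_one_div {y : ℝ} (hy : 0 < y) : AnalyticAt ℂ (fun z : ℂ => 1 / z) y :=
  analyticAt_const.div analyticAt_id (ofReal_ne_zero.2 hy.ne')

theorem analyticAt_reflectFactor {y : ℝ} (hy : 0 < y) (s : ℂ) :
    AnalyticAt ℂ (fun z : ℂ => 1 / z ^ 2 * (1 / z) ^ (s - 1)) y := by
  have hy0 : (y : ℂ) ≠ 0 := ofReal_ne_zero.2 hy.ne'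
  refine (analyticAt_const.div (analyticAt_id.pow 2) (pow_ne_zero 2 hy0)).mul
    ((analyticAt_one_div hy).cpow analyticAt_const ?_)
  have := ofReal_mem_slitPlane' (one_div_pos.2 hy)
  rwa [ofReal_div, ofReal_one] at this

theorem reflectFactor_ne_zero {y : ℝ} (hy : 0 < y) (s : ℂ) :
    1 / (y : ℂ) ^ 2 * (1 / (y : ℂ)) ^ (s - 1) ≠ 0 := by
  have hy0 : (y : ℂ) ≠ 0 := ofReal_ne_zero.2 hy.ne'
  exact mul_ne_zero (one_div_ne_zero (pow_ne_zero 2 hy0)) fun h =>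
    one_div_ne_zero hy0 ((cpow_eq_zero_iff _ _).1 h).1

theorem reflectMellin_eq (K : ℂ → ℂ) (s : ℂ) : reflectMellin K s =
    fun z => K (1 / z) * (1 / z ^ 2 * (1 / z) ^ (s - 1)) := by
  funext z
  rw [reflectMellin]
  ring

theorem analyticAt_reflectMellin {y : ℝ} (hy : 0 < y) (s : ℂ)
    (hK : AnalyticAt ℂ K ((1 / y : ℝ) : ℂ)) : AnalyticAt ℂ (reflectMellin K s) y := by
  rw [reflectMellin_eq]
  rw [ofReal_div, ofReal_one] at hK
  exact (AnalyticAt.fun_comp (g := K) (f := fun z => 1 / z) hK (analyticAt_one_div hy)).mul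
    (analyticAt_reflectFactor hy s)

theorem regularOrPole_reflectMellin {y : ℝ} (hy : 0 < y) (s : ℂ)
    (hK : RegularOrPole K ((1 / y : ℝ) : ℂ)) : RegularOrPole (reflectMellin K s) y := by
  have hy0 : (y : ℂ) ≠ 0 := ofReal_ne_zero.2 hy.ne'
  rw [reflectMellin_eq]
  rw [ofReal_div, ofReal_one] at hK
  refine RegularOrPole.mul_of_ne_zero (RegularOrPole.comp_of_deriv_ne_zero (f := K)
    (g := fun z => 1 / z) hK (analyticAt_one_div hy) ?_) (analyticAt_reflectFactor hy s)
    (reflectFactor_ne_zero hy s)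
  simp only [one_div]
  rw [(hasDerivAt_inv hy0).deriv]
  exact neg_ne_zero.2 (inv_ne_zero (pow_ne_zero 2 hy0))

theorem analyticAt_of_reflectMellin {x : ℝ} (hx : 0 < x) (s : ℂ)
    (h : AnalyticAt ℂ (reflectMellin K s) ((1 / x : ℝ) : ℂ)) : AnalyticAt ℂ K x := by
  have hy : 0 < 1 / x := one_div_pos.2 hx
  rw [reflectMellin_eq] at h
  have h1 := analyticAt_of_mul (f := fun z => K (1 / z)) h (analyticAt_reflectFactor hy s)
    (reflectFactor_ne_zero hy s)
  rw [ofReal_div, ofReal_one] at h1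
  have h2 := AnalyticAt.fun_comp (g := fun z => K (1 / z)) (f := fun z => 1 / z) h1
    (analyticAt_one_div hx)
  simpa using h2

end Reflection

/-- The finite-part and regularized integrals which make up the Mellin transform of `K`:
`A₀`, `M` and `B₀` are the integrals over `(0, B⁻¹)`, `(B⁻¹, B)` and `(B, ∞)`. -/
structure MellinPieces (K : ℂ → ℂ) (B : ℝ) (A₀ M B₀ : ℂ → ℂ) (σ : ℝ) : Prop where
  pos : 0 < B
  meromorphic_zero : MeromorphicOn A₀ Set.univ
  meromorphic_infinity : MeromorphicOn B₀ Set.univ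
  analytic_zero : ∀ t : ℝ, 0 < t → t ≤ B⁻¹ → AnalyticAt ℂ K t
  analytic_infinity : ∀ t : ℝ, B ≤ t → AnalyticAt ℂ K t
  hasFP : ∀ s : ℂ, HasFP (fun t : ℝ => K t * (t : ℂ) ^ (s - 1)) B⁻¹ B (M s)
  zero : ∀ s : ℂ, σ < s.re →
    HasRegIntegralAtZero (fun t : ℝ => K t * (t : ℂ) ^ (s - 1)) B⁻¹ (A₀ s)
  infinity : ∀ s : ℂ, s.re < -σ →
    HasRegIntegralAtInfinity (fun t : ℝ => K t * (t : ℂ) ^ (s - 1)) B (B₀ s)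

theorem hasRegIntegralAtZero_iff {K : ℂ → ℂ} {s v : ℂ} {T : ℝ} :
    HasRegIntegralAtZero (fun t : ℝ => K t * (t : ℂ) ^ (s - 1)) T v ↔
      HasRegIntegralAtInfinity (fun t : ℝ => reflectMellin K s t) T⁻¹ v := by
  rw [HasRegIntegralAtZero, funext (reflectMellin_ofReal K s)]

/-- The definition requires break points independent of s. Those adapted to the poles of K serve
every K(z) z^(s-1), whose poles are among them; Λ is then the normal form of R. -/
theorem MellinPieces.exists_isCompletedL {f A₀ M B₀ R : ℂ → ℂ} {B σ : ℝ}
    (hK : ∀ x : ℝ, 0 < x → RegularOrPole (fun z => f (I * z)) x)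
    (h : MellinPieces (fun z => f (I * z)) B A₀ M B₀ σ) (hR : MeromorphicOn R Set.univ)
    (hsum : ∀ s, A₀ s + M s + B₀ s = R s) : ∃ Λ, IsCompletedL f Λ := by
  set K : ℂ → ℂ := fun z => f (I * z) with hKdef
  have hB0 := h.pos
  have hBi : 0 < B⁻¹ := inv_pos.2 hB0
  have hle : B⁻¹ ≤ B := (h.hasFP 0).1
  have hA : AnalyticAt ℂ K ((B⁻¹ : ℝ) : ℂ) := h.analytic_zero _ hBi le_rfl
  have hBa : AnalyticAt ℂ K (B : ℂ) := h.analytic_infinity _ le_rfl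
  have key : ∃ (n : ℕ) (a c : ℕ → ℝ) (H : ℕ → ℂ → ℂ), a 0 = B⁻¹ ∧ a n = B ∧
      (∀ i < n, ∀ s : ℂ, HasHadamardIntegral (fun t : ℝ => K t * (t : ℂ) ^ (s - 1))
        (a i) (c i) (a (i + 1)) (H i s)) ∧ ∀ s, ∑ i ∈ Finset.range n, H i s = M s := by
    obtain ⟨D, -, hD, -⟩ := exists_isFPPrim_poles (G := K) (A := B⁻¹) (B := B)
      fun x hx => hK x (hBi.trans_le hx.1)
    have hreg : ∀ s : ℂ, ∀ x ∈ Set.Icc B⁻¹ B, RegularOrPole (fun z => K z * z ^ (s - 1)) x :=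
      fun s x hx => (hK x (hBi.trans_le hx.1)).mul_cpow (hBi.trans_le hx.1) s
    choose Ds Φ hDs hΦ using fun s => exists_isFPPrim_poles (hreg s)
    have hsub : ∀ s, ∀ x ∈ Ds s, x ∈ D := fun s x hx => by
      have h1 := (hDs s x).1 hx
      refine (hD x).2 ⟨h1.1, fun h2 => h1.2 ?_⟩
      exact h2.mul (analyticAt_cpow_sub_one (hBi.trans_le h1.1.1) s)
    have hBD : B ∉ D := fun h0 => ((hD _).1 h0).2 hBa
    have hAD : B⁻¹ ∉ D := fun h0 => ((hD _).1 h0).2 hA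
    have htel : ∀ (s : ℂ), Φ s B - Φ s B⁻¹ = M s := fun s =>
      ((hΦ s).hasFP le_rfl hle le_rfl (fun h0 => hAD (hsub s _ h0))
        fun h0 => hBD (hsub s _ h0)).unique (h.hasFP s)
    rcases hle.eq_or_lt with heq | hlt
    · refine ⟨0, fun _ => B⁻¹, fun _ => 0, fun _ _ => 0, rfl, heq, by simp, fun s => ?_⟩
      rw [← htel s, Finset.sum_range_zero, heq, sub_self]
    · obtain ⟨n, a, c, ha0, han, hac, hDc⟩ := exists_breakpoints D hlt fun d hd => by
        have h1 := ((hD d).1 hd).1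
        exact ⟨h1.1.lt_of_ne fun h0 => hAD (h0 ▸ hd), h1.2.lt_of_ne fun h0 => hBD (h0 ▸ hd)⟩
      refine ⟨n, a, c, fun i s => Φ s (a (i + 1)) - Φ s (a i), ha0, han, fun i hi s => ?_,
        fun s => ?_⟩
      · exact (hΦ s).chain ha0.ge han.le hac (fun i hi d hd => hDc i hi d (hsub s d hd)) i hi
      · rw [Finset.sum_range_sub fun i => Φ s (a i), ha0, han, htel]
  obtain ⟨n, a, c, H, ha0, han, hH, hHM⟩ := key
  refine ⟨toMeromorphicNFOn R Set.univ, meromorphicNFOn_toMeromorphicNFOn _ _, n, a, c, A₀, B₀, H,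
    σ, ha0 ▸ hBi, h.meromorphic_zero, h.meromorphic_infinity, fun s hs => ?_, fun s hs => ?_, hH,
    ?_⟩
  · rw [ha0]; exact h.zero s hs
  · rw [han]; exact h.infinity s hs
  · have h1 : toMeromorphicNFOn R Set.univ =ᶠ[codiscrete ℂ] R :=
      (toMeromorphicNFOn_eqOn_codiscrete hR).symm
    filter_upwards [h1] with s hs
    rw [hs, hHM, hsum]

theorem MeromorphicOn.eventuallyEq_of_re_lt {A B : ℂ → ℂ} (hA : MeromorphicOn A Set.univ)
    (hB : MeromorphicOn B Set.univ) {σ : ℝ} (h : ∀ s : ℂ, σ < s.re → A s = B s) (y : ℂ) :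
    A =ᶠ[𝓝[≠] y] B := by
  refine MeromorphicOn.eventuallyEq_of_isPreconnected hA hB isPreconnected_univ
    (x := ((σ + 1 : ℝ) : ℂ)) (Set.mem_univ _) (Set.mem_univ _) ?_
  have h1 : {s : ℂ | σ < s.re} ∈ 𝓝 ((σ + 1 : ℝ) : ℂ) :=
    (isOpen_lt continuous_const continuous_re).mem_nhds (by simp)
  filter_upwards [mem_nhdsWithin_of_mem_nhds h1] with s hs using h s hs

theorem MeromorphicOn.eventuallyEq_of_lt_re {A B : ℂ → ℂ} (hA : MeromorphicOn A Set.univ)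
    (hB : MeromorphicOn B Set.univ) {σ : ℝ} (h : ∀ s : ℂ, s.re < σ → A s = B s) (y : ℂ) :
    A =ᶠ[𝓝[≠] y] B := by
  refine MeromorphicOn.eventuallyEq_of_isPreconnected hA hB isPreconnected_univ
    (x := ((σ - 1 : ℝ) : ℂ)) (Set.mem_univ _) (Set.mem_univ _) ?_
  have h1 : {s : ℂ | s.re < σ} ∈ 𝓝 ((σ - 1 : ℝ) : ℂ) :=
    (isOpen_lt continuous_re continuous_const).mem_nhds (by simp)
  filter_upwards [mem_nhdsWithin_of_mem_nhds h1] with s hs using h s hs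

/-- Uniqueness of Λ. Integrability makes K analytic on (0, a 0] and on [a n, ∞), so the outer
integrals can be moved to 1/B and B at the cost of entire functions v₀ and v₁. These cancel against
the difference of the compact parts. The end integrals are compared for Re s or -Re s large, then by
the identity theorem. -/
theorem IsCompletedL.eventuallyEq {f R Λ : ℂ → ℂ}
    (hK : ∀ x : ℝ, 0 < x → RegularOrPole (fun z => f (I * z)) x)
    (h : ∀ᶠ B in atTop, ∃ A₀ M B₀ σ, MellinPieces (fun z => f (I * z)) B A₀ M B₀ σ ∧
      ∀ s, A₀ s + M s + B₀ s = R s) (hL : IsCompletedL f Λ) (y : ℂ) : Λ =ᶠ[𝓝[≠] y] R := by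
  obtain ⟨-, n, a, c, A, B', H, σ, ha0, hA, hB', hzero, hinf, hHad, hΛ⟩ := hL
  set K : ℂ → ℂ := fun z => f (I * z) with hKdef
  have hmono : ∀ i < n, a i < a (i + 1) := fun i hi => (hHad i hi 0).1.trans (hHad i hi 0).2.1
  have h0n : a 0 ≤ a n := breakpoints_le hmono (Nat.zero_le n) le_rfl
  have han : 0 < a n := ha0.trans_le h0n
  have hreg : ∀ (s : ℂ) (x : ℝ), 0 < x → RegularOrPole (fun z => K z * z ^ (s - 1)) x :=
    fun s x hx => (hK x hx).mul_cpow hx s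
  have hKinf : ∀ x : ℝ, a n ≤ x → AnalyticAt ℂ K x := by
    intro x hx
    have hx0 := han.trans_le hx
    have h1 := hinf ((-σ - 1 : ℝ) : ℂ) (by rw [ofReal_re]; linarith)
    have h2 := HasRegIntegralAtInfinity.analyticAt
      (G := fun z => K z * z ^ (((-σ - 1 : ℝ) : ℂ) - 1)) h1 hx (hreg _ x hx0)
    exact analyticAt_of_mul h2 (analyticAt_cpow_sub_one hx0 _) (cpow_sub_one_ne_zero hx0 _)
  have hKzero : ∀ x : ℝ, 0 < x → x ≤ a 0 → AnalyticAt ℂ K x := by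
    intro x hx hxa
    have h1 := hzero ((σ + 1 : ℝ) : ℂ) (by rw [ofReal_re]; linarith)
    have h2 : HasRegIntegralAtInfinity
      (fun t : ℝ => reflectMellin K ((σ + 1 : ℝ) : ℂ) t) (a 0)⁻¹ _ := hasRegIntegralAtZero_iff.1 h1
    have hy : 0 < 1 / x := one_div_pos.2 hx
    refine analyticAt_of_reflectMellin hx _ (h2.analyticAt (x := 1 / x) ?_
      (regularOrPole_reflectMellin hy _ (hK _ (one_div_pos.2 hy))))
    rw [← one_div]
    exact one_div_le_one_div_of_le hx hxa
  -- Having pieces for all large B allows one with 1/B ≤ a 0 and a n ≤ B.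
  obtain ⟨B, ⟨A₀, M, B₀, σ', hP, hsum⟩, hBn, hB0⟩ := (h.and ((eventually_ge_atTop (a n)).and
    (eventually_ge_atTop (a 0)⁻¹))).exists
  have hBpos : 0 < B := hP.pos
  have hBi : 0 < B⁻¹ := inv_pos.2 hBpos
  have hBa0 : B⁻¹ ≤ a 0 := inv_le_of_inv_le₀ ha0 hB0
  obtain ⟨v₁, hv₁d, hv₁⟩ := exists_entire_hasFP_of_analyticAt (G := K) han hBn
    fun x hx => hKinf x hx.1
  obtain ⟨v₀, hv₀d, hv₀⟩ := exists_entire_hasFP_of_analyticAt (G := K) hBi hBa0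
    fun x hx => hKzero x (hBi.trans_le hx.1) hx.2
  have hGa : ∀ (s : ℂ) (x : ℝ), 0 < x → AnalyticAt ℂ K x →
      AnalyticAt ℂ (fun z => K z * z ^ (s - 1)) x := fun s x hx hKx =>
    hKx.mul (analyticAt_cpow_sub_one hx s)
  have hM : ∀ s, M s = v₀ s + ∑ i ∈ Finset.range n, H i s + v₁ s := by
    intro s
    have h1 := (hasFP_of_chain (G := fun z => K z * z ^ (s - 1)) (fun i hi => hHad i hi s)
      (fun x hx => hreg s x (ha0.trans_le hx.1)) (hGa s _ han (hKinf _ le_rfl))).2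
    have hB1 := hGa s _ hBi (hKzero _ hBi hBa0)
    have hB2 := hGa s _ ha0 (hKzero _ ha0 le_rfl)
    have hB3 := hGa s _ han (hKinf _ le_rfl)
    have hB4 := hGa s _ hBpos (hKinf _ hBn)
    have h2 := HasFP.concat (G := fun z => K z * z ^ (s - 1))
      (fun x hx => hreg s x (hBi.trans_le hx.1)) hB1 hB2 hB3 (hv₀ s) h1
    exact (hP.hasFP s).unique (HasFP.concat (G := fun z => K z * z ^ (s - 1))
      (fun x hx => hreg s x (hBi.trans_le hx.1)) hB1 hB3 hB4 h2 (hv₁ s))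
  have hBeq : B' =ᶠ[𝓝[≠] y] fun s => B₀ s + v₁ s := by
    refine MeromorphicOn.eventuallyEq_of_lt_re hB'
      (hP.meromorphic_infinity.fun_add fun s _ => (hv₁d.analyticAt s).meromorphicAt)
      (σ := min (-σ) (-σ')) (fun s hs => ?_) y
    have h1 := (hinf s (hs.trans_le (min_le_left _ _))).shift hBn
    have h2 := hP.infinity s (hs.trans_le (min_le_right _ _))
    have h3 : ∫ t in a n..B, K t * (t : ℂ) ^ (s - 1) = v₁ s :=
      (hasFP_integral (G := fun z => K z * z ^ (s - 1)) hBn fun x hx =>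
        hGa s x (han.trans_le hx.1) (hKinf x hx.1)).unique (hv₁ s)
    rw [h2.unique h1, ← h3]
    exact (sub_add_cancel _ _).symm
  have hAeq : A =ᶠ[𝓝[≠] y] fun s => A₀ s + v₀ s := by
    refine MeromorphicOn.eventuallyEq_of_re_lt hA
      (hP.meromorphic_zero.fun_add fun s _ => (hv₀d.analyticAt s).meromorphicAt)
      (σ := max σ σ') (fun s hs => ?_) y
    have h1 : HasRegIntegralAtInfinity (fun t : ℝ => reflectMellin K s t) (a 0)⁻¹ (A s) :=
      hasRegIntegralAtZero_iff.1 (hzero s ((le_max_left _ _).trans_lt hs))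
    have h2 := hasRegIntegralAtZero_iff.1 (hP.zero s ((le_max_right _ _).trans_lt hs))
    rw [inv_inv] at h2
    have h3 := (hv₀ s).reflect hBi
    rw [inv_inv, ← funext (reflectMellin_ofReal K s)] at h3
    have h4 : ∫ t in (a 0)⁻¹..B, reflectMellin K s t = v₀ s := by
      refine (hasFP_integral (G := reflectMellin K s) hB0 fun x hx => ?_).unique h3
      have hx0 : 0 < x := (inv_pos.2 ha0).trans_le hx.1
      refine analyticAt_reflectMellin hx0 s (hKzero _ (one_div_pos.2 hx0) ?_)
      rw [one_div]
      exact inv_le_of_inv_le₀ ha0 hx.1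
    rw [h2.unique (h1.shift hB0), ← h4]
    exact (sub_add_cancel _ _).symm
  have hΛ' := (eventually_codiscreteWithin_iff isOpen_univ).1 hΛ y (Set.mem_univ y)
  filter_upwards [hΛ', hAeq, hBeq] with s h1 h2 h3
  rw [h1, h2, h3, ← hsum, hM]
  ring

end QMF

end

noncomputable section

namespace QMF

/-! ### The completed `L`-function as a sum of half-line contributions -/

/-- The sum of the contributions of `(t₀, ∞)` and, by inversion, of `(0, t₀)`. -/
def completedLValue (k : ℤ) (p : ℕ) (f : ℂ → ℂ) (Q : ℕ → ℂ → ℂ) (t₀ : ℝ) (s : ℂ) : ℂ :=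
  halfLineMellin f t₀ s +
    ∑ r ∈ Finset.range (p + 1), I ^ (k - r) * halfLineMellin (Q r) t₀⁻¹ (k - r - s)

theorem regularOrPole_toMeromorphicNFOn_I_mul (f : ℂ → ℂ) {x : ℝ} (hx : 0 < x) :
    RegularOrPole (fun z => toMeromorphicNFOn f upperHalf (I * z)) x := by
  refine RegularOrPole.comp_of_deriv_ne_zero (f := toMeromorphicNFOn f upperHalf)
    (g := fun z => I * z) ?_ (by fun_prop) ?_
  · have hmem : I * (x : ℂ) ∈ upperHalf := by simpa [upperHalf] using hx
    exact MeromorphicNFAt.regularOrPole (meromorphicNFOn_toMeromorphicNFOn f upperHalf hmem)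
  · have h : HasDerivAt (fun z : ℂ => I * z) (I * 1) x := (hasDerivAt_id _).const_mul I
    rw [h.deriv, mul_one]
    exact I_ne_zero

theorem IsPeriodicMeromorphic.analyticAt_of_poleOrder {g : ℂ → ℂ} (hg : IsPeriodicMeromorphic g)
    {τ : ℂ} (hτ : τ ∈ upperHalf) :
    poleOrder g τ = 0 ↔ AnalyticAt ℂ (toMeromorphicNFOn g upperHalf) τ := by
  rw [poleOrder_eq_zero_iff, ← meromorphicOrderAt_toMeromorphicNFOn hg.meromorphic hτ]
  exact (meromorphicNFOn_toMeromorphicNFOn g upperHalf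
    hτ).meromorphicOrderAt_nonneg_iff_analyticAt

theorem I_mul_mem_upperHalf {t : ℝ} (ht : 0 < t) : I * (t : ℂ) ∈ upperHalf := by
  simpa [upperHalf] using ht

theorem analyticAt_comp_I_mul {g : ℂ → ℂ} {t : ℝ} (h : AnalyticAt ℂ g (I * t)) :
    AnalyticAt ℂ (fun z => g (I * z)) t :=
  AnalyticAt.fun_comp (g := g) (f := fun z => I * z) h (by fun_prop)

namespace InversionData

variable {k : ℤ} {p : ℕ} {f : ℂ → ℂ} {Q : ℕ → ℂ → ℂ} (hf : InversionData k p f Q) {t₀ : ℝ}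
  (ht₀ : 0 < t₀)
  (hpole : ∀ r ∈ Finset.range (p + 1), poleOrder (Q r) (I * ((t₀⁻¹ : ℝ) : ℂ)) = 0)

include hf ht₀ hpole

/-- The inversion relation at i/t₀ expresses f near it₀ through functions regular at i/t₀. -/
theorem poleOrder_eq_zero : poleOrder f (I * t₀) = 0 := by
  have hi : 0 < t₀⁻¹ := inv_pos.2 ht₀
  have h := (hf.inversion_I_mul hi fun r hr => ((hf.component r hr).analyticAt_of_poleOrder
    (I_mul_mem_upperHalf hi)).1 (hpole r hr)).1
  rw [one_div, inv_inv] at h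
  exact (hf.periodic.analyticAt_of_poleOrder (I_mul_mem_upperHalf ht₀)).2 h

theorem meromorphicOn_completedLValue :
    MeromorphicOn (completedLValue k p f Q t₀) Set.univ := by
  intro s _
  refine MeromorphicAt.fun_add (hf.periodic.meromorphicOn_halfLineMellin ht₀
    (hf.poleOrder_eq_zero ht₀ hpole) s (Set.mem_univ s)) (MeromorphicAt.fun_sum fun r hr => ?_)
  have h1 := (hf.component r hr).meromorphicOn_halfLineMellin (inv_pos.2 ht₀) (hpole r hr)
    (k - r - s) (Set.mem_univ _)
  exact (MeromorphicAt.const _ _).fun_mul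
    (h1.comp_analyticAt (g := fun s : ℂ => (k - r - s : ℂ)) (by fun_prop))

theorem analyticAt_completedLValue {s : ℂ} (h0 : s = 0 → tildeCoeff f t₀ 0 = 0)
    (hr0 : ∀ r ∈ Finset.range (p + 1), s = k - r → tildeCoeff (Q r) t₀⁻¹ 0 = 0) :
    AnalyticAt ℂ (completedLValue k p f Q t₀) s := by
  refine AnalyticAt.fun_add (hf.periodic.analyticAt_halfLineMellin ht₀
    (hf.poleOrder_eq_zero ht₀ hpole) h0) (Finset.analyticAt_fun_sum _ fun r hr =>
      analyticAt_const.mul ?_)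
  exact AnalyticAt.fun_comp (g := halfLineMellin (Q r) t₀⁻¹) (f := fun s : ℂ => (k - r - s : ℂ))
    ((hf.component r hr).analyticAt_halfLineMellin (inv_pos.2 ht₀) (hpole r hr)
      fun h => hr0 r hr (sub_eq_zero.1 h).symm) (by fun_prop)

/-- The half-line results for f at t₀ and for the Q r at 1/t₀ are taken at a common B. Reflecting
the latter gives the parts over (0, 1/B) and (1/B, t₀). The auxiliary entire functions u and w
cancel in the total. -/
theorem exists_mellinPieces : ∀ᶠ B in atTop, ∃ A₀ M B₀ σ,
    MellinPieces (fun z => toMeromorphicNFOn f upperHalf (I * z)) B A₀ M B₀ σ ∧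
      ∀ s, A₀ s + M s + B₀ s = completedLValue k p f Q t₀ s := by
  have hi : 0 < t₀⁻¹ := inv_pos.2 ht₀
  have hpole₀ := hf.poleOrder_eq_zero ht₀ hpole
  have hQ : ∀ᶠ B in atTop, ∀ r ∈ Finset.range (p + 1), _ :=
    (Finset.eventually_all _).2 fun r hr => (hf.component r hr).mellin_halfLine hi (hpole r hr)
  filter_upwards [hQ, hf.periodic.mellin_halfLine ht₀ hpole₀] with B hB hBf
  obtain ⟨htB, hfa, u, hud, huFP, huInf⟩ := hBf
  have hiB : t₀⁻¹ < B := (hB 0 (by simp)).1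
  have hQa : ∀ t : ℝ, B ≤ t → ∀ r ∈ Finset.range (p + 1),
      AnalyticAt ℂ (toMeromorphicNFOn (Q r) upperHalf) (I * t) := fun t ht r hr =>
    (hB r hr).2.1 t ht
  have hex := fun r hr => (hB r hr).2.2
  choose! w hwd hwFP hwInf using hex
  have hB0 : 0 < B := hi.trans hiB
  have hBi : 0 < B⁻¹ := inv_pos.2 hB0
  have hBt₀ : B⁻¹ < t₀ := inv_lt_of_inv_lt₀ ht₀ hiB
  set K : ℂ → ℂ := fun z => toMeromorphicNFOn f upperHalf (I * z) with hK
  have hQ₀ : ∀ r ∈ Finset.range (p + 1),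
      AnalyticAt ℂ (toMeromorphicNFOn (Q r) upperHalf) (I * ((t₀⁻¹ : ℝ) : ℂ)) := fun r hr =>
    ((hf.component r hr).analyticAt_of_poleOrder (I_mul_mem_upperHalf hi)).1 (hpole r hr)
  have hKinf : ∀ t : ℝ, B ≤ t → AnalyticAt ℂ K t := fun t ht => analyticAt_comp_I_mul (hfa t ht)
  have hKt₀ : AnalyticAt ℂ K t₀ := analyticAt_comp_I_mul
    ((hf.periodic.analyticAt_of_poleOrder (I_mul_mem_upperHalf ht₀)).1 hpole₀)
  have hKzero : ∀ t : ℝ, 0 < t → t ≤ B⁻¹ → AnalyticAt ℂ K t := by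
    intro t ht htB
    have h1 : B ≤ 1 / t := by
      rw [one_div]
      exact le_inv_of_le_inv₀ ht htB
    have h2 := (hf.inversion_I_mul (one_div_pos.2 ht) (hQa _ h1)).1
    rw [one_div_one_div] at h2
    exact analyticAt_comp_I_mul h2
  have hrefl : ∀ (s : ℂ) (t : ℝ), 0 < t → (∀ r ∈ Finset.range (p + 1),
      AnalyticAt ℂ (toMeromorphicNFOn (Q r) upperHalf) (I * t)) →
      ∑ r ∈ Finset.range (p + 1), I ^ (k - r) *
        (toMeromorphicNFOn (Q r) upperHalf (I * t) * (t : ℂ) ^ ((k - r - s) - 1)) =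
      reflectMellin K s t := fun s t ht hQt => by
    rw [reflectMellin_ofReal, ← hf.reflected_integrand ht hQt s]
  -- The poles of the Q r on the axis, off which the inversion relation holds pointwise; neither end
  -- point of [1/t₀, B] is among them.
  obtain ⟨E, hE⟩ : ∃ E : Finset ℝ, ∀ x, x ∈ E ↔ x ∈ Set.Icc t₀⁻¹ B ∧ ∃ r ∈ Finset.range (p + 1),
      ¬ AnalyticAt ℂ (fun z => toMeromorphicNFOn (Q r) upperHalf (I * z)) (x : ℂ) := by
    choose D _ hD _ using fun r => exists_isFPPrim_poles
      (G := fun z => toMeromorphicNFOn (Q r) upperHalf (I * z)) (A := t₀⁻¹) (B := B)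
      fun x hx => regularOrPole_toMeromorphicNFOn_I_mul (Q r) (hi.trans_le hx.1)
    refine ⟨(Finset.range (p + 1)).biUnion D, fun x => ?_⟩
    simp only [Finset.mem_biUnion, hD]
    exact ⟨fun ⟨r, hr, hx, h⟩ => ⟨hx, r, hr, h⟩, fun ⟨hx, r, hr, h⟩ => ⟨r, hr, hx, h⟩⟩
  have hQE : ∀ t ∈ Set.Icc t₀⁻¹ B, t ∉ E → ∀ r ∈ Finset.range (p + 1),
      AnalyticAt ℂ (toMeromorphicNFOn (Q r) upperHalf) (I * t) := by
    intro t ht htE r hr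
    by_contra hcon
    refine htE ((hE t).2 ⟨ht, r, hr, fun h => hcon ?_⟩)
    have h1 := AnalyticAt.fun_comp
      (g := fun z => toMeromorphicNFOn (Q r) upperHalf (I * z)) (f := fun z => -I * z) (x := I * t)
      (by simpa [← mul_assoc] using h) (by fun_prop)
    simpa [← mul_assoc] using h1
  have hFP0 : ∀ s : ℂ, HasFP (fun t : ℝ => K t * (t : ℂ) ^ (s - 1)) B⁻¹ t₀
      (∑ r ∈ Finset.range (p + 1), I ^ (k - r) * w r (k - r - s)) := by
    intro s
    have h1 := HasFP.sum (Finset.range (p + 1)) hiB.le fun r hr =>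
      (hwFP r hr (k - r - s)).const_mul (I ^ (k - r))
    have h2 := h1.congr (g₂ := fun t : ℝ => reflectMellin K s t) E
      (fun h => by
        obtain ⟨-, r, hr, h2⟩ := (hE _).1 h
        exact h2 (analyticAt_comp_I_mul (hQ₀ r hr)))
      (fun h => by
        obtain ⟨-, r, hr, h2⟩ := (hE _).1 h
        exact h2 (analyticAt_comp_I_mul (hQa B le_rfl r hr)))
      (fun t ht htE => hrefl s t (hi.trans_le ht.1) (hQE t ht htE))
    have h3 := h2.reflect hi
    rw [inv_inv] at h3
    refine h3.congr ∅ (by simp) (by simp) fun t ht _ => ?_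
    have ht0 : (t : ℂ) ≠ 0 := ofReal_ne_zero.2 (hBi.trans_le ht.1).ne'
    rw [reflectMellin_ofReal, one_div_one_div]
    push_cast
    field_simp
  have hreg : ∀ (s : ℂ), ∀ x ∈ Set.Icc B⁻¹ B, RegularOrPole (fun z => K z * z ^ (s - 1)) x :=
    fun s x hx => (regularOrPole_toMeromorphicNFOn_I_mul f (hBi.trans_le hx.1)).mul_cpow
      (hBi.trans_le hx.1) s
  have hGa : ∀ (s : ℂ) (x : ℝ), 0 < x → AnalyticAt ℂ K x →
      AnalyticAt ℂ (fun z => K z * z ^ (s - 1)) x := fun s x hx hKx =>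
    hKx.mul (analyticAt_cpow_sub_one hx s)
  have hwm : ∀ r ∈ Finset.range (p + 1), MeromorphicOn (fun s : ℂ => w r (k - r - s)) Set.univ :=
    fun r hr s _ => (((hwd r hr).comp
      (by fun_prop : Differentiable ℂ fun s : ℂ => (k - r - s : ℂ))).analyticAt s).meromorphicAt
  refine ⟨fun s => ∑ r ∈ Finset.range (p + 1), I ^ (k - r) *
      (halfLineMellin (Q r) t₀⁻¹ (k - r - s) - w r (k - r - s)),
    fun s => ∑ r ∈ Finset.range (p + 1), I ^ (k - r) * w r (k - r - s) + u s,
    -- Re s > k makes Re(k - r - s) < 0 for all r ≥ 0, as the reflected tails require; Re s < 0 is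
    -- needed for the tail of f.
    fun s => halfLineMellin f t₀ s - u s, max k 0,
    ⟨hB0, fun s _ => MeromorphicAt.fun_sum fun r hr => ?_, fun s _ => ?_, hKzero, hKinf,
      fun s => ?_, fun s hs => ?_, fun s hs => ?_⟩, fun s => ?_⟩
  · have h1 := (hf.component r hr).meromorphicOn_halfLineMellin hi (hpole r hr)
      (k - r - s) (Set.mem_univ _)
    exact (MeromorphicAt.const _ _).fun_mul ((h1.comp_analyticAt
      (g := fun s : ℂ => (k - r - s : ℂ)) (by fun_prop)).fun_sub (hwm r hr s (Set.mem_univ s)))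
  · exact (hf.periodic.meromorphicOn_halfLineMellin ht₀ hpole₀ s (Set.mem_univ s)).fun_sub
      (hud.analyticAt s).meromorphicAt
  · exact HasFP.concat (G := fun z => K z * z ^ (s - 1)) (hreg s)
      (hGa s _ hBi (hKzero _ hBi le_rfl)) (hGa s _ ht₀ hKt₀) (hGa s _ hB0 (hKinf _ le_rfl))
      (hFP0 s) (huFP s)
  · rw [hasRegIntegralAtZero_iff, inv_inv]
    refine HasRegIntegralAtInfinity.congr_ae (HasRegIntegralAtInfinity.sum
      (Finset.range (p + 1)) fun r hr => (hwInf r hr (k - r - s) ?_).const_mul (I ^ (k - r))) ?_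
    · have h1 := (le_max_left (k : ℝ) 0).trans_lt hs
      have h2 : (0 : ℝ) ≤ r := Nat.cast_nonneg r
      simp only [sub_re, intCast_re, natCast_re]
      linarith
    · filter_upwards [ae_restrict_mem measurableSet_Ioi] with t ht
      exact hrefl s t (hB0.trans ht) (hQa t (le_of_lt ht))
  · exact huInf s (by linarith [le_max_right (k : ℝ) 0])
  · rw [completedLValue]
    simp only [mul_sub, Finset.sum_sub_distrib]
    ring

theorem isCompletedL_completedL : IsCompletedL f (completedL f) := by
  have hloc : ∀ t : ℝ, 0 < t → toMeromorphicNFOn f upperHalf =ᶠ[𝓝[≠] (I * t)] f := fun t ht =>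
    hf.periodic.meromorphic.toMeromorphicNFOn_eq_self_on_nhdsNE (I_mul_mem_upperHalf ht)
  have hex : ∃ Λ, IsCompletedL f Λ := by
    obtain ⟨B, A₀, M, B₀, σ, hP, hsum⟩ := (hf.exists_mellinPieces ht₀ hpole).exists
    obtain ⟨Λ, hΛ⟩ := hP.exists_isCompletedL
      (fun x hx => regularOrPole_toMeromorphicNFOn_I_mul f hx)
      (hf.meromorphicOn_completedLValue ht₀ hpole) hsum
    exact ⟨Λ, hΛ.congr hloc⟩
  rw [completedL, dif_pos hex]
  exact hex.choose_spec

/-- The two sides agree near s off s itself. The right-hand side is analytic at s, so the normal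
form on the left is analytic there too, and the values coincide. -/
theorem completedL_eq {s : ℂ} (h0 : s = 0 → tildeCoeff f t₀ 0 = 0)
    (hr0 : ∀ r ∈ Finset.range (p + 1), s = k - r → tildeCoeff (Q r) t₀⁻¹ 0 = 0) :
    completedL f s = completedLValue k p f Q t₀ s := by
  have hL := hf.isCompletedL_completedL ht₀ hpole
  have hloc : ∀ t : ℝ, 0 < t → f =ᶠ[𝓝[≠] (I * t)] toMeromorphicNFOn f upperHalf := fun t ht =>
    (hf.periodic.meromorphic.toMeromorphicNFOn_eq_self_on_nhdsNE (I_mul_mem_upperHalf ht)).symm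
  have he := (hL.congr hloc).eventuallyEq
    (fun x hx => regularOrPole_toMeromorphicNFOn_I_mul f hx)
    (hf.exists_mellinPieces ht₀ hpole) s
  have ha := hf.analyticAt_completedLValue ht₀ hpole h0 hr0
  refine eq_of_eventuallyEq_nhdsNE ?_ ha he
  refine (hL.1 (Set.mem_univ s)).meromorphicOrderAt_nonneg_iff_analyticAt.1 ?_
  rw [meromorphicOrderAt_congr he]
  exact ha.meromorphicOrderAt_nonneg

end InversionData

end QMF

end

/-! ### The theorem, assembled from the half-line contributions -/

theorem theorem8p6 (k : ℤ) (p : ℕ) (f : ℂ → ℂ) (F : ℕ → ℂ → ℂ)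
    (hf : QMF.IsMeromorphicQuasimodular k p f F) (t₀ : ℝ) (ht₀ : 0 < t₀)
    (hpole : ∀ r ≤ p, QMF.poleOrder (F r) (Complex.I * ((t₀⁻¹ : ℝ) : ℂ)) = 0) :
    QMF.IsCompletedL f (QMF.completedL f) ∧
    (∀ T ∈ ({t₀, t₀⁻¹} : Set ℝ),
      QMF.IsFourierExpansion (QMF.removePoles f T) T (QMF.tildeCoeff f T)) ∧
    (∀ r ∈ Finset.Icc 1 p,
      QMF.IsFourierExpansion (QMF.removePoles (F r) t₀⁻¹) t₀⁻¹ (QMF.tildeCoeff (F r) t₀⁻¹)) ∧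
    (∀ s : ℂ,
      Summable (QMF.gammaTerm (QMF.tildeCoeff f t₀) s t₀) ∧
      Summable (QMF.gammaTerm (QMF.tildeCoeff f t₀⁻¹) (k - s) t₀⁻¹) ∧
      ∀ r ∈ Finset.Icc 1 p,
        Summable (QMF.gammaTerm (QMF.tildeCoeff (F r) t₀⁻¹) (k - r - s) t₀⁻¹)) ∧
    ∀ s : ℂ,
      (s = 0 → QMF.tildeCoeff f t₀ 0 = 0) →
      (s = k → QMF.tildeCoeff f t₀⁻¹ 0 = 0) →
      (∀ r ∈ Finset.Icc 1 p, s = k - r → QMF.tildeCoeff (F r) t₀⁻¹ 0 = 0) →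
      QMF.completedL f s =
        -(QMF.tildeCoeff f t₀ 0 * ((t₀ : ℂ) ^ s / s)
          + QMF.tildeCoeff f t₀⁻¹ 0 * (Complex.I ^ k * (t₀ : ℂ) ^ (s - k) / (k - s)))
        + (∑' n, QMF.gammaTerm (QMF.tildeCoeff f t₀) s t₀ n
          + Complex.I ^ k * ∑' n, QMF.gammaTerm (QMF.tildeCoeff f t₀⁻¹) (k - s) t₀⁻¹ n)
        + QMF.poleTerm f s t₀ + Complex.I ^ k * QMF.poleTerm f (k - s) t₀⁻¹
        + ∑ r ∈ Finset.Icc 1 p,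
          (-(Complex.I ^ (k - r) * QMF.tildeCoeff (F r) t₀⁻¹ 0 * (t₀ : ℂ) ^ (-(k - r - s))
              / (k - r - s))
            + Complex.I ^ (k - r) *
              ∑' n, QMF.gammaTerm (QMF.tildeCoeff (F r) t₀⁻¹) (k - r - s) t₀⁻¹ n
            + Complex.I ^ (k - r) * QMF.poleTerm (F r) (k - r - s) t₀⁻¹) := by
  have hD := hf.inversionData
  set Q : ℕ → ℂ → ℂ := fun r => if r = 0 then f else F r with hQ
  have hi : 0 < t₀⁻¹ := inv_pos.2 ht₀
  have hQr : ∀ r ∈ Finset.Icc 1 p, Q r = F r := fun r hr => by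
    rw [Finset.mem_Icc] at hr
    exact if_neg (by omega)
  have hP : ∀ r ∈ Finset.range (p + 1), QMF.poleOrder (Q r) (Complex.I * ((t₀⁻¹ : ℝ) : ℂ)) = 0 := by
    intro r hr
    rw [Finset.mem_range] at hr
    rcases Nat.eq_zero_or_pos r with rfl | h
    · exact (QMF.poleOrder_congr (hf.eventuallyEq_component_zero
        (QMF.I_mul_mem_upperHalf hi))).trans (hpole 0 (Nat.zero_le p))
    · rw [hQr r (Finset.mem_Icc.2 ⟨h, by omega⟩)]
      exact hpole r (by omega)
  have hF : ∀ r ∈ Finset.Icc 1 p, QMF.IsPeriodicMeromorphic (F r) := fun r hr =>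
    hf.component_isPeriodicMeromorphic (Finset.mem_Icc.1 hr).2
  refine ⟨hD.isCompletedL_completedL ht₀ hP, ?_, fun r hr => (hF r hr).isFourierExpansion hi,
    fun s => ⟨hD.periodic.summable_gammaTerm ht₀ s, hD.periodic.summable_gammaTerm hi _,
      fun r hr => (hF r hr).summable_gammaTerm hi _⟩, fun s h0 hk hr => ?_⟩
  · rintro T (rfl | rfl)
    · exact hD.periodic.isFourierExpansion ht₀
    · exact hD.periodic.isFourierExpansion hi
  · have hcast : ∀ w : ℂ, ((t₀⁻¹ : ℝ) : ℂ) ^ w = (t₀ : ℂ) ^ (-w) := fun w => by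
      rw [Complex.ofReal_inv, Complex.inv_cpow _ _ (by
        rw [Complex.arg_ofReal_of_nonneg ht₀.le]; exact Real.pi_pos.ne), Complex.cpow_neg]
    rw [hD.completedL_eq ht₀ hP h0 fun r hr' hs => ?_]
    -- The summand r = 0 is the term with f at 1/t₀ and is displayed separately in the formula.
    · have hsum : ∀ φ : ℕ → ℂ, ∑ r ∈ Finset.range (p + 1), φ r =
          φ 0 + ∑ r ∈ Finset.Icc 1 p, φ r := fun φ => by
        rw [Finset.sum_range_eq_add_Ico _ (Nat.succ_pos p)]
        rfl
      rw [QMF.completedLValue, hsum, Finset.sum_congr rfl fun r hr => by rw [hQr r hr]]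
      simp only [QMF.halfLineMellin, hcast, hQ, if_true, Nat.cast_zero, sub_zero, neg_sub]
      have h1 : ∀ r ∈ Finset.Icc 1 p, Complex.I ^ (k - r : ℤ) *
          (QMF.poleTerm (F r) (k - r - s) t₀⁻¹ - QMF.tildeCoeff (F r) t₀⁻¹ 0 *
            ((t₀ : ℂ) ^ (s - (k - r : ℂ)) / (k - r - s)) +
            ∑' n, QMF.gammaTerm (QMF.tildeCoeff (F r) t₀⁻¹) (k - r - s) t₀⁻¹ n) =
          -(Complex.I ^ (k - r : ℤ) * QMF.tildeCoeff (F r) t₀⁻¹ 0 *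
            (t₀ : ℂ) ^ (s - (k - r : ℂ)) / (k - r - s))
            + Complex.I ^ (k - r : ℤ) *
              ∑' n, QMF.gammaTerm (QMF.tildeCoeff (F r) t₀⁻¹) (k - r - s) t₀⁻¹ n
            + Complex.I ^ (k - r : ℤ) * QMF.poleTerm (F r) (k - r - s) t₀⁻¹ := fun r _ => by ring
      rw [Finset.sum_congr rfl h1]
      ring
    · rcases Nat.eq_zero_or_pos r with rfl | h
      · exact hk (by simpa using hs)
      · have hmem : r ∈ Finset.Icc 1 p := Finset.mem_Icc.2 ⟨h, by rw [Finset.mem_range] at hr'; omega⟩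
        rw [hQr r hmem]
        exact hr r hmem hs
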